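/- Let $\mathbb K=\mathbb R$ or $\mathbb C$. **Super quantum Airy structures.** Let $V$ be a super vector space with homogeneous basis $\{x^i\}_{i\in I}$ and dual vectors $y_i\in V^*$, and let $\widetilde V=V\oplus\mathbb K^{0|1}$ be obtained by adding one odd basis vector. Let $\mathbb K[[\widetilde V,\hbar]]$ be the completion of the supercommutative polynomial algebra $\mathbb K[\widetilde V,\hbar]$ with respect to the powers of the ideal of elements of positive degree. Let $\widehat{\mathcal W}_\hbar(\widetilde V)$ be the completion, for pointwise convergence on $\mathbb K[[\widetilde V,\hbar]]$, of the algebra of differential operators generated by $\hbar$, the variables $x^a$ and the $\hbar\partial_a$; it is graded by $\deg x^a=\deg\hbar\partial_a=1$, $\deg\hbar=2$. Define $\widehat{\mathcal W}_\hbar(V)\subseteq\widehat{\mathcal W}_\hbar(\widetilde V)$ in the same way from the variables of $V$ only. A super quantum Airy structure is a pair $(V,L)$ with $L:V^*\to\widehat{\mathcal W}_\hbar(\widetilde V)$ linear, parity preserving and continuous ($V^*$ with pointwise convergence, $\mathbb K$ discrete), such that (i) the left ideal $\mathfrak L$ of $\widehat{\mathcal W}_\hbar(\widetilde V)$ generated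 by $L(V^*)$ satisfies $[\mathfrak L,\mathfrak L]\subseteq\hbar\,\mathfrak L$ for the supercommutator, and (ii) the part of $L(y_i)$ of degree at most $1$ is $\hbar\partial_i$ for all $i\in I$. **Modes.** Let $V$ have basis $x^0,x^1,\dots$ (even) and $\theta^1,\theta^2,\dots$ (odd), with dual vectors $y_0,y_1,\dots$ and $\eta_1,\eta_2,\dots$. Represent the super Heisenberg algebra $[b_k,b_l]=k\,\delta_{k,-l}$, $\{\psi_r,\psi_s\}=\delta_{r,-s}$, $[b_k,\psi_r]=0$ ($k,l\in\mathbb Z$, $r,s\in\mathbb Z+\frac12$) by $$b_m=\sqrt\hbar\,\frac{\partial}{\partial x^m},\quad b_{-m}=\frac{m}{\sqrt\hbar}\,x^m\ (m\ge1),\quad b_0=\sqrt\hbar\,\frac{\partial}{\partial x^0},\qquad \psi_r=\sqrt\hbar\,\frac{\partial}{\partial\theta^{r+1/2}},\quad \psi_{-r}=\frac1{\sqrt\hbar}\,\theta^{r+1/2}\ (r\in\mathbb Z_{\ge0}+\tfrac12).$$ Let ${:}b_kb_l{:}$ have the mode of smaller index on the left, and let ${:}\psi_r\psi_s{:}$ be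 $\psi_r\psi_s$ if $r\le s$ and $-\psi_s\psi_r$ if $r>s$. For $N\in\mathbb Z$, $i\in\mathbb Z_{\ge0}$ and $r\in\mathbb Z_{\ge0}+\frac12$ put $$H_i=\hbar\frac{\partial}{\partial x^i}+\frac\hbar2\sum_{k\in\mathbb Z}{:}b_kb_{i+N-1-k}{:}+\frac\hbar2\sum_{s\in\mathbb Z+\frac12}\Bigl(s+\frac{i+N-1}2\Bigr){:}\psi_{-s}\psi_{i+N-1+s}{:},\qquad F_r=\hbar\frac{\partial}{\partial\theta^{r+1/2}}+\hbar\sum_{m\in\mathbb Z}\psi_{r+N-1-m}b_m .$$ The sums converge pointwise; only products such as $\hbar\,b_kb_l=(\sqrt\hbar\, b_k)(\sqrt\hbar\, b_l)$ enter, which contain no negative or fractional power of $\hbar$. Consider the relations $$[H_m,H_n]=\hbar(m-n)H_{m+n+N-1},\quad [H_m,F_r]=\hbar\Bigl(\frac{m-N+1}2-r\Bigr)F_{m+r+N-1},\quad \{F_r,F_s\}=2\hbar\,H_{r+s+N-1}.\tag{$*$}$$ They are, after multiplication of the generators by $\hbar$, those of the elements $L_{i+N-1}\leftrightarrow H_i$,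 $G_{r+N-1}\leftrightarrow F_r$ of the Neveu–Schwarz super Virasoro algebra of central charge $\frac32$. (A term with vanishing coefficient on the right is read as $0$, also if its index lies outside the given range.) **Proposition.** Let $D_0,D_1,\dots$ and $C_0$ be arbitrary constants in $\mathbb K$. 1. Let $N\ge0$. There is a super quantum Airy structure $(V,H)$, with values in $\widehat{\mathcal W}_\hbar(V)$, such that $$H(y_i)=H_i+\hbar D_i\,\delta_{i\le N-1}\ (i\ge0),\qquad H(\eta_{r+1/2})=F_r\ (r\ge\tfrac12).$$ 2. Let $N\ge1$. There is a super quantum Airy structure $(V,H)$, with values in $\widehat{\mathcal W}_\hbar(V)$, such that $$H(y_i)=H_i+\hbar D_i\,\delta_{i\le N-1}\ (i\ge1),\quad H(\eta_{r+1/2})=F_r\ (r\ge\tfrac12),\quad H(y_0)=\hbar\frac{\partial}{\partial x^0}+\frac{\hbar^2}2C_0\frac{\partial^2}{\partial(x^0)^2}+\hbar D_0 .$$ 3. Let $N\ge-1$, and let $V_{red}\subset V$ be spanned by $x^0,x^1,\dots$ and $\theta^2,\theta^3,\dots$, so that $\widetilde V_{red}=V$ with $\theta^1$ as the extra fermionic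 variable. There is a super quantum Airy structure $(V_{red},H)$, with values in $\widehat{\mathcal W}_\hbar(V)$, such that $$H(y_i)=H_i+\hbar D_i\,\delta_{i\le N+1}\ (i\ge1),\quad H(\eta_{r+1/2})=F_r\ (r\ge\tfrac32),\quad H(y_0)=\hbar\frac{\partial}{\partial x^0}+\frac{\hbar^2}2C_0\frac{\partial^2}{\partial(x^0)^2}+\hbar D_0 .$$ In each case the elements $L_{i+N-1}$, $G_{r+N-1}$ with $i,r$ in the ranges given for $H_i$, $F_r$ span a subalgebra of the Neveu–Schwarz super Virasoro algebra, and the operators $H(y_i)$, $H(\eta_{r+1/2})$ with $i,r$ in these ranges represent it: they satisfy $(*)$ with $H_i$ replaced by $H_i+\hbar D_i\delta_{i\le N-1}$ in cases 1 and 2 and by $H_i+\hbar D_i\delta_{i\le N+1}$ in case 3. In cases 2 and 3 moreover $[H(y_0),H(y_i)]=[H(y_0),H(\eta_{r+1/2})]=0$ for $i$ and $r$ in these ranges. -/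

import Mathlib

noncomputable section

namespace SuperAiry

/-! ### Polynomials and formal series in even and odd variables and `ħ` -/

/-- Monomials `ħ ^ k * x ^ α * θ_S` in `ħ`, even variables `x^e` (`e : E`) and odd variables
`θ^o` (`o : O`); `θ_S` is the product of the `θ^o`, `o ∈ S`, in increasing order. -/
abbrev Mono (E O : Type*) := ℕ × (E →₀ ℕ) × Finset O

/-- The degree, with `deg x^e = deg θ^o = 1` and `deg ħ = 2`. -/
def Mono.deg {E O : Type*} (m : Mono E O) : ℕ := 2 * m.1 + m.2.1.degree + m.2.2.card

/-- Families of coefficients with finitely many nonzero entries in each degree. -/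
def seriesSubmodule (K E O : Type*) [Field K] : Submodule K (Mono E O → K) where
  carrier := {f | ∀ d : ℕ, {m | m.deg = d ∧ f m ≠ 0}.Finite}
  zero_mem' := fun d => by simp
  add_mem' := by
    intro f g hf hg d
    refine ((hf d).union (hg d)).subset ?_
    rintro m ⟨hm, hne⟩
    by_cases h : f m = 0
    · right
      refine ⟨hm, ?_⟩
      intro h'
      exact hne (by simp [h, h'])
    · exact Or.inl ⟨hm, h⟩
  smul_mem' := by
    intro c f hf d
    refine (hf d).subset ?_
    rintro m ⟨hm, hne⟩
    refine ⟨hm, ?_⟩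
    intro h
    exact hne (by simp [h])

/-- `K[[V, ħ]]`, for the super vector space `V` with basis `x^e`, `θ^o`: the completion of the
super-polynomial algebra `K[V, ħ]` for the powers of its ideal of elements of positive degree.
Its elements are the sequences of homogeneous polynomials, one for each degree. -/
def Series (K E O : Type*) [Field K] : Type _ := ↥(seriesSubmodule K E O)

section Series

variable {K E O : Type*} [Field K]

instance : AddCommGroup (Series K E O) := inferInstanceAs (AddCommGroup ↥(seriesSubmodule K E O))

instance : Module K (Series K E O) := inferInstanceAs (Module K ↥(seriesSubmodule K E O))

/-- The coefficient of a monomial. -/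
def Series.coeff (f : Series K E O) (m : Mono E O) : K := f.1 m

/-- The adic topology: `g` is close to `f` when both agree in all degrees below a large `n`. -/
instance : TopologicalSpace (Series K E O) where
  IsOpen U := ∀ f ∈ U, ∃ n : ℕ, ∀ g : Series K E O,
    (∀ m : Mono E O, m.deg < n → g.coeff m = f.coeff m) → g ∈ U
  isOpen_univ := fun _ _ => ⟨0, fun _ _ => trivial⟩
  isOpen_inter := by
    rintro U V hU hV f ⟨hfU, hfV⟩
    obtain ⟨n, hn⟩ := hU f hfU
    obtain ⟨k, hk⟩ := hV f hfV
    exact ⟨max n k, fun g hg => ⟨hn g fun m hm => hg m (lt_of_lt_of_le hm (le_max_left _ _)),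
      hk g fun m hm => hg m (lt_of_lt_of_le hm (le_max_right _ _))⟩⟩
  isOpen_sUnion := by
    rintro 𝒰 h𝒰 f ⟨U, hU, hf⟩
    obtain ⟨n, hn⟩ := h𝒰 U hU f hf
    exact ⟨n, fun g hg => ⟨U, hU, hn g hg⟩⟩

/-- The part of a series in degrees `≥ n`. -/
def Series.truncGE (n : ℕ) : Series K E O →ₗ[K] Series K E O where
  toFun f := ⟨fun m => if n ≤ m.deg then f.coeff m else 0, by
    intro d
    refine (f.2 d).subset ?_
    rintro m ⟨hm, hne⟩
    refine ⟨hm, ?_⟩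
    intro h
    exact hne (by simp [Series.coeff, h])⟩
  map_add' f g := by
    apply Subtype.ext
    funext m
    change (if _ then (f.1 m + g.1 m) else 0) = (if _ then f.1 m else 0) + (if _ then g.1 m else 0)
    split_ifs <;> simp
  map_smul' c f := by
    apply Subtype.ext
    funext m
    change (if _ then (c * f.1 m) else 0) = c * (if _ then f.1 m else 0)
    split_ifs <;> simp

end Series

/-! ### Differential operators -/

/-- Linear operators on `K[[V, ħ]]`; products are compositions. -/
abbrev Op (K E O : Type*) [Field K] := Module.End K (Series K E O)

section Operators

variable {K E O : Type*} [Field K]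

/-- The topology of pointwise convergence. -/
instance : TopologicalSpace (Op K E O) :=
  TopologicalSpace.induced (fun (T : Op K E O) (f : Series K E O) => T f) inferInstance

/-- The operator `f ↦ (m ↦ c m * f (g m))`, in terms of coefficients. -/
def substOp (c : Mono E O → K) (g : Mono E O → Mono E O) (δ : ℕ → ℕ)
    (hinj : Set.InjOn g {m | c m ≠ 0}) (hdeg : ∀ m, c m ≠ 0 → (g m).deg = δ m.deg) :
    Op K E O where
  toFun f := ⟨fun m => c m * f.coeff (g m), by
    intro d
    refine Set.Finite.of_finite_image ((f.2 (δ d)).subset ?_) (f := g) ?_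
    · rintro _ ⟨m, ⟨hm, hne⟩, rfl⟩
      refine ⟨?_, right_ne_zero_of_mul hne⟩
      rw [hdeg m (left_ne_zero_of_mul hne), hm]
    · exact hinj.mono fun m hm => left_ne_zero_of_mul hm.2⟩
  map_add' f g' := by
    apply Subtype.ext
    funext m
    exact mul_add _ _ _
  map_smul' a f := by
    apply Subtype.ext
    funext m
    exact mul_left_comm _ _ _

/-- Multiplication by `ħ`. -/
def hbar : Op K E O :=
  substOp (fun m => if m.1 = 0 then 0 else 1) (fun m => (m.1 - 1, m.2)) (fun d => d - 2)
    (by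
      rintro ⟨k, p⟩ hk ⟨l, q⟩ hl h
      simp only [ne_eq, Set.mem_ofPred_eq, ite_eq_left_iff, one_ne_zero, imp_false, not_not]
        at hk hl
      simp only [Prod.mk.injEq] at h ⊢
      exact ⟨by omega, h.2⟩)
    (by
      rintro ⟨k, p⟩ hk
      simp only [ne_eq, ite_eq_left_iff, one_ne_zero, imp_false, not_not] at hk
      simp only [Mono.deg]
      omega)

/-- Multiplication by the even variable `x^e`. -/
def mulX (e : E) : Op K E O :=
  substOp (fun m => if m.2.1 e = 0 then 0 else 1)
    (fun m => (m.1, m.2.1 - Finsupp.single e 1, m.2.2)) (fun d => d - 1)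
    (by
      rintro ⟨k, α, S⟩ hk ⟨l, β, S'⟩ hl h
      simp only [ne_eq, Set.mem_ofPred_eq, ite_eq_left_iff, one_ne_zero, imp_false, not_not]
        at hk hl
      simp only [Prod.mk.injEq] at h ⊢
      refine ⟨h.1, ?_, h.2.2⟩
      have h1 : Finsupp.single e 1 ≤ α := by
        rw [Finsupp.single_le_iff]; omega
      have h2 : Finsupp.single e 1 ≤ β := by
        rw [Finsupp.single_le_iff]; omega
      rw [← tsub_add_cancel_of_le h1, h.2.1, tsub_add_cancel_of_le h2])
    (by
      rintro ⟨k, α, S⟩ hk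
      simp only [ne_eq, ite_eq_left_iff, one_ne_zero, imp_false, not_not] at hk
      have h1 : Finsupp.single e 1 ≤ α := by
        rw [Finsupp.single_le_iff]; omega
      have h2 : α.degree = (α - Finsupp.single e 1).degree + 1 := by
        conv_lhs => rw [← tsub_add_cancel_of_le h1]
        simp
      simp only [Mono.deg]
      omega)

/-- The derivative `∂/∂x^e`. -/
def derX (e : E) : Op K E O :=
  substOp (fun m => ((m.2.1 e + 1 : ℕ) : K))
    (fun m => (m.1, m.2.1 + Finsupp.single e 1, m.2.2)) (fun d => d + 1)
    (by
      rintro ⟨k, α, S⟩ - ⟨l, β, S'⟩ - h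
      simpa using h)
    (by
      rintro ⟨k, α, S⟩ -
      simp only [Mono.deg, map_add, Finsupp.degree_single]
      omega)

variable [LinearOrder O]

/-- The sign of moving `θ^o` past the factors `θ^p`, `p < o`, of `θ_S`. -/
def oddSign (K : Type*) [Field K] (o : O) (S : Finset O) : K := (-1) ^ (S.filter (· < o)).card

/-- Left multiplication by the odd variable `θ^o`. -/
def mulTheta (o : O) : Op K E O :=
  substOp (fun m => if o ∈ m.2.2 then oddSign K o m.2.2 else 0)
    (fun m => (m.1, m.2.1, m.2.2.erase o)) (fun d => d - 1)
    (by
      rintro ⟨k, α, S⟩ hk ⟨l, β, S'⟩ hl h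
      have h1 : o ∈ S := by
        by_contra h'
        exact hk (if_neg h')
      have h2 : o ∈ S' := by
        by_contra h'
        exact hl (if_neg h')
      simp only [Prod.mk.injEq] at h ⊢
      refine ⟨h.1, h.2.1, ?_⟩
      rw [← Finset.insert_erase h1, h.2.2, Finset.insert_erase h2])
    (by
      rintro ⟨k, α, S⟩ hk
      have h1 : o ∈ S := by
        by_contra h'
        exact hk (if_neg h')
      have h2 := Finset.card_erase_add_one h1
      simp only [Mono.deg]
      omega)

/-- The left derivative `∂/∂θ^o`. -/
def derTheta (o : O) : Op K E O :=
  substOp (fun m => if o ∈ m.2.2 then 0 else oddSign K o m.2.2)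
    (fun m => (m.1, m.2.1, insert o m.2.2)) (fun d => d + 1)
    (by
      rintro ⟨k, α, S⟩ hk ⟨l, β, S'⟩ hl h
      have h1 : o ∉ S := by
        intro h'
        exact hk (if_pos h')
      have h2 : o ∉ S' := by
        intro h'
        exact hl (if_pos h')
      simp only [Prod.mk.injEq] at h ⊢
      refine ⟨h.1, h.2.1, ?_⟩
      rw [← Finset.erase_insert h1, h.2.2, Finset.erase_insert h2])
    (by
      rintro ⟨k, α, S⟩ hk
      have h1 : o ∉ S := by
        intro h'
        exact hk (if_pos h')
      have h2 := Finset.card_insert_of_notMem h1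
      simp only [Mono.deg]
      omega)

/-- Left multiplication by a basis vector of `V`. -/
def mulVar : E ⊕ O → Op K E O
  | Sum.inl e => mulX e
  | Sum.inr o => mulTheta o

/-- Left derivative with respect to a basis vector of `V`. -/
def derVar : E ⊕ O → Op K E O
  | Sum.inl e => derX e
  | Sum.inr o => derTheta o

/-- The algebra of the finite sums of operators
`c ħ^(m+k) x^{i_1} ⋯ x^{i_n} ∂_{j_1} ⋯ ∂_{j_m}`, `k ≥ 0`, in the variables from `s`. -/
def weylFinite (K : Type*) [Field K] (s : Set (E ⊕ O)) : Subalgebra K (Op K E O) :=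
  Algebra.adjoin K ({hbar} ∪ mulVar '' s ∪ (fun a => hbar * derVar a) '' s)

/-- The completed Weyl algebra in the variables from `s`: the closure of `weylFinite K s` for
pointwise convergence on the complete space `K[[V, ħ]]`. An infinite sum
`ħ^(m+k) ∑ c_I^J x^I ∂_J` with, for each `J` of length `m`, finitely many nonzero `c_I^J`, `I` of
length `n`, is the pointwise limit of its finite partial sums (only finitely many `∂_J` act
nontrivially on a polynomial), so closing up the algebra that contains these infinite sums as well
gives the same completion. -/
def weylHat (K : Type*) [Field K] (s : Set (E ⊕ O)) : Set (Op K E O) :=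
  closure (weylFinite K s : Set (Op K E O))

end Operators

/-! ### Parity, supercommutator, and degree of operators -/

section Grading

variable {K E O : Type*} [Field K]

/-- The parity involution of `K[[V, ħ]]`: `+1` on even and `-1` on odd elements. -/
def parity : Op K E O :=
  substOp (fun m => (-1) ^ m.2.2.card) id id (Function.injective_id.injOn) (fun _ _ => rfl)

/-- The operator preserves parity. -/
def IsEvenOp (T : Op K E O) : Prop := parity * T * parity = T

/-- The operator exchanges parity. -/
def IsOddOp (T : Op K E O) : Prop := parity * T * parity = -T

/-- The even component of an operator. -/
def evenPart (T : Op K E O) : Op K E O := (2⁻¹ : K) • (T + parity * T * parity)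

/-- The odd component of an operator. -/
def oddPart (T : Op K E O) : Op K E O := (2⁻¹ : K) • (T - parity * T * parity)

/-- The supercommutator: bilinear, and `T S - (-1)^(|T||S|) S T` on homogeneous operators. -/
def superComm (T S : Op K E O) : Op K E O :=
  (evenPart T * evenPart S - evenPart S * evenPart T)
    + (evenPart T * oddPart S - oddPart S * evenPart T)
    + (oddPart T * evenPart S - evenPart S * oddPart T)
    + (oddPart T * oddPart S + oddPart S * oddPart T)

/-- The part `T^{≤ n}` of degree at most `n` of an operator, where `T` has degree `d` if it maps
elements of degree `p` to elements of degree `p + d`: the coefficient of `T^{≤ n} f` at a monomial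
of degree `q` is that of `T` applied to the components of `f` of degree `p` with `q ≤ p + n`. -/
def degLE (n : ℕ) (T : Op K E O) : Op K E O where
  toFun f := ⟨fun m => (T (Series.truncGE (m.deg - n) f)).coeff m, by
    intro d
    refine ((T (Series.truncGE (d - n) f)).2 d).subset ?_
    rintro m ⟨hm, hne⟩
    subst hm
    exact ⟨rfl, hne⟩⟩
  map_add' f g := by
    apply Subtype.ext
    funext m
    change (T (Series.truncGE (m.deg - n) (f + g))).1 m = _
    rw [map_add, map_add]
    rfl
  map_smul' c f := by
    apply Subtype.ext
    funext m
    change (T (Series.truncGE (m.deg - n) (c • f))).1 m = _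
    rw [map_smul, map_smul]
    rfl

end Grading

/-! ### Super quantum Airy structures -/

section Airy

variable {K E O : Type*} [Field K] [LinearOrder O]

/-- The left ideal of the completed Weyl algebra generated by the operators `L φ`. -/
def leftIdeal {P : Type*} (L : P → Op K E O) : Submodule K (Op K E O) :=
  Submodule.span K {T | ∃ A ∈ weylHat K (Set.univ : Set (E ⊕ O)), ∃ φ : P, T = A * L φ}

/-- The basis vectors of `V` as basis vectors of `V ⊕ K^{0|1}`, whose additional odd variable is
`θ^⊥`. -/
def inclVar : E ⊕ O → E ⊕ WithBot O := Sum.map id (fun o => (o : WithBot O))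

/-- Super quantum Airy structures `(V, L)`, where `V` has an even basis indexed by `E` and an odd
basis indexed by `O`. The dual `V^*` is the space of all families of coefficients `E ⊕ O → K`, the
dual vector of the basis vector `a` being `Pi.single a 1`; it carries the topology of pointwise
convergence, that is the product of the discrete topologies. -/
structure IsSuperQuantumAiry [DecidableEq E]
    (L : (E ⊕ O → K) →ₗ[K] Op K E (WithBot O)) : Prop where
  mem_weylHat : ∀ φ, L φ ∈ weylHat K (Set.univ : Set (E ⊕ WithBot O))
  map_even : ∀ φ, (∀ o, φ (Sum.inr o) = 0) → IsEvenOp (L φ)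
  map_odd : ∀ φ, (∀ e, φ (Sum.inl e) = 0) → IsOddOp (L φ)
  continuous : @Continuous _ _ (@Pi.topologicalSpace (E ⊕ O) (fun _ => K) (fun _ => ⊥))
    inferInstance L
  involutive : ∀ A ∈ leftIdeal L, ∀ B ∈ leftIdeal L, ∃ C ∈ leftIdeal L, superComm A B = hbar * C
  degLE_one : ∀ a : E ⊕ O, degLE 1 (L (Pi.single a 1)) = hbar * derVar (inclVar a)

end Airy

/-! ### The Neveu–Schwarz super Virasoro algebra -/

/-- Basis of the algebra: `L n`, `G k` (which is `G_r` with `r = k + 1/2`) and the central `one`. -/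
inductive NS where
  | L : ℤ → NS
  | G : ℤ → NS
  | one : NS

/-- The brackets of basis vectors, for the central charge `3/2`. -/
def nsBasisBracket (K : Type*) [Field K] : NS → NS → (NS →₀ K)
  | NS.L m, NS.L n => Finsupp.single (NS.L (m + n)) ((m : K) - n)
      + if m + n = 0 then Finsupp.single NS.one (8⁻¹ * (m : K) * ((m : K) ^ 2 - 1)) else 0
  | NS.L n, NS.G k => Finsupp.single (NS.G (n + k)) ((n : K) / 2 - (k + 2⁻¹))
  | NS.G k, NS.L n => -Finsupp.single (NS.G (n + k)) ((n : K) / 2 - (k + 2⁻¹))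
  | NS.G k, NS.G l => Finsupp.single (NS.L (k + l + 1)) (2 : K)
      + if k + l + 1 = 0 then Finsupp.single NS.one (2⁻¹ * (((k : K) + 2⁻¹) ^ 2 - 4⁻¹)) else 0
  | NS.one, _ => 0
  | _, NS.one => 0

/-- The bilinear bracket. -/
def nsBracket (K : Type*) [Field K] : (NS →₀ K) →ₗ[K] (NS →₀ K) →ₗ[K] (NS →₀ K) :=
  Finsupp.linearCombination K fun a => Finsupp.linearCombination K (nsBasisBracket K a)

/-- The basis vectors `L_{i+N-1}`, `i ∈ ev`, and `G_{r+N-1}`, `r = k + 1/2`, `k ∈ od`. -/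
def nsIndices (N : ℤ) (ev od : Set ℤ) : Set NS :=
  (fun i => NS.L (i + N - 1)) '' ev ∪ (fun k => NS.G (k + N - 1)) '' od

/-! ### The untwisted free boson–fermion representation -/

section Modes

variable {K O : Type*} [Field K] [LinearOrder O]

/-- The rescaled bosonic modes `J_k = √ħ b_k`: `ħ ∂/∂x^k` for `k ≥ 0`, and `m x^m` for `k = -m < 0`.
With this scaling `:J_k J_l: = ħ :b_k b_l:`. -/
def bosMode (k : ℤ) : Op K ℕ O :=
  if 0 ≤ k then hbar * derX k.toNat else (k.natAbs : K) • mulX k.natAbs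

/-- The rescaled fermionic modes `χ_r = √ħ ψ_r`, `r = k + 1/2`, where `θ^{n+1}` is the odd variable
with label `t n`: `ħ ∂/∂θ^{r + 1/2}` for `r > 0`, and `θ^{-r + 1/2}` for `r < 0`. -/
def ferMode (t : ℕ → O) (k : ℤ) : Op K ℕ O :=
  if 0 ≤ k then hbar * derTheta (t k.toNat) else mulTheta (t (-k - 1).toNat)

/-- The normally ordered product `:J_k J_l:`. -/
def bosNormal (k l : ℤ) : Op K ℕ O :=
  if k ≤ l then bosMode k * bosMode l else bosMode l * bosMode k

/-- The normally ordered product `:χ_r χ_s:`, `r = k + 1/2`, `s = l + 1/2`. -/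
def ferNormal (t : ℕ → O) (k l : ℤ) : Op K ℕ O :=
  if k ≤ l then ferMode t k * ferMode t l else -(ferMode t l * ferMode t k)

/-- The terms of the bosonic part of `2 ħ L_n`. -/
def bosTerm (n k : ℤ) : Op K ℕ O := bosNormal k (n - k)

/-- The terms `(r + n/2) :χ_{-r} χ_{n+r}:`, `r = k + 1/2`, of the fermionic part of `2 ħ L_n`. -/
def ferTerm (t : ℕ → O) (n k : ℤ) : Op K ℕ O :=
  ((k : K) + 2⁻¹ + (n : K) / 2) • ferNormal t (-k - 1) (n + k)

/-- The terms `χ_{r-m} J_m`, `r = k + 1/2`, of `ħ G_r`. -/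
def superTerm (t : ℕ → O) (k m : ℤ) : Op K ℕ O := ferMode t (k - m) * bosMode m

/-- `H_i = ħ ∂/∂x^i + (ħ/2) ∑_k :b_k b_{i+N-1-k}: + (ħ/2) ∑_r (r + (i+N-1)/2) :ψ_{-r} ψ_{i+N-1+r}:`;
note that `J_i = ħ ∂/∂x^i` for `i ≥ 0`. Sums converge pointwise. -/
def opH (t : ℕ → O) (N i : ℤ) : Op K ℕ O :=
  bosMode i + (2⁻¹ : K) • (∑' k : ℤ, bosTerm (i + N - 1) k)
    + (2⁻¹ : K) • (∑' k : ℤ, ferTerm t (i + N - 1) k)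

/-- `F_r = ħ ∂/∂θ^{r+1/2} + ħ ∑_m ψ_{r+N-1-m} b_m`, `r = k + 1/2`; note that
`χ_r = ħ ∂/∂θ^{r+1/2}` for `r > 0`. -/
def opF (t : ℕ → O) (N k : ℤ) : Op K ℕ O :=
  ferMode t k + ∑' m : ℤ, superTerm t (k + N - 1) m

/-- `H_i + ħ D_i δ_{i ≤ R}`. -/
def opHD (t : ℕ → O) (N R : ℤ) (D : ℕ → K) (i : ℤ) : Op K ℕ O :=
  opH t N i + if i ≤ R then D i.toNat • hbar else 0

/-- The auxiliary operator `ħ ∂/∂x^0 + (ħ²/2) C₀ ∂²/∂(x^0)² + ħ D₀`. -/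
def opAux (C₀ D₀ : K) : Op K ℕ O :=
  hbar * derX 0 + (C₀ / 2) • (hbar ^ 2 * derX 0 ^ 2) + D₀ • hbar

/-- The rescaled modes represent the super Heisenberg algebra:
`[J_k, J_l] = ħ k δ_{k,-l}`, `{χ_r, χ_s} = ħ δ_{r,-s}`, `[J_k, χ_r] = 0`. -/
def IsSuperHeisenberg (K : Type*) [Field K] (t : ℕ → O) : Prop :=
  (∀ k l : ℤ, superComm (bosMode k : Op K ℕ O) (bosMode l)
      = if k + l = 0 then (k : K) • hbar else 0) ∧
  (∀ k l : ℤ, superComm (ferMode t k : Op K ℕ O) (ferMode t l)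
      = if k + l + 1 = 0 then hbar else 0) ∧
  (∀ k l : ℤ, superComm (bosMode k : Op K ℕ O) (ferMode t l) = 0)

/-- The sums that define the operators `H_i` and `F_r` converge. -/
def ModeSumsConverge (K : Type*) [Field K] (t : ℕ → O) : Prop :=
  ∀ n : ℤ, Summable (fun k : ℤ => (bosTerm n k : Op K ℕ O)) ∧
    Summable (fun k : ℤ => (ferTerm t n k : Op K ℕ O)) ∧
    Summable (fun m : ℤ => (superTerm t n m : Op K ℕ O))

/-- The map `L_{i+N-1} ↦ H i`, `G_{r+N-1} ↦ F_r` on the span of the corresponding basis vectors of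
the super Virasoro algebra. -/
def nsMap (N : ℤ) (H F : ℤ → Op K ℕ O) : (NS →₀ K) →ₗ[K] Op K ℕ O :=
  Finsupp.linearCombination K fun
    | NS.L n => H (n - N + 1)
    | NS.G k => F (k - N + 1)
    | NS.one => 0

/-- The operators `H i`, `i ∈ ev`, and `F k` (that is `F_r`, `r = k + 1/2`), `k ∈ od`, represent,
up to the rescaling by `ħ`, the subalgebra of the Neveu–Schwarz super Virasoro algebra spanned by
the `L_{i+N-1}` and the `G_{r+N-1}`: this span is closed under the bracket, the operators satisfy
its commutation relations, and these are the ones displayed. -/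
structure RepresentsNS (N : ℤ) (ev od : Set ℤ) (H F : ℤ → Op K ℕ O) : Prop where
  closed : ∀ a ∈ Finsupp.supported K K (nsIndices N ev od),
    ∀ b ∈ Finsupp.supported K K (nsIndices N ev od),
      nsBracket K a b ∈ Finsupp.supported K K (nsIndices N ev od)
  map_bracket : ∀ a ∈ Finsupp.supported K K (nsIndices N ev od),
    ∀ b ∈ Finsupp.supported K K (nsIndices N ev od),
      superComm (nsMap N H F a) (nsMap N H F b) = hbar * nsMap N H F (nsBracket K a b)
  comm_HH : ∀ m ∈ ev, ∀ n ∈ ev,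
    superComm (H m) (H n) = ((m : K) - n) • (hbar * H (m + n + N - 1))
  comm_HF : ∀ m ∈ ev, ∀ k ∈ od,
    superComm (H m) (F k)
      = (((m : K) - N + 1) / 2 - ((k : K) + 2⁻¹)) • (hbar * F (m + k + N - 1))
  comm_FF : ∀ k ∈ od, ∀ l ∈ od,
    superComm (F k) (F l) = (2 : K) • (hbar * H (k + l + N))

end Modes

/-- Labels of the odd variables when `θ^1, θ^2, …` are the odd basis vectors of `V` (and `⊥` labels
an additional odd variable, on which the operators do not depend). -/
def thetaPlain (n : ℕ) : WithBot ℕ := (n : WithBot ℕ)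

/-- Labels of the odd variables when `θ^2, θ^3, …` are the odd basis vectors of `V` and `θ^1` is the
extra fermionic variable. -/
def thetaExtra : ℕ → WithBot ℕ
  | 0 => ⊥
  | n + 1 => (n : WithBot ℕ)

end SuperAiry

end

open SuperAiry

noncomputable section

namespace SuperAiry

open Topology Filter

/-! ### Degree filtration, pointwise convergence and homogeneous operators. -/

section Topological

variable {K E O : Type*} [Field K]

/-! Write J_k, χ_r for the rescaled modes and ħL_n, ħG_r for the quadratic sums (`virL`, `virG`), so
that H_i = J_i + ħL_{i+N-1} and F_r = χ_r + ħG_{r+N-1}. The proof has two independent halves.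

Commutation relations. The brackets of ħL_n and ħG_r with a single mode are again ħ times a single
mode, because only one or two terms of each sum contribute. The brackets of the quadratic operators
with each other are then found without multiplying two infinite sums. By the Jacobi identity
(`bracket_sub_mul_comm`) the difference between a bracket and its expected value commutes, up to
sign, with multiplication by every variable. For indices n, r ≥ -1 it also annihilates the constant
1, and an operator with these two properties vanishes (`Filtered.eq_zero_of_comm`). This restriction
on the indices is the reason why no central term occurs. The linear terms fit in because [J_m, ħL]
and [ħL, J_n] add up to the linear term of the operator on the right, and similarly for the odd
modes. The constants D_i are free because an H_i with i ≤ R never occurs on the right with nonzero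
coefficient. The auxiliary operator is a polynomial in ħ and J_0, and J_0 commutes with all modes.

Airy structure. `airyMap` extends a locally finite family of operators to all of V^* by infinite
sums. The relations extend to these sums since each operator occurs on the right of finitely many of
them (`exists_superComm_airyMap`). The left ideal generated is closed under brackets modulo the
factor ħ by the graded Leibniz rule (`superComm_mul_mul`), as supercommutators in the completed Weyl
algebra are themselves divisible by ħ (`superComm_mem_hbar_weylHat`). Everything besides the linear
terms has degree 2, which gives the normalization of the part of degree at most 1.

All three families are instances of `famOp`, with lower bounds e₀ and o₀ for the even and odd
indices and a bound R for the constants. -/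

@[ext] theorem Series.ext {f g : Series K E O} (h : ∀ m, f.coeff m = g.coeff m) : f = g :=
  Subtype.ext (funext h)

@[simp] theorem Series.coeff_add (f g : Series K E O) (m : Mono E O) :
    (f + g).coeff m = f.coeff m + g.coeff m := rfl

@[simp] theorem Series.coeff_sub (f g : Series K E O) (m : Mono E O) :
    (f - g).coeff m = f.coeff m - g.coeff m := rfl

@[simp] theorem Series.coeff_neg (f : Series K E O) (m : Mono E O) :
    (-f).coeff m = -f.coeff m := rfl

@[simp] theorem Series.coeff_zero (m : Mono E O) : (0 : Series K E O).coeff m = 0 := rfl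

@[simp] theorem Series.coeff_smul (c : K) (f : Series K E O) (m : Mono E O) :
    (c • f).coeff m = c * f.coeff m := rfl

/-- The coefficient of a monomial as a linear form. -/
def Series.coeffₗ (m : Mono E O) : Series K E O →ₗ[K] K where
  toFun f := f.coeff m
  map_add' _ _ := rfl
  map_smul' _ _ := rfl

@[simp] theorem Series.coeff_sum {ι : Type*} (s : Finset ι) (f : ι → Series K E O)
    (m : Mono E O) : (∑ i ∈ s, f i).coeff m = ∑ i ∈ s, (f i).coeff m :=
  map_sum (Series.coeffₗ m) f s

/-- The series without terms of degree less than `p`. -/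
def Series.filt (p : ℕ) : Submodule K (Series K E O) where
  carrier := {f | ∀ m : Mono E O, m.deg < p → f.coeff m = 0}
  zero_mem' := fun _ _ => rfl
  add_mem' := fun hf hg m hm => by simp [hf m hm, hg m hm]
  smul_mem' := fun c f hf m hm => by simp [hf m hm]

theorem Series.eq_zero_of_mem_filt {f : Series K E O} (h : ∀ p, f ∈ Series.filt p) : f = 0 :=
  Series.ext fun m => h (m.deg + 1) m (Nat.lt_succ_self _)

theorem Series.nhds_hasBasis (f : Series K E O) :
    (𝓝 f).HasBasis (fun _ : ℕ => True) (fun p => {g | g - f ∈ Series.filt p}) := by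
  refine ⟨fun U => ?_⟩
  rw [mem_nhds_iff]
  constructor
  · rintro ⟨V, hVU, hV, hf⟩
    obtain ⟨n, hn⟩ := hV f hf
    exact ⟨n, trivial, fun g hg => hVU (hn g fun m hm => sub_eq_zero.1 (hg m hm))⟩
  · rintro ⟨p, -, hp⟩
    refine ⟨_, hp, fun g hg => ⟨p, fun k hk m hm => ?_⟩, by simp⟩
    have := hg m hm
    rw [Series.coeff_sub] at this ⊢
    rw [hk m hm, this]

instance : IsTopologicalAddGroup (Series K E O) where
  continuous_add := continuous_iff_continuousAt.2 fun ⟨a, b⟩ => by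
    refine (((Series.nhds_hasBasis a).prod_nhds (Series.nhds_hasBasis b)).tendsto_iff
      (Series.nhds_hasBasis _)).2 fun p _ => ⟨(p, p), ⟨trivial, trivial⟩, ?_⟩
    rintro ⟨g, k⟩ ⟨hg, hk⟩
    have : g + k - (a + b) = (g - a) + (k - b) := by abel
    change g + k - (a + b) ∈ Series.filt p
    exact this ▸ add_mem hg hk
  continuous_neg := continuous_iff_continuousAt.2 fun a => by
    refine ((Series.nhds_hasBasis a).tendsto_iff
      (Series.nhds_hasBasis _)).2 fun p _ => ⟨p, trivial, ?_⟩
    intro g hg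
    have : -g - -a = -(g - a) := by abel
    change -g - -a ∈ Series.filt p
    exact this ▸ neg_mem hg

instance : T2Space (Series K E O) := by
  refine t2Space_iff_disjoint_nhds.2 fun f g hne => ?_
  obtain ⟨m, hm⟩ : ∃ m, f.coeff m ≠ g.coeff m := by
    by_contra! h
    exact hne (Series.ext h)
  refine ((Series.nhds_hasBasis f).disjoint_iff (Series.nhds_hasBasis g)).2
    ⟨m.deg + 1, trivial, m.deg + 1, trivial, Set.disjoint_left.2 fun k hf hg => hm ?_⟩
  have h1 := hf m (Nat.lt_succ_self _)
  have h2 := hg m (Nat.lt_succ_self _)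
  rw [Series.coeff_sub, sub_eq_zero] at h1 h2
  rw [← h1, ← h2]

theorem Series.isClosed_filt (p : ℕ) :
    IsClosed ((Series.filt p : Submodule K (Series K E O)) : Set (Series K E O)) := by
  refine isClosed_of_closure_subset fun f hf => ?_
  obtain ⟨g, hg, hgf⟩ := (mem_closure_iff_nhds_basis (Series.nhds_hasBasis f)).1 hf p trivial
  have : f = g - (g - f) := by abel
  exact this ▸ sub_mem hg hgf

/-- The operator does not lower degrees. -/
def Filtered (T : Op K E O) : Prop := ∀ p, ∀ f ∈ Series.filt p, T f ∈ Series.filt p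

theorem Filtered.continuous {T : Op K E O} (hT : Filtered T) : Continuous T := by
  refine continuous_iff_continuousAt.2 fun f => ?_
  refine ((Series.nhds_hasBasis f).tendsto_iff
      (Series.nhds_hasBasis _)).2 fun p _ => ⟨p, trivial, fun g hg => ?_⟩
  have := hT p _ hg
  rwa [map_sub] at this

theorem Filtered.mul {T S : Op K E O} (hT : Filtered T) (hS : Filtered S) : Filtered (T * S) :=
  fun p f hf => hT p _ (hS p f hf)

theorem Filtered.add {T S : Op K E O} (hT : Filtered T) (hS : Filtered S) : Filtered (T + S) :=
  fun p f hf => add_mem (hT p f hf) (hS p f hf)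

theorem Filtered.sub {T S : Op K E O} (hT : Filtered T) (hS : Filtered S) : Filtered (T - S) :=
  fun p f hf => sub_mem (hT p f hf) (hS p f hf)

theorem Filtered.smul {T : Op K E O} (c : K) (hT : Filtered T) : Filtered (c • T) :=
  fun p f hf => Submodule.smul_mem _ c (hT p f hf)

theorem Op.isInducing : IsInducing (fun (T : Op K E O) (f : Series K E O) => T f) := ⟨rfl⟩

theorem Op.continuous_apply (f : Series K E O) : Continuous fun T : Op K E O => T f :=
  (_root_.continuous_apply f).comp Op.isInducing.continuous

theorem Op.continuous_iff {X : Type*} [TopologicalSpace X] {u : X → Op K E O} :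
    Continuous u ↔ ∀ f, Continuous fun x => u x f := by
  rw [Op.isInducing.continuous_iff, continuous_pi_iff]
  rfl

instance : IsTopologicalAddGroup (Op K E O) where
  continuous_add := Op.continuous_iff.2 fun f =>
    ((Op.continuous_apply f).comp continuous_fst).add ((Op.continuous_apply f).comp continuous_snd)
  continuous_neg := Op.continuous_iff.2 fun f => (Op.continuous_apply f).neg

instance : T2Space (Op K E O) :=
  T2Space.of_injective_continuous DFunLike.coe_injective Op.isInducing.continuous

/-- Pointwise convergence treats the two factors differently: (T * B) f is an evaluation of T,
whereas B * T applies B to a limit, so B has to be continuous. -/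
theorem Filtered.continuous_mul_left {B : Op K E O} (hB : Continuous B) :
    Continuous fun T : Op K E O => B * T :=
  Op.continuous_iff.2 fun f => hB.comp (Op.continuous_apply f)

theorem Op.continuous_mul_right (B : Op K E O) : Continuous fun T : Op K E O => T * B :=
  Op.continuous_iff.2 fun f => Op.continuous_apply (B f)

/-- Scaling is left multiplication by a filtered operator, so no topology on `K` is involved. -/
theorem Op.continuous_smul (c : K) : Continuous fun T : Op K E O => c • T := by
  have h : Filtered (c • (1 : Op K E O)) := Filtered.smul c fun _ _ hf => hf
  simpa using Filtered.continuous_mul_left h.continuous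

theorem Op.hasSum_iff {ι : Type*} {T : ι → Op K E O} {A : Op K E O} :
    HasSum T A ↔ ∀ f p, ∃ s₀ : Finset ι, ∀ s, s₀ ⊆ s → (∑ i ∈ s, T i f) - A f ∈ Series.filt p := by
  unfold HasSum
  simp only [SummationFilter.unconditional_filter]
  rw [Op.isInducing.tendsto_nhds_iff, tendsto_pi_nhds]
  refine forall_congr' fun f => ?_
  rw [(Series.nhds_hasBasis _).tendsto_right_iff]
  simp only [Function.comp_apply, LinearMap.sum_apply, eventually_atTop, forall_true_left,
    Set.mem_ofPred_eq]

/-- The terms of the family, applied to any series, lie in high degrees with finitely many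
exceptions. -/
def LocFin {ι : Type*} (T : ι → Op K E O) : Prop :=
  ∀ f p, {i | T i f ∉ Series.filt p}.Finite

theorem LocFin.finite_coeff {ι : Type*} {T : ι → Op K E O} (hT : LocFin T) (f : Series K E O)
    (m : Mono E O) : (Function.support fun i => (T i f).coeff m).Finite :=
  (hT f (m.deg + 1)).subset fun _ hi h => hi (h m (Nat.lt_succ_self _))

/-- The sum of a locally finite family of operators. -/
def opSum {ι : Type*} (T : ι → Op K E O) (hT : LocFin T) : Op K E O where
  toFun f := ⟨fun m => ∑ᶠ i, (T i f).coeff m, fun d => by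
    -- In degree d only the finitely many indices with T i f outside `filt (d + 1)` contribute, each
    -- with finitely many monomials.
    refine ((hT f (d + 1)).biUnion fun i _ => (T i f).2 d).subset ?_
    rintro m ⟨hm, hne⟩
    obtain ⟨i, hi⟩ : ∃ i, (T i f).coeff m ≠ 0 := by
      by_contra! h
      exact hne ((finsum_congr h).trans finsum_zero)
    refine Set.mem_biUnion (x := i) (fun h => hi ?_) ⟨hm, hi⟩
    exact h m (by omega)⟩
  map_add' f g := Series.ext fun m => by
    change ∑ᶠ i, (T i (f + g)).coeff m = (∑ᶠ i, (T i f).coeff m) + ∑ᶠ i, (T i g).coeff m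
    rw [← finsum_add_distrib (hT.finite_coeff f m) (hT.finite_coeff g m)]
    simp
  map_smul' c f := Series.ext fun m => by
    change ∑ᶠ i, (T i (c • f)).coeff m = c * (∑ᶠ i, (T i f).coeff m)
    rw [mul_finsum]
    simp

theorem LocFin.hasSum {ι : Type*} {T : ι → Op K E O} (hT : LocFin T) : HasSum T (opSum T hT) := by
  refine Op.hasSum_iff.2 fun f p => ⟨(hT f p).toFinset, fun s hs m hm => ?_⟩
  rw [Series.coeff_sub, Series.coeff_sum, sub_eq_zero]
  refine (finsum_eq_sum_of_support_subset _ fun i hi => ?_).symm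
  refine hs ?_
  rw [Set.Finite.mem_toFinset]
  exact fun h => hi (h m hm)

theorem LocFin.summable {ι : Type*} {T : ι → Op K E O} (hT : LocFin T) : Summable T :=
  ⟨_, hT.hasSum⟩

theorem Filtered.hasSum {ι : Type*} {T : ι → Op K E O} {A : Op K E O} (h : HasSum T A)
    {p : ℕ} {f : Series K E O} (hT : ∀ i, T i f ∈ Series.filt p) : A f ∈ Series.filt p := by
  obtain ⟨s, hs⟩ := Op.hasSum_iff.1 h f p
  have h1 := hs s subset_rfl
  have h2 : ∑ i ∈ s, T i f ∈ (Series.filt p : Submodule K (Series K E O)) :=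
    sum_mem fun i _ => hT i
  have : A f = ∑ i ∈ s, T i f - (∑ i ∈ s, T i f - A f) := by abel
  exact this ▸ sub_mem h2 h1

/-- The operator raises degrees by `d`. -/
def Homog (d : ℤ) (T : Op K E O) : Prop :=
  ∀ (f : Series K E O) (m : Mono E O),
    (∀ m' : Mono E O, (m'.deg : ℤ) + d = m.deg → f.coeff m' = 0) → (T f).coeff m = 0

theorem Homog.mul {d e : ℤ} {T S : Op K E O} (hT : Homog d T) (hS : Homog e S) :
    Homog (d + e) (T * S) := fun f m h =>
  hT (S f) m fun m' hm' => hS f m' fun m'' hm'' => h m'' (by omega)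

theorem Homog.add {d : ℤ} {T S : Op K E O} (hT : Homog d T) (hS : Homog d S) :
    Homog d (T + S) := fun f m h => by simp [hT f m h, hS f m h]

theorem Homog.neg {d : ℤ} {T : Op K E O} (hT : Homog d T) :
    Homog d (-T) := fun f m h => by simp [hT f m h]

theorem Homog.smul {d : ℤ} (c : K) {T : Op K E O} (hT : Homog d T) :
    Homog d (c • T) := fun f m h => by simp [hT f m h]

theorem Homog.zero (d : ℤ) : Homog d (0 : Op K E O) := fun _ _ _ => rfl

theorem Homog.tsum {ι : Type*} {d : ℤ} {T : ι → Op K E O} (hT : ∀ i, Homog d (T i)) :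
    Homog d (∑' i, T i) := by
  by_cases hs : Summable T
  · intro f m h
    obtain ⟨s, hs⟩ := Op.hasSum_iff.1 hs.hasSum f (m.deg + 1)
    have h1 := hs s subset_rfl m (Nat.lt_succ_self _)
    rw [Series.coeff_sub, Series.coeff_sum, Finset.sum_eq_zero fun i _ => hT i f m h] at h1
    simpa using h1
  -- The default value 0 of a divergent sum is homogeneous of every degree, so summability need not
  -- be assumed.
  · rw [tsum_eq_zero_of_not_summable hs]
    exact Homog.zero d

theorem Homog.filtered {d : ℤ} (hd : 0 ≤ d) {T : Op K E O} (hT : Homog d T) : Filtered T :=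
  fun p f hf m hm => hT f m fun m' hm' => hf m' (by omega)

theorem substOp_coeff (c : Mono E O → K) (g : Mono E O → Mono E O) (δ : ℕ → ℕ)
    (hinj : Set.InjOn g {m | c m ≠ 0}) (hdeg : ∀ m, c m ≠ 0 → (g m).deg = δ m.deg)
    (f : Series K E O) (m : Mono E O) :
    (substOp c g δ hinj hdeg f).coeff m = c m * f.coeff (g m) := rfl

theorem homog_substOp (c : Mono E O → K) (g : Mono E O → Mono E O) (δ : ℕ → ℕ)
    (hinj : Set.InjOn g {m | c m ≠ 0}) (hdeg : ∀ m, c m ≠ 0 → (g m).deg = δ m.deg) (d : ℤ)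
    (hd : ∀ m, c m ≠ 0 → ((g m).deg : ℤ) + d = m.deg) : Homog d (substOp c g δ hinj hdeg) := by
  intro f m h
  rw [substOp_coeff]
  by_cases hc : c m = 0
  · rw [hc, zero_mul]
  · rw [h _ (hd m hc), mul_zero]

theorem degLE_add (n : ℕ) (T S : Op K E O) : degLE n (T + S) = degLE n T + degLE n S := rfl

/-- The coefficient at m depends only on the part of f of degree m.deg - d, and the truncation keeps
this part exactly when d ≤ n. The truncated subtraction in `degLE` is harmless here. -/
theorem Homog.degLE_eq_self {d : ℤ} {n : ℕ} (h : d ≤ n) {T : Op K E O} (hT : Homog d T) :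
    degLE n T = T := by
  refine LinearMap.ext fun f => Series.ext fun m => ?_
  change (T (Series.truncGE (m.deg - n) f)).coeff m = (T f).coeff m
  rw [← sub_eq_zero, ← Series.coeff_sub, ← map_sub]
  refine hT _ m fun m' hm' => ?_
  have h1 : m.deg - n ≤ m'.deg := by omega
  change (if m.deg - n ≤ m'.deg then f.coeff m' else 0) - f.coeff m' = 0
  rw [if_pos h1, sub_self]

theorem Homog.degLE_eq_zero {d : ℤ} {n : ℕ} (h : (n : ℤ) < d) {T : Op K E O} (hT : Homog d T) :
    degLE n T = 0 := by
  refine LinearMap.ext fun f => Series.ext fun m => ?_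
  refine hT _ m fun m' hm' => ?_
  exact if_neg (by omega)

end Topological

/-! ### Commutation relations of ħ, the even variables, their derivatives and parity. -/

section Generators

variable {K E O : Type*} [Field K]

theorem hbar_coeff (f : Series K E O) (k : ℕ) (α : E →₀ ℕ) (S : Finset O) :
    ((hbar : Op K E O) f).coeff (k, α, S) = if k = 0 then 0 else f.coeff (k - 1, α, S) := by
  change (if k = 0 then (0 : K) else 1) * f.coeff (k - 1, α, S) = _
  split_ifs <;> simp

theorem mulX_coeff (e : E) (f : Series K E O) (k : ℕ) (α : E →₀ ℕ) (S : Finset O) :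
    (mulX e f).coeff (k, α, S) =
      if α e = 0 then 0 else f.coeff (k, α - Finsupp.single e 1, S) := by
  change (if α e = 0 then (0 : K) else 1) * f.coeff (k, α - Finsupp.single e 1, S) = _
  split_ifs <;> simp

theorem derX_coeff (e : E) (f : Series K E O) (k : ℕ) (α : E →₀ ℕ) (S : Finset O) :
    (derX e f).coeff (k, α, S) = ((α e : K) + 1) * f.coeff (k, α + Finsupp.single e 1, S) := by
  change ((α e + 1 : ℕ) : K) * f.coeff (k, α + Finsupp.single e 1, S) = _
  push_cast
  rfl

theorem parity_coeff (f : Series K E O) (k : ℕ) (α : E →₀ ℕ) (S : Finset O) :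
    ((parity : Op K E O) f).coeff (k, α, S) = (-1) ^ S.card * f.coeff (k, α, S) := rfl

theorem homog_hbar : Homog 2 (hbar : Op K E O) := by
  refine homog_substOp _ _ _ _ _ _ ?_
  rintro ⟨k, α, S⟩ h
  have hk : k ≠ 0 := fun hk => h (if_pos hk)
  simp only [Mono.deg]
  omega

theorem homog_mulX (e : E) : Homog 1 (mulX e : Op K E O) := by
  refine homog_substOp _ _ _ _ _ _ ?_
  rintro ⟨k, α, S⟩ h
  have hk : α e ≠ 0 := fun hk => h (if_pos hk)
  have h1 : Finsupp.single e 1 ≤ α := by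
    rw [Finsupp.single_le_iff]; omega
  have h2 : α.degree = (α - Finsupp.single e 1).degree + 1 := by
    conv_lhs => rw [← tsub_add_cancel_of_le h1]
    simp
  simp only [Mono.deg]
  omega

theorem homog_derX (e : E) : Homog (-1) (derX e : Op K E O) := by
  refine homog_substOp _ _ _ _ _ _ ?_
  rintro ⟨k, α, S⟩ h
  simp only [Mono.deg, map_add, Finsupp.degree_single]
  omega

theorem parity_mul_parity : (parity : Op K E O) * parity = 1 := by
  refine LinearMap.ext fun f => Series.ext fun ⟨k, α, S⟩ => ?_
  change (-1) ^ S.card * ((-1) ^ S.card * f.coeff (k, α, S)) = f.coeff (k, α, S)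
  rw [← mul_assoc, ← mul_pow]
  simp

theorem homog_parity : Homog 0 (parity : Op K E O) := by
  refine homog_substOp _ _ _ _ _ _ ?_
  intro m h
  simp

theorem hbar_comm_mulX (e : E) : (hbar : Op K E O) * mulX e = mulX e * hbar := by
  refine LinearMap.ext fun f => Series.ext fun ⟨k, α, S⟩ => ?_
  simp only [Module.End.mul_apply, hbar_coeff, mulX_coeff]
  split_ifs <;> rfl

theorem hbar_comm_derX (e : E) : (hbar : Op K E O) * derX e = derX e * hbar := by
  refine LinearMap.ext fun f => Series.ext fun ⟨k, α, S⟩ => ?_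
  simp only [Module.End.mul_apply, hbar_coeff, derX_coeff]
  split_ifs <;> simp

theorem hbar_comm_parity : (hbar : Op K E O) * parity = parity * hbar := by
  refine LinearMap.ext fun f => Series.ext fun ⟨k, α, S⟩ => ?_
  simp only [Module.End.mul_apply, hbar_coeff, parity_coeff]
  split_ifs <;> simp

theorem parity_comm_mulX (e : E) : (parity : Op K E O) * mulX e = mulX e * parity := by
  refine LinearMap.ext fun f => Series.ext fun ⟨k, α, S⟩ => ?_
  simp only [Module.End.mul_apply, parity_coeff, mulX_coeff]
  split_ifs <;> simp

theorem parity_comm_derX (e : E) : (parity : Op K E O) * derX e = derX e * parity := by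
  refine LinearMap.ext fun f => Series.ext fun ⟨k, α, S⟩ => ?_
  simp only [Module.End.mul_apply, parity_coeff, derX_coeff]
  ring

theorem mulX_comm (e e' : E) : (mulX e : Op K E O) * mulX e' = mulX e' * mulX e := by
  classical
  refine LinearMap.ext fun f => Series.ext fun ⟨k, α, S⟩ => ?_
  rcases eq_or_ne e e' with rfl | h
  · rfl
  simp only [Module.End.mul_apply, mulX_coeff, Finsupp.tsub_apply, Finsupp.single_apply, h, h.symm,
    if_false, tsub_zero, tsub_right_comm]
  split_ifs <;> rfl

theorem derX_comm (e e' : E) : (derX e : Op K E O) * derX e' = derX e' * derX e := by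
  classical
  refine LinearMap.ext fun f => Series.ext fun ⟨k, α, S⟩ => ?_
  rcases eq_or_ne e e' with rfl | h
  · rfl
  simp only [Module.End.mul_apply, derX_coeff, Finsupp.add_apply, Finsupp.single_apply, h, h.symm,
    if_false, add_zero, add_right_comm α (Finsupp.single e 1) (Finsupp.single e' 1)]
  ring

theorem derX_mul_mulX_self (e : E) : (derX e : Op K E O) * mulX e = mulX e * derX e + 1 := by
  classical
  refine LinearMap.ext fun f => Series.ext fun ⟨k, α, S⟩ => ?_
  simp only [Module.End.mul_apply, LinearMap.add_apply, Module.End.one_apply, Series.coeff_add,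
    derX_coeff, mulX_coeff, Finsupp.add_apply, Finsupp.tsub_apply, Finsupp.single_eq_same,
    Nat.add_eq_zero_iff, one_ne_zero, and_false, if_false, add_tsub_cancel_right]
  split_ifs with h
  · simp [h]
  · have h1 : Finsupp.single e 1 ≤ α := by
      rw [Finsupp.single_le_iff]; omega
    rw [tsub_add_cancel_of_le h1, Nat.cast_sub (Nat.one_le_iff_ne_zero.2 h)]
    push_cast
    ring

theorem derX_mul_mulX_of_ne {e e' : E} (h : e ≠ e') :
    (derX e : Op K E O) * mulX e' = mulX e' * derX e := by
  classical
  refine LinearMap.ext fun f => Series.ext fun ⟨k, α, S⟩ => ?_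
  simp only [Module.End.mul_apply, derX_coeff, mulX_coeff, Finsupp.add_apply, Finsupp.tsub_apply,
    Finsupp.single_apply, h, h.symm, if_false, add_zero, tsub_zero]
  split_ifs with h'
  · simp
  · have h1 : Finsupp.single e' 1 ≤ α := by
      rw [Finsupp.single_le_iff]; omega
    rw [tsub_add_eq_add_tsub h1]

end Generators

/-! ### Anticommutation relations of the odd variables and their derivatives. -/

section OddGenerators

variable {K E O : Type*} [Field K] [LinearOrder O]

theorem mulTheta_coeff (o : O) (f : Series K E O) (k : ℕ) (α : E →₀ ℕ) (S : Finset O) :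
    (mulTheta o f).coeff (k, α, S) =
      if o ∈ S then oddSign K o S * f.coeff (k, α, S.erase o) else 0 := by
  change (if o ∈ S then oddSign K o S else 0) * f.coeff (k, α, S.erase o) = _
  split_ifs <;> simp

theorem derTheta_coeff (o : O) (f : Series K E O) (k : ℕ) (α : E →₀ ℕ) (S : Finset O) :
    (derTheta o f).coeff (k, α, S) =
      if o ∈ S then 0 else oddSign K o S * f.coeff (k, α, insert o S) := by
  change (if o ∈ S then 0 else oddSign K o S) * f.coeff (k, α, insert o S) = _
  split_ifs <;> simp

theorem homog_mulTheta (o : O) : Homog 1 (mulTheta o : Op K E O) := by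
  refine homog_substOp _ _ _ _ _ _ ?_
  rintro ⟨k, α, S⟩ h
  have h1 : o ∈ S := by
    by_contra h'
    exact h (if_neg h')
  have h2 := Finset.card_erase_add_one h1
  simp only [Mono.deg]
  omega

theorem homog_derTheta (o : O) : Homog (-1) (derTheta o : Op K E O) := by
  refine homog_substOp _ _ _ _ _ _ ?_
  rintro ⟨k, α, S⟩ h
  have h1 : o ∉ S := by
    intro h'
    exact h (if_pos h')
  have h2 := Finset.card_insert_of_notMem h1
  simp only [Mono.deg]
  omega

theorem oddSign_mul_self (o : O) (S : Finset O) : oddSign K o S * oddSign K o S = 1 := by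
  rw [oddSign, ← mul_pow]
  simp

theorem oddSign_erase_self (o : O) (S : Finset O) : oddSign K o (S.erase o) = oddSign K o S := by
  rw [oddSign, oddSign, Finset.filter_erase, Finset.erase_eq_of_notMem (by simp)]

theorem oddSign_insert_self (o : O) (S : Finset O) : oddSign K o (insert o S) = oddSign K o S := by
  rw [oddSign, oddSign, Finset.filter_insert, if_neg (lt_irrefl o)]

/-- The additional factor θ^p stands to the left of the position of θ^o exactly when p < o. This
comparison is the source of all anticommutation signs below. -/
theorem oddSign_insert {o p : O} {S : Finset O} (hp : p ∉ S) :
    oddSign K o (insert p S) = (if p < o then -1 else 1) * oddSign K o S := by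
  rw [oddSign, oddSign, Finset.filter_insert]
  split_ifs
  · rw [Finset.card_insert_of_notMem (by simp [hp]), pow_succ, mul_comm]
  · rw [one_mul]

theorem oddSign_erase {o p : O} {S : Finset O} (hp : p ∈ S) :
    oddSign K o (S.erase p) = (if p < o then -1 else 1) * oddSign K o S := by
  have h := oddSign_insert (K := K) (o := o) (Finset.notMem_erase p S)
  rw [Finset.insert_erase hp] at h
  rw [h, ← mul_assoc]
  split_ifs <;> simp

theorem hbar_comm_mulTheta (o : O) : (hbar : Op K E O) * mulTheta o = mulTheta o * hbar := by
  refine LinearMap.ext fun f => Series.ext fun ⟨k, α, S⟩ => ?_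
  simp only [Module.End.mul_apply, hbar_coeff, mulTheta_coeff]
  split_ifs <;> simp

theorem hbar_comm_derTheta (o : O) : (hbar : Op K E O) * derTheta o = derTheta o * hbar := by
  refine LinearMap.ext fun f => Series.ext fun ⟨k, α, S⟩ => ?_
  simp only [Module.End.mul_apply, hbar_coeff, derTheta_coeff]
  split_ifs <;> simp

theorem mulX_comm_mulTheta (e : E) (o : O) :
    (mulX e : Op K E O) * mulTheta o = mulTheta o * mulX e := by
  refine LinearMap.ext fun f => Series.ext fun ⟨k, α, S⟩ => ?_
  simp only [Module.End.mul_apply, mulX_coeff, mulTheta_coeff]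
  split_ifs <;> simp

theorem mulX_comm_derTheta (e : E) (o : O) :
    (mulX e : Op K E O) * derTheta o = derTheta o * mulX e := by
  refine LinearMap.ext fun f => Series.ext fun ⟨k, α, S⟩ => ?_
  simp only [Module.End.mul_apply, mulX_coeff, derTheta_coeff]
  split_ifs <;> simp

theorem derX_comm_mulTheta (e : E) (o : O) :
    (derX e : Op K E O) * mulTheta o = mulTheta o * derX e := by
  refine LinearMap.ext fun f => Series.ext fun ⟨k, α, S⟩ => ?_
  simp only [Module.End.mul_apply, derX_coeff, mulTheta_coeff]
  split_ifs <;> ring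

theorem derX_comm_derTheta (e : E) (o : O) :
    (derX e : Op K E O) * derTheta o = derTheta o * derX e := by
  refine LinearMap.ext fun f => Series.ext fun ⟨k, α, S⟩ => ?_
  simp only [Module.End.mul_apply, derX_coeff, derTheta_coeff]
  split_ifs <;> ring

theorem parity_anticomm_mulTheta (o : O) :
    (parity : Op K E O) * mulTheta o = -(mulTheta o * parity) := by
  refine LinearMap.ext fun f => Series.ext fun ⟨k, α, S⟩ => ?_
  simp only [Module.End.mul_apply, LinearMap.neg_apply, Series.coeff_neg, parity_coeff,
    mulTheta_coeff]
  split_ifs with h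
  · rw [← Finset.card_erase_add_one h]
    ring
  · simp

theorem parity_anticomm_derTheta (o : O) :
    (parity : Op K E O) * derTheta o = -(derTheta o * parity) := by
  refine LinearMap.ext fun f => Series.ext fun ⟨k, α, S⟩ => ?_
  simp only [Module.End.mul_apply, LinearMap.neg_apply, Series.coeff_neg, parity_coeff,
    derTheta_coeff]
  split_ifs with h
  · simp
  · rw [Finset.card_insert_of_notMem h]
    ring

theorem mulTheta_mul_self (o : O) : (mulTheta o : Op K E O) * mulTheta o = 0 := by
  refine LinearMap.ext fun f => Series.ext fun ⟨k, α, S⟩ => ?_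
  simp [Module.End.mul_apply, mulTheta_coeff]

theorem derTheta_mul_self (o : O) : (derTheta o : Op K E O) * derTheta o = 0 := by
  refine LinearMap.ext fun f => Series.ext fun ⟨k, α, S⟩ => ?_
  simp [Module.End.mul_apply, derTheta_coeff]

/-- Each order of the two factors produces a sign comparing o with p. Since exactly one of o < p and
p < o holds, the two signs are opposite. -/
theorem mulTheta_anticomm (o p : O) :
    (mulTheta o : Op K E O) * mulTheta p = -(mulTheta p * mulTheta o) := by
  rcases eq_or_ne o p with rfl | h
  · simp [mulTheta_mul_self]
  refine LinearMap.ext fun f => Series.ext fun ⟨k, α, S⟩ => ?_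
  simp only [Module.End.mul_apply, LinearMap.neg_apply, Series.coeff_neg, mulTheta_coeff,
    Finset.mem_erase, h, h.symm, ne_eq, not_false_eq_true, true_and]
  by_cases ho : o ∈ S
  · by_cases hp : p ∈ S
    · simp only [ho, hp, if_true, oddSign_erase, Finset.erase_right_comm]
      rcases lt_or_gt_of_ne h with h' | h'
      · simp only [h', h'.not_gt, if_true, if_false]
        ring
      · simp only [h', h'.not_gt, if_true, if_false]
        ring
    · simp [ho, hp]
  · simp [ho]

theorem derTheta_anticomm (o p : O) :
    (derTheta o : Op K E O) * derTheta p = -(derTheta p * derTheta o) := by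
  rcases eq_or_ne o p with rfl | h
  · simp [derTheta_mul_self]
  refine LinearMap.ext fun f => Series.ext fun ⟨k, α, S⟩ => ?_
  simp only [Module.End.mul_apply, LinearMap.neg_apply, Series.coeff_neg, derTheta_coeff,
    Finset.mem_insert, h, h.symm, false_or]
  by_cases ho : o ∈ S
  · simp [ho]
  · by_cases hp : p ∈ S
    · simp [ho, hp]
    · simp only [ho, hp, if_false, oddSign_insert, not_false_eq_true, Finset.insert_comm o p S]
      rcases lt_or_gt_of_ne h with h' | h'
      · simp only [h', h'.not_gt, if_true, if_false]
        ring
      · simp only [h', h'.not_gt, if_true, if_false]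
        ring

theorem derTheta_mul_mulTheta_of_ne {o p : O} (h : o ≠ p) :
    (derTheta o : Op K E O) * mulTheta p = -(mulTheta p * derTheta o) := by
  refine LinearMap.ext fun f => Series.ext fun ⟨k, α, S⟩ => ?_
  simp only [Module.End.mul_apply, LinearMap.neg_apply, Series.coeff_neg, derTheta_coeff,
    mulTheta_coeff, Finset.mem_insert, Finset.mem_erase, h, h.symm, false_or, ne_eq,
    not_false_eq_true, true_and]
  by_cases ho : o ∈ S
  · simp [ho]
  · by_cases hp : p ∈ S
    · simp only [ho, hp, if_false, if_true, oddSign_insert, oddSign_erase, not_false_eq_true,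
        Finset.erase_insert_of_ne h]
      rcases lt_or_gt_of_ne h with h' | h'
      · simp only [h', h'.not_gt, if_true, if_false]
        ring
      · simp only [h', h'.not_gt, if_true, if_false]
        ring
    · simp [ho, hp]

theorem derTheta_mul_mulTheta_self (o : O) :
    (derTheta o : Op K E O) * mulTheta o = -(mulTheta o * derTheta o) + 1 := by
  refine LinearMap.ext fun f => Series.ext fun ⟨k, α, S⟩ => ?_
  simp only [Module.End.mul_apply, LinearMap.neg_apply, LinearMap.add_apply, Module.End.one_apply,
    Series.coeff_add, Series.coeff_neg, derTheta_coeff,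
    mulTheta_coeff, Finset.mem_insert_self, Finset.notMem_erase, if_true, if_false,
    oddSign_insert_self, oddSign_erase_self]
  by_cases ho : o ∈ S
  · simp [ho, ← mul_assoc, oddSign_mul_self, Finset.insert_erase]
  · simp [ho, ← mul_assoc, oddSign_mul_self]

end OddGenerators

/-! ### Monomials and a vanishing criterion for operators. -/

section Monomials

variable {K E O : Type*} [Field K]

open Classical in
/-- The monomial `m` as a series. -/
def Series.mono (m : Mono E O) : Series K E O :=
  ⟨fun m' => if m' = m then 1 else 0, fun d => (Set.finite_singleton m).subset (by
    rintro m' ⟨-, h⟩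
    by_contra h'
    exact h (if_neg h'))⟩

open Classical in
theorem Series.mono_coeff (m m' : Mono E O) :
    (Series.mono m : Series K E O).coeff m' = if m' = m then 1 else 0 := rfl

/-- Density of polynomials: a series has only finitely many terms below a given degree. -/
theorem Series.exists_sub_sum_mem_filt (f : Series K E O) (p : ℕ) :
    ∃ s : Finset (Mono E O), f - ∑ m ∈ s, f.coeff m • Series.mono m ∈ Series.filt p := by
  classical
  have hfin : {m : Mono E O | m.deg < p ∧ f.coeff m ≠ 0}.Finite := by
    refine ((Finset.range p).finite_toSet.biUnion fun d _ => f.2 d).subset ?_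
    rintro m ⟨hm, hne⟩
    exact Set.mem_biUnion (x := m.deg) (by simpa using hm) ⟨rfl, hne⟩
  refine ⟨hfin.toFinset, fun m hm => ?_⟩
  simp only [Series.coeff_sub, Series.coeff_sum, Series.coeff_smul, Series.mono_coeff, mul_ite,
    mul_one, mul_zero, Finset.sum_ite_eq, Set.Finite.mem_toFinset, Set.mem_ofPred_eq, hm, true_and]
  by_cases h : f.coeff m = 0 <;> simp [h]

theorem Filtered.eq_zero_of_mono {Z : Op K E O} (hZ : Filtered Z)
    (h : ∀ m, Z (Series.mono m) = 0) : Z = 0 := by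
  refine LinearMap.ext fun f => Series.eq_zero_of_mem_filt fun p => ?_
  obtain ⟨s, hs⟩ := f.exists_sub_sum_mem_filt p
  have := hZ p _ hs
  rwa [map_sub, map_sum, Finset.sum_eq_zero, sub_zero] at this
  intro m _
  rw [map_smul, h, smul_zero]

theorem hbar_mono (k : ℕ) (α : E →₀ ℕ) (S : Finset O) :
    (hbar : Op K E O) (Series.mono (k, α, S)) = Series.mono (k + 1, α, S) := by
  classical
  refine Series.ext fun ⟨k', α', S'⟩ => ?_
  rw [hbar_coeff, Series.mono_coeff, Series.mono_coeff, ← ite_not]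
  rcases k' with _ | k' <;> simp

theorem mulX_mono (e : E) (k : ℕ) (α : E →₀ ℕ) (S : Finset O) :
    (mulX e : Op K E O) (Series.mono (k, α, S)) =
      Series.mono (k, α + Finsupp.single e 1, S) := by
  classical
  refine Series.ext fun ⟨k', α', S'⟩ => ?_
  rw [mulX_coeff, Series.mono_coeff, Series.mono_coeff]
  by_cases h : α' e = 0
  · rw [if_pos h, if_neg]
    intro h'
    simp only [Prod.mk.injEq] at h'
    rw [h'.2.1] at h
    simp at h
  · have h1 : Finsupp.single e 1 ≤ α' := by
      rw [Finsupp.single_le_iff]; omega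
    rw [if_neg h]
    refine if_congr ?_ rfl rfl
    simp only [Prod.mk.injEq]
    rw [tsub_eq_iff_eq_add_of_le h1]

variable [LinearOrder O]

theorem mulTheta_mono (o : O) (k : ℕ) (α : E →₀ ℕ) (S : Finset O) (ho : o ∉ S) :
    (mulTheta o : Op K E O) (Series.mono (k, α, S)) =
      oddSign K o S • Series.mono (k, α, insert o S) := by
  classical
  refine Series.ext fun ⟨k', α', S'⟩ => ?_
  rw [mulTheta_coeff, Series.coeff_smul, Series.mono_coeff, Series.mono_coeff]
  by_cases h : o ∈ S'
  · have h1 : S'.erase o = S ↔ S' = insert o S := by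
      constructor
      · rintro rfl
        rw [Finset.insert_erase h]
      · rintro rfl
        rw [Finset.erase_insert ho]
    rw [if_pos h]
    simp only [Prod.mk.injEq, h1]
    split_ifs with h'
    · rw [h'.2.2, oddSign_insert_self]
    · simp
  · rw [if_neg h, if_neg, mul_zero]
    intro h'
    simp only [Prod.mk.injEq] at h'
    exact h (h'.2.2 ▸ Finset.mem_insert_self o S)

/-- An operator is zero if it annihilates `1` and commutes, up to a sign for odd variables, with
multiplication by `ħ` and by all variables. -/
theorem Filtered.eq_zero_of_comm {Z : Op K E O} (hZ : Filtered Z) (ε : K)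
    (h1 : Z (Series.mono (0, 0, ∅)) = 0) (hh : Z * hbar = hbar * Z)
    (hX : ∀ e, Z * mulX e = mulX e * Z) (hT : ∀ o, Z * mulTheta o = ε • (mulTheta o * Z)) :
    Z = 0 := by
  -- Every monomial is reached from 1 by multiplying with odd variables, then with even variables,
  -- then with ħ; the vanishing propagates along these three stages.
  have hS : ∀ S : Finset O, Z (Series.mono (0, 0, S)) = 0 := by
    intro S
    induction S using Finset.induction_on with
    | empty => exact h1
    | insert o S ho ih =>
      have h2 := DFunLike.congr_fun (hT o) (Series.mono (0, 0, S))
      simp only [Module.End.mul_apply, LinearMap.smul_apply, ih, map_zero, smul_zero,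
        mulTheta_mono o _ _ S ho, map_smul] at h2
      refine (smul_eq_zero.1 h2).resolve_left ?_
      exact left_ne_zero_of_mul_eq_one (oddSign_mul_self o S)
  have hα : ∀ (n : ℕ) (α : E →₀ ℕ) (S : Finset O), α.degree = n →
      Z (Series.mono (0, α, S)) = 0 := by
    intro n
    induction n with
    | zero =>
      intro α S h
      rw [(Finsupp.degree_eq_zero_iff α).1 h]
      exact hS S
    | succ n ih =>
      intro α S h
      obtain ⟨e, he⟩ : ∃ e, α e ≠ 0 := by
        by_contra! h'
        rw [show α = 0 from Finsupp.ext h'] at h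
        simp at h
      have h2 : Finsupp.single e 1 ≤ α := by
        rw [Finsupp.single_le_iff]; omega
      obtain ⟨β, rfl⟩ := exists_add_of_le h2
      rw [add_comm] at h ⊢
      rw [← mulX_mono, ← Module.End.mul_apply, hX, Module.End.mul_apply, ih β S, map_zero]
      simpa using h
  refine hZ.eq_zero_of_mono fun ⟨k, α, S⟩ => ?_
  induction k with
  | zero => exact hα _ α S rfl
  | succ k ih => rw [← hbar_mono, ← Module.End.mul_apply, hh, Module.End.mul_apply, ih, map_zero]

end Monomials

/-! ### Parity, even and odd parts, and the supercommutator. -/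

section Parity

variable {K E O : Type*} [Field K]

/-- Conjugation by the parity involution. -/
def parityConj : Op K E O →ₐ[K] Op K E O where
  toFun T := parity * T * parity
  map_one' := by rw [mul_one, parity_mul_parity]
  map_mul' T S := by
    rw [show parity * T * parity * (parity * S * parity)
      = parity * T * (parity * parity) * S * parity by noncomm_ring, parity_mul_parity]
    noncomm_ring
  map_zero' := by simp
  map_add' T S := by noncomm_ring
  commutes' c := by
    rw [← Algebra.commutes, mul_assoc, parity_mul_parity, mul_one]

theorem parityConj_apply (T : Op K E O) : parityConj T = parity * T * parity := rfl

theorem parityConj_parityConj (T : Op K E O) : parityConj (parityConj T) = T := by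
  rw [parityConj_apply, parityConj_apply,
    show (parity : Op K E O) * (parity * T * parity) * parity
      = (parity * parity) * T * (parity * parity) by noncomm_ring, parity_mul_parity, one_mul,
    mul_one]

theorem evenPart_eq (T : Op K E O) : evenPart T = (2⁻¹ : K) • (T + parityConj T) := rfl

theorem oddPart_eq (T : Op K E O) : oddPart T = (2⁻¹ : K) • (T - parityConj T) := rfl

theorem parity_continuous : Continuous (parity : Op K E O) :=
  (homog_parity.filtered le_rfl).continuous

theorem parityConj_continuous : Continuous (parityConj : Op K E O → Op K E O) :=
  (Op.continuous_mul_right _).comp (Filtered.continuous_mul_left parity_continuous)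

variable [CharZero K]

theorem evenPart_add_oddPart (T : Op K E O) : evenPart T + oddPart T = T := by
  rw [evenPart_eq, oddPart_eq, ← smul_add, add_add_sub_cancel, ← two_smul K, smul_smul]
  simp

theorem evenPart_sub_oddPart (T : Op K E O) : evenPart T - oddPart T = parityConj T := by
  rw [evenPart_eq, oddPart_eq, ← smul_sub, add_sub_sub_cancel, ← two_smul K, smul_smul]
  simp

/-- Moving an even S past T changes nothing, and moving an odd S past T replaces T by its parity
conjugate. In this form bilinearity and continuity can be read off. -/
theorem superComm_eq (T S : Op K E O) :
    superComm T S = T * S - evenPart S * T - oddPart S * parityConj T := by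
  conv_rhs => rw [← evenPart_sub_oddPart T, ← evenPart_add_oddPart T]
  conv_rhs => enter [1, 1, 2]; rw [← evenPart_add_oddPart S]
  conv_rhs => enter [2, 2]; rw [evenPart_add_oddPart T]
  unfold superComm
  noncomm_ring

theorem IsEvenOp.evenPart {T : Op K E O} (h : IsEvenOp T) : evenPart T = T := by
  rw [evenPart_eq, parityConj_apply, h, ← two_smul K, smul_smul]
  simp

omit [CharZero K] in
theorem IsOddOp.evenPart {T : Op K E O} (h : IsOddOp T) : evenPart T = 0 := by
  rw [evenPart_eq, parityConj_apply, h, add_neg_cancel, smul_zero]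

omit [CharZero K] in
theorem IsEvenOp.oddPart {T : Op K E O} (h : IsEvenOp T) : oddPart T = 0 := by
  rw [oddPart_eq, parityConj_apply, h, sub_self, smul_zero]

theorem IsOddOp.oddPart {T : Op K E O} (h : IsOddOp T) : oddPart T = T := by
  rw [oddPart_eq, parityConj_apply, h, sub_neg_eq_add, ← two_smul K, smul_smul]
  simp

omit [CharZero K] in
theorem isEvenOp_evenPart (T : Op K E O) : IsEvenOp (evenPart T) := by
  change parityConj _ = _
  rw [evenPart_eq, map_smul, map_add, parityConj_parityConj, add_comm]

omit [CharZero K] in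
theorem isOddOp_oddPart (T : Op K E O) : IsOddOp (oddPart T) := by
  change parityConj _ = _
  rw [oddPart_eq, map_smul, map_sub, parityConj_parityConj, ← smul_neg, neg_sub]

theorem IsEvenOp.superComm_right {T S : Op K E O} (h : IsEvenOp S) :
    superComm T S = T * S - S * T := by
  rw [superComm_eq, h.evenPart, h.oddPart, zero_mul, sub_zero]

theorem IsOddOp.superComm_right {T S : Op K E O} (h : IsOddOp S) :
    superComm T S = T * S - S * parityConj T := by
  rw [superComm_eq, h.evenPart, h.oddPart, zero_mul, sub_zero]

theorem IsEvenOp.superComm_left {T S : Op K E O} (h : IsEvenOp T) :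
    superComm T S = T * S - S * T := by
  rw [superComm_eq, parityConj_apply, h, sub_sub, ← add_mul, evenPart_add_oddPart]

theorem IsOddOp.superComm {T S : Op K E O} (h : IsOddOp T) (h' : IsOddOp S) :
    superComm T S = T * S + S * T := by
  rw [h'.superComm_right, parityConj_apply, h, mul_neg, sub_neg_eq_add]

end Parity

/-! ### Bilinearity and continuity of the supercommutator. -/

section SuperCommBilinear

variable {K E O : Type*} [Field K]

/-- The even part as a linear map. -/
def evenPartₗ : Op K E O →ₗ[K] Op K E O := (2⁻¹ : K) • (LinearMap.id + parityConj.toLinearMap)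

/-- The odd part as a linear map. -/
def oddPartₗ : Op K E O →ₗ[K] Op K E O := (2⁻¹ : K) • (LinearMap.id - parityConj.toLinearMap)

theorem evenPartₗ_apply (T : Op K E O) : evenPartₗ T = evenPart T := rfl

theorem oddPartₗ_apply (T : Op K E O) : oddPartₗ T = oddPart T := rfl

theorem evenPart_continuous : Continuous (evenPart : Op K E O → Op K E O) :=
  (Op.continuous_smul _).comp (continuous_id.add parityConj_continuous)

theorem oddPart_continuous : Continuous (oddPart : Op K E O → Op K E O) :=
  (Op.continuous_smul _).comp (continuous_id.sub parityConj_continuous)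

variable [CharZero K]

/-- The supercommutator as a bilinear map. -/
def superCommₗ : Op K E O →ₗ[K] Op K E O →ₗ[K] Op K E O :=
  LinearMap.mk₂ K superComm
    (fun T T' S => by simp only [superComm_eq, map_add]; noncomm_ring)
    (fun c T S => by
      simp only [superComm_eq, map_smul, smul_mul_assoc, mul_smul_comm, ← smul_sub])
    (fun T S S' => by
      simp only [superComm_eq, ← evenPartₗ_apply, ← oddPartₗ_apply, map_add]; noncomm_ring)
    (fun c T S => by
      simp only [superComm_eq, ← evenPartₗ_apply, ← oddPartₗ_apply, map_smul, smul_mul_assoc,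
        mul_smul_comm, ← smul_sub])

theorem superCommₗ_apply (T S : Op K E O) : superCommₗ T S = superComm T S := rfl

/-- The parts of S act as left factors on the varying operator T, hence the two continuity
hypotheses. -/
theorem superComm_continuous_left (S : Op K E O) (he : Continuous (evenPart S))
    (ho : Continuous (oddPart S)) : Continuous fun T => superComm T S := by
  simp only [superComm_eq]
  exact ((Op.continuous_mul_right S).sub (Filtered.continuous_mul_left he)).sub
    ((Filtered.continuous_mul_left ho).comp parityConj_continuous)

theorem superComm_continuous_right (T : Op K E O) (hT : Continuous T) :
    Continuous fun S => superComm T S := by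
  simp only [superComm_eq]
  exact ((Filtered.continuous_mul_left hT).sub
    ((Op.continuous_mul_right T).comp evenPart_continuous)).sub
    ((Op.continuous_mul_right _).comp oddPart_continuous)

end SuperCommBilinear

/-! ### The uncompleted Weyl algebra: supercommutators are divisible by ħ. -/

section WeylFinite

variable {K E O : Type*} [Field K] [LinearOrder O]

/-- The sign of exchanging two basis vectors. -/
def varSign (K : Type*) [Field K] : E ⊕ O → E ⊕ O → K
  | Sum.inr _, Sum.inr _ => -1
  | _, _ => 1

theorem hbar_comm_mulVar (v : E ⊕ O) : (hbar : Op K E O) * mulVar v = mulVar v * hbar := by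
  rcases v with e | o
  · exact hbar_comm_mulX e
  · exact hbar_comm_mulTheta o

theorem hbar_comm_derVar (v : E ⊕ O) : (hbar : Op K E O) * derVar v = derVar v * hbar := by
  rcases v with e | o
  · exact hbar_comm_derX e
  · exact hbar_comm_derTheta o

theorem mulVar_mul_mulVar (u v : E ⊕ O) :
    (mulVar u : Op K E O) * mulVar v = varSign K u v • (mulVar v * mulVar u) := by
  rcases u with e | o <;> rcases v with e' | o' <;> simp only [varSign, mulVar, one_smul, neg_smul]
  · exact mulX_comm e e'
  · exact mulX_comm_mulTheta e o'
  · exact (mulX_comm_mulTheta e' o).symm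
  · exact mulTheta_anticomm o o'

theorem derVar_mul_derVar (u v : E ⊕ O) :
    (derVar u : Op K E O) * derVar v = varSign K u v • (derVar v * derVar u) := by
  rcases u with e | o <;> rcases v with e' | o' <;> simp only [varSign, derVar, one_smul, neg_smul]
  · exact derX_comm e e'
  · exact derX_comm_derTheta e o'
  · exact (derX_comm_derTheta e' o).symm
  · exact derTheta_anticomm o o'

open Classical in
theorem derVar_mul_mulVar (u v : E ⊕ O) :
    (derVar u : Op K E O) * mulVar v =
      varSign K u v • (mulVar v * derVar u) + if u = v then 1 else 0 := by
  rcases u with e | o <;> rcases v with e' | o' <;>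
    simp only [varSign, derVar, mulVar, one_smul, neg_smul, Sum.inl.injEq, Sum.inr.injEq,
      reduceCtorEq, if_false, add_zero]
  · split_ifs with h
    · exact h ▸ derX_mul_mulX_self e
    · rw [derX_mul_mulX_of_ne h, add_zero]
  · exact derX_comm_mulTheta e o'
  · exact (mulX_comm_derTheta e' o).symm
  · split_ifs with h
    · exact h ▸ derTheta_mul_mulTheta_self o
    · rw [derTheta_mul_mulTheta_of_ne h, add_zero]

omit [LinearOrder O] in
theorem varSign_comm (u v : E ⊕ O) : varSign K u v = varSign K v u := by
  rcases u with e | o <;> rcases v with e' | o' <;> rfl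

omit [LinearOrder O] in
theorem varSign_mul_self (u v : E ⊕ O) : varSign K u v * varSign K u v = 1 := by
  rcases u with e | o <;> rcases v with e' | o' <;> simp [varSign]

/-- The identity for even `v` and conjugation by the parity involution for odd `v`. -/
def varConj : E ⊕ O → Op K E O →ₐ[K] Op K E O
  | Sum.inl _ => AlgHom.id K _
  | Sum.inr _ => parityConj

omit [LinearOrder O] in
theorem parityConj_hbar : parityConj (hbar : Op K E O) = hbar := by
  rw [parityConj_apply, ← hbar_comm_parity, mul_assoc, parity_mul_parity, mul_one]

omit [LinearOrder O] in
theorem parityConj_mulX (e : E) : parityConj (mulX e : Op K E O) = mulX e := by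
  rw [parityConj_apply, parity_comm_mulX, mul_assoc, parity_mul_parity, mul_one]

omit [LinearOrder O] in
theorem parityConj_derX (e : E) : parityConj (derX e : Op K E O) = derX e := by
  rw [parityConj_apply, parity_comm_derX, mul_assoc, parity_mul_parity, mul_one]

theorem parityConj_mulTheta (o : O) : parityConj (mulTheta o : Op K E O) = -mulTheta o := by
  rw [parityConj_apply, parity_anticomm_mulTheta, neg_mul, mul_assoc, parity_mul_parity, mul_one]

theorem parityConj_derTheta (o : O) : parityConj (derTheta o : Op K E O) = -derTheta o := by
  rw [parityConj_apply, parity_anticomm_derTheta, neg_mul, mul_assoc, parity_mul_parity, mul_one]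

omit [LinearOrder O] in
theorem varConj_hbar (v : E ⊕ O) : varConj v (hbar : Op K E O) = hbar := by
  rcases v with e | o
  · rfl
  · exact parityConj_hbar

theorem varConj_mulVar (u v : E ⊕ O) :
    varConj v (mulVar u : Op K E O) = varSign K u v • mulVar u := by
  rcases u with e | o <;> rcases v with e' | o' <;>
    simp [varConj, varSign, mulVar, parityConj_mulX, parityConj_mulTheta]

theorem varConj_derVar (u v : E ⊕ O) :
    varConj v (derVar u : Op K E O) = varSign K u v • derVar u := by
  rcases u with e | o <;> rcases v with e' | o' <;>
    simp [varConj, varSign, derVar, parityConj_derX, parityConj_derTheta]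

/-- The generators of the algebra `weylFinite K s`. -/
abbrev weylGen (K : Type*) [Field K] (s : Set (E ⊕ O)) : Set (Op K E O) :=
  {hbar} ∪ mulVar '' s ∪ (fun a => hbar * derVar a) '' s

theorem hbar_mem_weylFinite (s : Set (E ⊕ O)) : (hbar : Op K E O) ∈ weylFinite K s :=
  Algebra.subset_adjoin (Or.inl (Or.inl rfl))

theorem mulVar_mem_weylFinite {s : Set (E ⊕ O)} {v : E ⊕ O} (hv : v ∈ s) :
    (mulVar v : Op K E O) ∈ weylFinite K s :=
  Algebra.subset_adjoin (Or.inl (Or.inr ⟨v, hv, rfl⟩))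

theorem hbar_mul_derVar_mem_weylFinite {s : Set (E ⊕ O)} {v : E ⊕ O} (hv : v ∈ s) :
    (hbar * derVar v : Op K E O) ∈ weylFinite K s :=
  Algebra.subset_adjoin (Or.inr ⟨v, hv, rfl⟩)

theorem weylGen_cases {s : Set (E ⊕ O)} {P : Op K E O → Prop} (h1 : P hbar)
    (h2 : ∀ v ∈ s, P (mulVar v)) (h3 : ∀ v ∈ s, P (hbar * derVar v)) :
    ∀ T ∈ weylGen K s, P T := by
  rintro T ((h | ⟨v, hv, rfl⟩) | ⟨v, hv, rfl⟩)
  · rw [Set.mem_singleton_iff.1 h]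
    exact h1
  · exact h2 v hv
  · exact h3 v hv

theorem homog_mulVar (v : E ⊕ O) : Homog 1 (mulVar v : Op K E O) := by
  rcases v with e | o
  · exact homog_mulX e
  · exact homog_mulTheta o

theorem homog_derVar (v : E ⊕ O) : Homog (-1) (derVar v : Op K E O) := by
  rcases v with e | o
  · exact homog_derX e
  · exact homog_derTheta o

theorem homog_hbar_mul_derVar (v : E ⊕ O) : Homog 1 (hbar * derVar v : Op K E O) :=
  homog_hbar.mul (homog_derVar v)

theorem filtered_of_mem_weylFinite {s : Set (E ⊕ O)} {T : Op K E O} (hT : T ∈ weylFinite K s) :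
    Filtered T := by
  induction hT using Algebra.adjoin_induction with
  | mem T hT =>
    exact weylGen_cases (homog_hbar.filtered (by norm_num))
      (fun v _ => (homog_mulVar v).filtered (by norm_num))
      (fun v _ => (homog_hbar_mul_derVar v).filtered (by norm_num)) T hT
  | algebraMap c => exact fun p f hf => Submodule.smul_mem _ c hf
  | add T S _ _ hT hS => exact hT.add hS
  | mul T S _ _ hT hS => exact hT.mul hS

theorem hbar_comm_of_mem_weylFinite {s : Set (E ⊕ O)} {T : Op K E O} (hT : T ∈ weylFinite K s) :
    hbar * T = T * hbar := by
  induction hT using Algebra.adjoin_induction with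
  | mem T hT =>
    exact weylGen_cases (P := fun T => hbar * T = T * hbar) rfl (fun v _ => hbar_comm_mulVar v)
      (fun v _ => by rw [mul_assoc, ← hbar_comm_derVar]) T hT
  | algebraMap c => exact (Algebra.commutes c hbar).symm
  | add T S _ _ hT hS => rw [mul_add, add_mul, hT, hS]
  | mul T S _ _ hT hS => rw [← mul_assoc, hT, mul_assoc, hS, mul_assoc]

theorem varConj_mem_weylFinite {s : Set (E ⊕ O)} (v : E ⊕ O) {T : Op K E O}
    (hT : T ∈ weylFinite K s) : varConj v T ∈ weylFinite K s := by
  induction hT using Algebra.adjoin_induction with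
  | mem T hT =>
    refine weylGen_cases (P := fun T => varConj v T ∈ weylFinite K s) ?_ ?_ ?_ T hT
    · rw [varConj_hbar]
      exact hbar_mem_weylFinite s
    · intro u hu
      rw [varConj_mulVar]
      exact Subalgebra.smul_mem _ (mulVar_mem_weylFinite hu) _
    · intro u hu
      rw [map_mul, varConj_hbar, varConj_derVar, mul_smul_comm]
      exact Subalgebra.smul_mem _ (hbar_mul_derVar_mem_weylFinite hu) _
  | algebraMap c =>
    rw [AlgHom.commutes]
    exact Subalgebra.algebraMap_mem _ c
  | add T S _ _ hT hS =>
    rw [map_add]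
    exact add_mem hT hS
  | mul T S _ _ hT hS =>
    rw [map_mul]
    exact mul_mem hT hS

/-- Parity conjugation is `varConj` at any odd variable; this is what `Nonempty O` provides. -/
theorem parityConj_mem_weylFinite [Nonempty O] {s : Set (E ⊕ O)} {T : Op K E O}
    (hT : T ∈ weylFinite K s) : parityConj T ∈ weylFinite K s :=
  varConj_mem_weylFinite (Sum.inr (Classical.arbitrary O)) hT

/-- The products of `ħ` and elements of `weylFinite K s`. -/
def hbarWeylFinite (K : Type*) [Field K] (s : Set (E ⊕ O)) : Submodule K (Op K E O) :=
  (Subalgebra.toSubmodule (weylFinite K s)).map (LinearMap.mulLeft K hbar)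

theorem mul_mem_hbarWeylFinite_right {s : Set (E ⊕ O)} {T S : Op K E O}
    (hT : T ∈ hbarWeylFinite K s) (hS : S ∈ weylFinite K s) : T * S ∈ hbarWeylFinite K s := by
  obtain ⟨C, hC, rfl⟩ := hT
  exact ⟨C * S, Subalgebra.mul_mem _ hC hS, (mul_assoc _ _ _).symm⟩

theorem mul_mem_hbarWeylFinite_left {s : Set (E ⊕ O)} {T S : Op K E O}
    (hT : T ∈ weylFinite K s) (hS : S ∈ hbarWeylFinite K s) : T * S ∈ hbarWeylFinite K s := by
  obtain ⟨C, hC, rfl⟩ := hS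
  refine ⟨T * C, Subalgebra.mul_mem _ hT hC, ?_⟩
  change hbar * (T * C) = T * (hbar * C)
  rw [← mul_assoc, hbar_comm_of_mem_weylFinite hT, mul_assoc]

theorem smul_hbar_mem_hbarWeylFinite (s : Set (E ⊕ O)) (c : K) :
    c • (hbar : Op K E O) ∈ hbarWeylFinite K s :=
  Submodule.smul_mem _ c ⟨1, Subalgebra.one_mem _, mul_one _⟩

/-- The twisted commutators of elements of `weylFinite K s` with `b` are divisible by `ħ` if those
of the generators are. -/
theorem twisted_comm_mem {s : Set (E ⊕ O)} {b : Op K E O} (v : E ⊕ O)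
    (h : ∀ a ∈ weylGen K s, a * b - b * varConj v a ∈ hbarWeylFinite K s)
    {a : Op K E O} (ha : a ∈ weylFinite K s) :
    a * b - b * varConj v a ∈ hbarWeylFinite K s := by
  induction ha using Algebra.adjoin_induction with
  | mem a ha => exact h a ha
  | algebraMap c =>
    rw [AlgHom.commutes, Algebra.commutes, sub_self]
    exact zero_mem _
  | add a a' _ _ h h' =>
    rw [map_add, show (a + a') * b - b * (varConj v a + varConj v a')
      = (a * b - b * varConj v a) + (a' * b - b * varConj v a') by noncomm_ring]
    exact add_mem h h'
  | mul a a' ha ha' h h' =>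
    -- Twisted Leibniz rule; it relies on `varConj v` being multiplicative.
    rw [map_mul, show a * a' * b - b * (varConj v a * varConj v a')
      = a * (a' * b - b * varConj v a') + (a * b - b * varConj v a) * varConj v a' by noncomm_ring]
    exact add_mem (mul_mem_hbarWeylFinite_left ha h')
      (mul_mem_hbarWeylFinite_right h (varConj_mem_weylFinite v ha'))

/-- Among the generators only ħ∂_v fails to commute with the variable v in the twisted sense, and
the discrepancy is exactly ħ. -/
theorem twisted_comm_mulVar_mem {s : Set (E ⊕ O)} (v : E ⊕ O) {a : Op K E O}
    (ha : a ∈ weylFinite K s) :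
    a * mulVar v - mulVar v * varConj v a ∈ hbarWeylFinite K s := by
  classical
  refine twisted_comm_mem v (weylGen_cases (P := fun a => a * mulVar v - mulVar v * varConj v a ∈ hbarWeylFinite K s)
      ?_ ?_ ?_) ha
  · rw [varConj_hbar, hbar_comm_mulVar, sub_self]
    exact zero_mem _
  · intro u hu
    rw [varConj_mulVar, mulVar_mul_mulVar, mul_smul_comm, sub_self]
    exact zero_mem _
  · intro u hu
    rw [map_mul, varConj_hbar, varConj_derVar, mul_assoc, derVar_mul_mulVar, ← mul_assoc,
      ← hbar_comm_mulVar, mul_smul_comm, mul_add, mul_smul_comm, mul_assoc, add_sub_cancel_left]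
    split_ifs
    · exact ⟨1, Subalgebra.one_mem _, rfl⟩
    · rw [mul_zero]
      exact zero_mem _

theorem twisted_comm_derVar_mem {s : Set (E ⊕ O)} (v : E ⊕ O) {a : Op K E O}
    (ha : a ∈ weylFinite K s) :
    a * (hbar * derVar v) - (hbar * derVar v) * varConj v a ∈ hbarWeylFinite K s := by
  classical
  refine twisted_comm_mem v (weylGen_cases (P := fun a => a * (hbar * derVar v) - (hbar * derVar v) * varConj v a
      ∈ hbarWeylFinite K s) ?_ ?_ ?_) ha
  · rw [varConj_hbar, mul_assoc, ← hbar_comm_derVar, sub_self]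
    exact zero_mem _
  · intro u hu
    rw [varConj_mulVar, ← mul_assoc, ← hbar_comm_mulVar, mul_smul_comm, mul_assoc, mul_assoc,
      ← mul_smul_comm, ← mul_sub, derVar_mul_mulVar, smul_add, smul_smul, varSign_comm v u,
      varSign_mul_self, one_smul, sub_add_cancel_left, mul_neg]
    refine neg_mem ?_
    split_ifs
    · rw [mul_smul_comm, mul_one]
      exact smul_hbar_mem_hbarWeylFinite s _
    · rw [smul_zero, mul_zero]
      exact zero_mem _
  · intro u hu
    have h1 : (hbar * derVar u : Op K E O) * (hbar * derVar v)
        = hbar * hbar * (derVar u * derVar v) := by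
      rw [mul_assoc, ← mul_assoc (derVar u), ← hbar_comm_derVar]
      simp only [mul_assoc]
    have h2 : (hbar * derVar v : Op K E O) * (hbar * derVar u)
        = hbar * hbar * (derVar v * derVar u) := by
      rw [mul_assoc, ← mul_assoc (derVar v), ← hbar_comm_derVar]
      simp only [mul_assoc]
    rw [map_mul, varConj_hbar, varConj_derVar, mul_smul_comm, mul_smul_comm, h1, h2,
      derVar_mul_derVar u v, mul_smul_comm, sub_self]
    exact zero_mem _

variable [CharZero K]

omit [CharZero K] in
theorem evenPart_mem_weylFinite [Nonempty O] {s : Set (E ⊕ O)} {T : Op K E O}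
    (hT : T ∈ weylFinite K s) : evenPart T ∈ weylFinite K s :=
  Subalgebra.smul_mem _ (add_mem hT (parityConj_mem_weylFinite hT)) _

omit [CharZero K] in
theorem oddPart_mem_weylFinite [Nonempty O] {s : Set (E ⊕ O)} {T : Op K E O}
    (hT : T ∈ weylFinite K s) : oddPart T ∈ weylFinite K s :=
  Subalgebra.smul_mem _ (sub_mem hT (parityConj_mem_weylFinite hT)) _

omit [LinearOrder O] in
theorem evenPart_mul (T S : Op K E O) :
    evenPart (T * S) = evenPart T * evenPart S + oddPart T * oddPart S := by
  simp only [evenPart_eq, oddPart_eq, map_mul, smul_mul_smul_comm, ← smul_add]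
  rw [show (T + parityConj T) * (S + parityConj S) + (T - parityConj T) * (S - parityConj S)
    = (2 : ℕ) • (T * S + parityConj T * parityConj S) by noncomm_ring, ← Nat.cast_smul_eq_nsmul K,
    smul_smul]
  norm_num

omit [LinearOrder O] in
theorem oddPart_mul (T S : Op K E O) :
    oddPart (T * S) = evenPart T * oddPart S + oddPart T * evenPart S := by
  simp only [evenPart_eq, oddPart_eq, map_mul, smul_mul_smul_comm, ← smul_add]
  rw [show (T + parityConj T) * (S - parityConj S) + (T - parityConj T) * (S + parityConj S)
    = (2 : ℕ) • (T * S - parityConj T * parityConj S) by noncomm_ring, ← Nat.cast_smul_eq_nsmul K,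
    smul_smul]
  norm_num

/-- By induction on B. A homogeneous generator has only one nonzero part, for which the earlier
twisted commutators apply. In products the two kinds of commutators mix: the even part of B B'
contains the product of the odd parts. -/
theorem twisted_comm_parts_mem [Nonempty O] {s : Set (E ⊕ O)} {B : Op K E O}
    (hB : B ∈ weylFinite K s) : ∀ A ∈ weylFinite K s,
      A * evenPart B - evenPart B * A ∈ hbarWeylFinite K s ∧
      A * oddPart B - oddPart B * parityConj A ∈ hbarWeylFinite K s := by
  have homogeneous : ∀ v : E ⊕ O, ∀ b : Op K E O, varConj (Sum.inr (Classical.arbitrary O)) b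
      = varSign K (Sum.inr (Classical.arbitrary O)) v • b →
      (∀ A ∈ weylFinite K s, A * b - b * varConj v A ∈ hbarWeylFinite K s) →
      ∀ A ∈ weylFinite K s, A * evenPart b - evenPart b * A ∈ hbarWeylFinite K s ∧
      A * oddPart b - oddPart b * parityConj A ∈ hbarWeylFinite K s := by
    intro v b hb h A hA
    rcases v with e | o
    · have hb' : IsEvenOp b := hb.trans (one_smul K b)
      rw [hb'.evenPart, hb'.oddPart]
      exact ⟨h A hA, by simp⟩
    · have hb' : IsOddOp b := hb.trans (neg_one_smul K b)
      rw [hb'.evenPart, hb'.oddPart]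
      exact ⟨by simp, h A hA⟩
  have central : ∀ b : Op K E O, parityConj b = b →
      (∀ A ∈ weylFinite K s, A * b = b * A) →
      ∀ A ∈ weylFinite K s, A * evenPart b - evenPart b * A ∈ hbarWeylFinite K s ∧
      A * oddPart b - oddPart b * parityConj A ∈ hbarWeylFinite K s := by
    intro b hb h A hA
    have hb' : IsEvenOp b := hb
    rw [hb'.evenPart, hb'.oddPart, h A hA, sub_self]
    simp
  induction hB using Algebra.adjoin_induction with
  | mem b hb =>
    refine weylGen_cases (P := fun b => ∀ A ∈ weylFinite K s,
      A * evenPart b - evenPart b * A ∈ hbarWeylFinite K s ∧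
      A * oddPart b - oddPart b * parityConj A ∈ hbarWeylFinite K s) ?_ ?_ ?_ b hb
    · exact central hbar parityConj_hbar fun A hA => (hbar_comm_of_mem_weylFinite hA).symm
    · exact fun v _ => homogeneous v _ (by rw [varConj_mulVar, varSign_comm])
        fun A hA => twisted_comm_mulVar_mem v hA
    · exact fun v _ => homogeneous v _
        (by rw [map_mul, varConj_hbar, varConj_derVar, varSign_comm, mul_smul_comm])
        fun A hA => twisted_comm_derVar_mem v hA
  | algebraMap c =>
    exact central _ (AlgHom.commutes _ c) fun A _ => (Algebra.commutes c A).symm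
  | add B B' _ _ h h' =>
    intro A hA
    simp only [← evenPartₗ_apply, ← oddPartₗ_apply, map_add, mul_add, add_mul, add_sub_add_comm]
    exact ⟨add_mem (h A hA).1 (h' A hA).1, add_mem (h A hA).2 (h' A hA).2⟩
  | mul B B' hB hB' h h' =>
    intro A hA
    have hA' := parityConj_mem_weylFinite hA
    rw [evenPart_mul, oddPart_mul]
    constructor
    · rw [show A * (evenPart B * evenPart B' + oddPart B * oddPart B')
          - (evenPart B * evenPart B' + oddPart B * oddPart B') * A
        = ((A * evenPart B - evenPart B * A) * evenPart B'
            + evenPart B * (A * evenPart B' - evenPart B' * A))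
          + ((A * oddPart B - oddPart B * parityConj A) * oddPart B'
            + oddPart B * (parityConj A * oddPart B' - oddPart B' * A)) by noncomm_ring]
      -- Passing two odd factors conjugates A twice, and the two conjugations cancel.
      have h4 := (h' _ hA').2
      rw [parityConj_parityConj] at h4
      exact add_mem (add_mem
        (mul_mem_hbarWeylFinite_right (h A hA).1 (evenPart_mem_weylFinite hB'))
        (mul_mem_hbarWeylFinite_left (evenPart_mem_weylFinite hB) (h' A hA).1)) (add_mem
        (mul_mem_hbarWeylFinite_right (h A hA).2 (oddPart_mem_weylFinite hB'))
        (mul_mem_hbarWeylFinite_left (oddPart_mem_weylFinite hB) h4))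
    · rw [show A * (evenPart B * oddPart B' + oddPart B * evenPart B')
          - (evenPart B * oddPart B' + oddPart B * evenPart B') * parityConj A
        = ((A * evenPart B - evenPart B * A) * oddPart B'
            + evenPart B * (A * oddPart B' - oddPart B' * parityConj A))
          + ((A * oddPart B - oddPart B * parityConj A) * evenPart B'
            + oddPart B * (parityConj A * evenPart B' - evenPart B' * parityConj A))
            by noncomm_ring]
      exact add_mem (add_mem
        (mul_mem_hbarWeylFinite_right (h A hA).1 (oddPart_mem_weylFinite hB'))
        (mul_mem_hbarWeylFinite_left (evenPart_mem_weylFinite hB) (h' A hA).2)) (add_mem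
        (mul_mem_hbarWeylFinite_right (h A hA).2 (evenPart_mem_weylFinite hB'))
        (mul_mem_hbarWeylFinite_left (oddPart_mem_weylFinite hB) (h' _ hA').1))

theorem superComm_mem_hbarWeylFinite [Nonempty O] {s : Set (E ⊕ O)} {A B : Op K E O}
    (hA : A ∈ weylFinite K s) (hB : B ∈ weylFinite K s) :
    superComm A B ∈ hbarWeylFinite K s := by
  rw [superComm_eq, show A * B = A * evenPart B + A * oddPart B by
      rw [← mul_add, evenPart_add_oddPart], sub_sub, add_sub_add_comm]
  exact add_mem (twisted_comm_parts_mem hB A hA).1 (twisted_comm_parts_mem hB A hA).2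

end WeylFinite

/-! ### The completed Weyl algebra. -/

section WeylHat

variable {K E O : Type*} [Field K]

/-- Division by `ħ`, a left inverse of multiplication by `ħ`. -/
def unhbar : Op K E O :=
  substOp (fun _ => 1) (fun m => (m.1 + 1, m.2)) (fun d => d + 2)
    (by
      rintro ⟨k, p⟩ - ⟨l, q⟩ - h
      simpa using h)
    (by
      rintro ⟨k, p⟩ -
      simp only [Mono.deg]
      omega)

theorem unhbar_mul_hbar : (unhbar : Op K E O) * hbar = 1 := by
  refine LinearMap.ext fun f => Series.ext fun ⟨k, α, S⟩ => ?_
  change 1 * ((hbar : Op K E O) f).coeff (k + 1, α, S) = f.coeff (k, α, S)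
  simp [hbar_coeff]

/-- Division by ħ lowers degrees by 2, so it is not filtered; it is continuous nevertheless, with
the shift from p to p + 2. -/
theorem unhbar_continuous : Continuous (unhbar : Op K E O) := by
  refine continuous_iff_continuousAt.2 fun f => ?_
  refine ((Series.nhds_hasBasis f).tendsto_iff
      (Series.nhds_hasBasis _)).2 fun p _ => ⟨p + 2, trivial, fun g hg => ?_⟩
  rintro ⟨k, α, S⟩ hm
  have := hg (k + 1, α, S) (by simp only [Mono.deg] at hm ⊢; omega)
  rw [← map_sub]
  change 1 * (g - f).coeff (k + 1, α, S) = 0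
  rw [this, mul_zero]

theorem hbar_continuous : Continuous (hbar : Op K E O) :=
  (homog_hbar.filtered (by norm_num)).continuous

variable [LinearOrder O] {s : Set (E ⊕ O)}

theorem isClosed_weylHat : IsClosed (weylHat K s) := isClosed_closure

theorem weylFinite_subset_weylHat : (weylFinite K s : Set (Op K E O)) ⊆ weylHat K s :=
  subset_closure

theorem weylHat_induction {P : Op K E O → Prop} (hP : IsClosed {T | P T})
    (h : ∀ T ∈ weylFinite K s, P T) {T : Op K E O} (hT : T ∈ weylHat K s) : P T :=
  closure_minimal h hP hT

/-- The subspaces `filt p` are closed, so not lowering degrees survives pointwise limits. In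
particular elements of the completion are continuous and may be used as left factors under limits.
-/
theorem filtered_of_mem_weylHat {T : Op K E O} (hT : T ∈ weylHat K s) : Filtered T := by
  refine weylHat_induction ?_ (fun T hT => filtered_of_mem_weylFinite hT) hT
  simp only [Filtered, Set.ofPred_forall]
  exact isClosed_iInter fun p => isClosed_iInter fun f => isClosed_iInter fun _ =>
    (Series.isClosed_filt p).preimage (Op.continuous_apply f)

theorem hbar_comm_of_mem_weylHat {T : Op K E O} (hT : T ∈ weylHat K s) : hbar * T = T * hbar :=
  weylHat_induction
    (isClosed_eq (Filtered.continuous_mul_left hbar_continuous) (Op.continuous_mul_right _))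
    (fun _ hT => hbar_comm_of_mem_weylFinite hT) hT

theorem add_mem_weylHat {T S : Op K E O} (hT : T ∈ weylHat K s) (hS : S ∈ weylHat K s) :
    T + S ∈ weylHat K s :=
  map_mem_closure₂ continuous_add hT hS fun _ hT _ hS => add_mem hT hS

theorem smul_mem_weylHat (c : K) {T : Op K E O} (hT : T ∈ weylHat K s) : c • T ∈ weylHat K s :=
  map_mem_closure (Op.continuous_smul c) hT fun _ hT => Subalgebra.smul_mem _ hT c

/-- Two separate limits: with S in the uncompleted algebra, right multiplication by S is continuous;
afterwards S varies, and continuity of T is what is needed. -/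
theorem mul_mem_weylHat {T S : Op K E O} (hT : T ∈ weylHat K s) (hS : S ∈ weylHat K s) :
    T * S ∈ weylHat K s := by
  refine weylHat_induction (P := fun S => T * S ∈ weylHat K s)
    (isClosed_weylHat.preimage
      (Filtered.continuous_mul_left (filtered_of_mem_weylHat hT).continuous)) ?_ hS
  intro S hS
  exact map_mem_closure (f := fun T => T * S) (Op.continuous_mul_right S) hT
    fun T hT => mul_mem hT hS

/-- The completed Weyl algebra as a subspace. -/
def weylHatSubmodule (K : Type*) [Field K] (s : Set (E ⊕ O)) : Submodule K (Op K E O) where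
  carrier := weylHat K s
  zero_mem' := weylFinite_subset_weylHat (zero_mem _)
  add_mem' := add_mem_weylHat
  smul_mem' c _ hT := smul_mem_weylHat c hT

theorem hasSum_mem_weylHat {ι : Type*} {T : ι → Op K E O} {A : Op K E O} (h : HasSum T A)
    (hT : ∀ i, T i ∈ weylHat K s) : A ∈ weylHat K s :=
  isClosed_weylHat.mem_of_tendsto h
    (.of_forall fun _ => (weylHatSubmodule K s).sum_mem fun i _ => hT i)

theorem tsum_mem_weylHat {ι : Type*} {T : ι → Op K E O} (hT : ∀ i, T i ∈ weylHat K s) :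
    ∑' i, T i ∈ weylHat K s := by
  by_cases h : Summable T
  · exact hasSum_mem_weylHat h.hasSum hT
  · rw [tsum_eq_zero_of_not_summable h]
    exact (weylHatSubmodule K s).zero_mem

variable [CharZero K] [Nonempty O]

omit [CharZero K] in
theorem evenPart_mem_weylHat {T : Op K E O} (hT : T ∈ weylHat K s) : evenPart T ∈ weylHat K s :=
  map_mem_closure evenPart_continuous hT fun _ hT => evenPart_mem_weylFinite hT

omit [CharZero K] in
theorem oddPart_mem_weylHat {T : Op K E O} (hT : T ∈ weylHat K s) : oddPart T ∈ weylHat K s :=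
  map_mem_closure oddPart_continuous hT fun _ hT => oddPart_mem_weylFinite hT

/-- Supercommutators in the completed Weyl algebra are divisible by `ħ`. -/
theorem superComm_mem_hbar_weylHat {A B : Op K E O} (hA : A ∈ weylHat K s)
    (hB : B ∈ weylHat K s) : ∃ C ∈ weylHat K s, superComm A B = hbar * C := by
  suffices h : unhbar * superComm A B ∈ weylHat K s ∧
      hbar * (unhbar * superComm A B) = superComm A B from ⟨_, h.1, h.2.symm⟩
  -- Written with `unhbar`, being ħ times an element of the completion is a closed condition. It
  -- therefore passes to limits, in B with A fixed and then in A with B in the uncompleted algebra.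
  have hcl : IsClosed {T : Op K E O | unhbar * T ∈ weylHat K s ∧ hbar * (unhbar * T) = T} :=
    (isClosed_weylHat.preimage (Filtered.continuous_mul_left unhbar_continuous)).inter
      (isClosed_eq ((Filtered.continuous_mul_left hbar_continuous).comp
        (Filtered.continuous_mul_left unhbar_continuous)) continuous_id)
  have hfin : ∀ T ∈ hbarWeylFinite K s,
      T ∈ {T : Op K E O | unhbar * T ∈ weylHat K s ∧ hbar * (unhbar * T) = T} := by
    rintro _ ⟨C, hC, rfl⟩
    have h1 : unhbar * (hbar * C) = C := by rw [← mul_assoc, unhbar_mul_hbar, one_mul]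
    refine ⟨?_, ?_⟩
    · change unhbar * (hbar * C) ∈ _
      rw [h1]
      exact weylFinite_subset_weylHat hC
    · change hbar * (unhbar * (hbar * C)) = hbar * C
      rw [h1]
  refine weylHat_induction (P := fun B => superComm A B ∈
    {T : Op K E O | unhbar * T ∈ weylHat K s ∧ hbar * (unhbar * T) = T})
    (hcl.preimage (superComm_continuous_right A (filtered_of_mem_weylHat hA).continuous)) ?_ hB
  intro B hB
  refine weylHat_induction (P := fun A => superComm A B ∈
    {T : Op K E O | unhbar * T ∈ weylHat K s ∧ hbar * (unhbar * T) = T})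
    (hcl.preimage (superComm_continuous_left B
      (filtered_of_mem_weylFinite (evenPart_mem_weylFinite hB)).continuous
      (filtered_of_mem_weylFinite (oddPart_mem_weylFinite hB)).continuous)) ?_ hA
  exact fun A hA => hfin _ (superComm_mem_hbarWeylFinite hA hB)

end WeylHat

/-! ### Infinite linear combinations of a locally finite family. -/

section AiryMap

theorem _root_.HasSum.congr_fun' {α β : Type*} [AddCommMonoid α] [TopologicalSpace α]
    {f g : β → α} {a : α} (h : HasSum f a) (hfg : ∀ b, f b = g b) : HasSum g a :=
  (funext hfg : f = g) ▸ h


variable {K E O A : Type*} [Field K]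

theorem hasSum_const_smul {T : A → Op K E O} {B : Op K E O} (c : K) (h : HasSum T B) :
    HasSum (fun a => c • T a) (c • B) :=
  h.map (LinearMap.lsmul K (Op K E O) c).toAddMonoidHom (Op.continuous_smul c)

theorem hasSum_mul_left {T : A → Op K E O} {B : Op K E O} {C : Op K E O} (hC : Continuous C)
    (h : HasSum T B) : HasSum (fun a => C * T a) (C * B) :=
  h.map (AddMonoidHom.mulLeft C) (Filtered.continuous_mul_left hC)

theorem hasSum_mul_right {T : A → Op K E O} {B : Op K E O} (C : Op K E O)
    (h : HasSum T B) : HasSum (fun a => T a * C) (B * C) :=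
  h.map (AddMonoidHom.mulRight C) (Op.continuous_mul_right C)

theorem LocFin.smul {H : A → Op K E O} (hH : LocFin H) (φ : A → K) :
    LocFin fun a => φ a • H a := fun f p =>
  (hH f p).subset fun _ ha h => ha (Submodule.smul_mem _ _ h)

/-- The linear map `φ ↦ ∑ φ_a H_a`. -/
def airyMap (H : A → Op K E O) (hH : LocFin H) : (A → K) →ₗ[K] Op K E O where
  toFun φ := opSum (fun a => φ a • H a) (hH.smul φ)
  map_add' φ ψ := by
    refine (hH.smul (φ + ψ)).hasSum.unique ?_
    simpa only [Pi.add_apply, add_smul] using (hH.smul φ).hasSum.add (hH.smul ψ).hasSum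
  map_smul' c φ := by
    refine (hH.smul (c • φ)).hasSum.unique ?_
    have := hasSum_const_smul c (hH.smul φ).hasSum
    exact this.congr_fun' fun a => (mul_smul c (φ a) (H a)).symm

variable {H : A → Op K E O} (hH : LocFin H)

theorem hasSum_airyMap (φ : A → K) : HasSum (fun a => φ a • H a) (airyMap H hH φ) :=
  (hH.smul φ).hasSum

theorem airyMap_single [DecidableEq A] (a : A) (c : K) :
    airyMap H hH (Pi.single a c) = c • H a := by
  refine (hasSum_airyMap hH _).unique ?_
  have := hasSum_single (f := fun b => (Pi.single a c : A → K) b • H b) a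
    (fun b hb => by simp [Pi.single_eq_of_ne hb])
  simpa using this

theorem airyMap_mem_filt {φ : A → K} {f : Series K E O} {p : ℕ}
    (h : ∀ a, H a f ∉ Series.filt p → φ a = 0) : airyMap H hH φ f ∈ Series.filt p := by
  refine Filtered.hasSum (hasSum_airyMap hH φ) fun a => ?_
  by_cases ha : H a f ∈ Series.filt p
  · exact Submodule.smul_mem _ _ ha
  · rw [h a ha, zero_smul]
    exact zero_mem _

/-- Applied to f and taken modulo `filt p`, the operator sees finitely many coordinates a, and each
coordinate is nonzero for finitely many φ i. So a finite partial sum is already exact modulo `filt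
p`. -/
theorem hasSum_airyMap_finsum {ι : Type*} (φ : ι → A → K) (hφ : ∀ a, {i | φ i a ≠ 0}.Finite) :
    HasSum (fun i => airyMap H hH (φ i)) (airyMap H hH fun a => ∑ᶠ i, φ i a) := by
  classical
  refine Op.hasSum_iff.2 fun f p =>
    ⟨(hH f p).toFinset.biUnion fun a => (hφ a).toFinset, fun s hs => ?_⟩
  rw [← LinearMap.sum_apply, ← map_sum, ← LinearMap.sub_apply, ← map_sub]
  refine airyMap_mem_filt hH fun a ha => ?_
  rw [Pi.sub_apply, Finset.sum_apply, sub_eq_zero]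
  refine (finsum_eq_sum_of_support_subset _ fun i hi => hs ?_).symm
  simp only [Finset.mem_biUnion, Set.Finite.mem_toFinset]
  exact ⟨a, ha, hi⟩

/-- For given f and p only finitely many coordinates of φ matter; fixing them is an open condition
in the product of discrete topologies. -/
theorem airyMap_continuous :
    @Continuous _ _ (@Pi.topologicalSpace A (fun _ => K) (fun _ => ⊥)) inferInstance
      (airyMap H hH) := by
  let : TopologicalSpace K := ⊥
  have : DiscreteTopology K := ⟨rfl⟩
  refine Op.continuous_iff.2 fun f => continuous_iff_continuousAt.2 fun φ => ?_
  refine ((Series.nhds_hasBasis _).tendsto_right_iff).2 fun p _ => ?_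
  have h : {ψ : A → K | ∀ a ∈ {a | H a f ∉ Series.filt p}, ψ a ∈ ({φ a} : Set K)} ∈ 𝓝 φ :=
    (isOpen_set_pi (hH f p) fun a _ => isOpen_discrete ({φ a} : Set K)).mem_nhds
      fun a _ => rfl
  filter_upwards [h] with ψ hψ
  change _ - _ ∈ _
  rw [← LinearMap.sub_apply, ← map_sub]
  exact airyMap_mem_filt hH fun a ha => sub_eq_zero.2 (hψ a ha)

theorem parityConj_airyMap (c : K) {φ : A → K}
    (h : ∀ a, φ a • parityConj (H a) = c • (φ a • H a)) :
    parityConj (airyMap H hH φ) = c • airyMap H hH φ := by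
  have h1 := (hasSum_airyMap hH φ).map parityConj parityConj_continuous
  have h2 := hasSum_const_smul c (hasSum_airyMap hH φ)
  refine h1.unique ?_
  convert h2 using 1
  funext a
  rw [← h a, Function.comp_apply, map_smul]

variable [LinearOrder O] [CharZero K]

omit [CharZero K] in
theorem airyMap_mem_weylHat {s : Set (E ⊕ O)} (hW : ∀ a, H a ∈ weylHat K s) (φ : A → K) :
    airyMap H hH φ ∈ weylHat K s :=
  hasSum_mem_weylHat (hasSum_airyMap hH φ) fun a => smul_mem_weylHat _ (hW a)

/-- If the operators `H a` satisfy commutation relations with locally finite structure constants,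
their infinite linear combinations are closed under the bracket. -/
theorem exists_superComm_airyMap [Nonempty O] {s : Set (E ⊕ O)} (hW : ∀ a, H a ∈ weylHat K s)
    (κ : A → A → K) (τ : A → A → A)
    (hbr : ∀ a b, superComm (H a) (H b) = κ a b • (hbar * H (τ a b)))
    (hfin : ∀ c, {q : A × A | κ q.1 q.2 ≠ 0 ∧ τ q.1 q.2 = c}.Finite) (φ ψ : A → K) :
    ∃ χ : A → K, superComm (airyMap H hH φ) (airyMap H hH ψ) = hbar * airyMap H hH χ := by
  classical
  have hL := airyMap_mem_weylHat hH hW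
  have hne : ∀ a b c, (Pi.single (τ a b) (ψ b * κ a b) : A → K) c ≠ 0 →
      κ a b ≠ 0 ∧ τ a b = c := by
    intro a b c h
    have h1 : τ a b = c := by
      by_contra h'
      exact h (Pi.single_eq_of_ne (Ne.symm h') _)
    subst h1
    rw [Pi.single_eq_same] at h
    exact ⟨right_ne_zero_of_mul h, rfl⟩
  -- First only the second argument is expanded, and its brackets with one H a are collected
  -- according to the index `τ a b` on the right.
  have step : ∀ a, superComm (H a) (airyMap H hH ψ) = hbar * airyMap H hH
      (fun c => ∑ᶠ b, (Pi.single (τ a b) (ψ b * κ a b) : A → K) c) := by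
    intro a
    have h1 := (hasSum_airyMap hH ψ).map (superCommₗ (H a)).toAddMonoidHom
      (superComm_continuous_right (H a) (filtered_of_mem_weylHat (hW a)).continuous)
    have h2 := hasSum_mul_left hbar_continuous (hasSum_airyMap_finsum hH
        (fun b => (Pi.single (τ a b) (ψ b * κ a b) : A → K)) fun c =>
        ((hfin c).preimage (Prod.mk_right_injective a).injOn).subset (hne a · c))
    refine (h1.congr_fun' ?_).unique h2
    intro b
    simp only [Function.comp_apply, LinearMap.toAddMonoidHom_coe, map_smul, superCommₗ_apply, hbr,
      airyMap_single, mul_smul_comm, smul_smul]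
  have hLψ := hL ψ
  have h1 := (hasSum_airyMap hH φ).map (superCommₗ.flip (airyMap H hH ψ)).toAddMonoidHom
    (superComm_continuous_left _
      (filtered_of_mem_weylHat (evenPart_mem_weylHat hLψ)).continuous
      (filtered_of_mem_weylHat (oddPart_mem_weylHat hLψ)).continuous)
  have h2 := hasSum_mul_left hbar_continuous (hasSum_airyMap_finsum hH
      (fun a => φ a • fun c => ∑ᶠ b, (Pi.single (τ a b) (ψ b * κ a b) : A → K) c) fun c =>
      -- The indices a that contribute to the coordinate c are first components of the finite fibre
      -- over c.
      ((hfin c).image Prod.fst).subset (by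
        intro a ha
        obtain ⟨b, hb⟩ : ∃ b, (Pi.single (τ a b) (ψ b * κ a b) : A → K) c ≠ 0 := by
          by_contra! h
          exact right_ne_zero_of_mul ha ((finsum_congr h).trans finsum_zero)
        exact ⟨(a, b), hne a b c hb, rfl⟩))
  refine ⟨_, (h1.congr_fun' ?_).unique h2⟩
  intro a
  simp only [Function.comp_apply, LinearMap.toAddMonoidHom_coe, map_smul, superCommₗ_apply,
    mul_smul_comm, LinearMap.flip_apply, step]

end AiryMap

/-! ### The left ideal generated by the operators and the graded Leibniz rule. -/

section LeftIdeal

variable {K E O : Type*} [Field K]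

/-- The operator is homogeneous of parity `x` (`true` for odd operators). -/
def HasParity (x : Bool) (T : Op K E O) : Prop := parityConj T = (if x then -1 else 1 : K) • T

theorem hasParity_false {T : Op K E O} : HasParity false T ↔ IsEvenOp T := by
  unfold HasParity IsEvenOp
  simp [parityConj_apply]

theorem hasParity_true {T : Op K E O} : HasParity true T ↔ IsOddOp T := by
  unfold HasParity IsOddOp
  simp [parityConj_apply]

theorem HasParity.mul {x y : Bool} {T S : Op K E O} (hT : HasParity x T) (hS : HasParity y S) :
    HasParity (xor x y) (T * S) := by
  unfold HasParity at *
  rw [map_mul, hT, hS, smul_mul_smul_comm]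
  cases x <;> cases y <;> simp

variable [CharZero K]

theorem HasParity.superComm {x y : Bool} {T S : Op K E O} (hT : HasParity x T)
    (hS : HasParity y S) :
    superComm T S = T * S - (if x && y then -1 else 1 : K) • (S * T) := by
  cases x
  · rw [(hasParity_false.1 hT).superComm_left]
    simp
  · cases y
    · rw [(hasParity_false.1 hS).superComm_right]
      simp
    · rw [(hasParity_true.1 hT).superComm (hasParity_true.1 hS)]
      simp

/-- Leibniz rule in both arguments, arranged so that every term ends in X, in Y or in their bracket.
With X and Y generators of a left ideal all four terms stay in it, provided the bracket of X and Y
does. -/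
theorem superComm_mul_mul {a x b y : Bool} {A X B Y : Op K E O} (hA : HasParity a A)
    (hX : HasParity x X) (hB : HasParity b B) (hY : HasParity y Y) :
    superComm (A * X) (B * Y) = A * superComm X B * Y
      + (if x && b then -1 else 1 : K) • (A * B * superComm X Y)
      + ((if x && b then -1 else 1) * (if x && y then -1 else 1) : K) • (superComm A B * Y * X)
      - (if xor a x && xor b y then -1 else 1 : K) • (B * superComm Y A * X) := by
  rw [(hA.mul hX).superComm (hB.mul hY), hX.superComm hB, hX.superComm hY, hA.superComm hB,
    hY.superComm hA]
  cases a <;> cases x <;> cases b <;> cases y <;> simp [mul_sub, sub_mul, mul_add, add_mul,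
    mul_assoc] <;> abel

variable [LinearOrder O]

/-- In the Leibniz rule the bracket of two generators is handled by `hbr`. The other three brackets
are taken in the completed Weyl algebra, where they yield the factor ħ by themselves. -/
theorem leftIdeal_superComm [Nonempty O] {P : Type*} [AddCommGroup P] [Module K P]
    (L : P →ₗ[K] Op K E O)
    (hW : ∀ φ, L φ ∈ weylHat K (Set.univ : Set (E ⊕ O)))
    (hpar : ∀ φ, ∃ φe φo, φ = φe + φo ∧ IsEvenOp (L φe) ∧ IsOddOp (L φo))
    (hbr : ∀ φ ψ, ∃ χ, superComm (L φ) (L ψ) = hbar * L χ) :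
    ∀ A ∈ leftIdeal L, ∀ B ∈ leftIdeal L, ∃ C ∈ leftIdeal L, superComm A B = hbar * C := by
  set G : Set (Op K E O) := {T | ∃ A ∈ weylHat K (Set.univ : Set (E ⊕ O)), ∃ φ a x,
    HasParity a A ∧ HasParity x (L φ) ∧ T = A * L φ} with hG
  -- Splitting both factors into even and odd parts shows that products of homogeneous operators
  -- span the ideal, so that the signs in the Leibniz rule are defined.
  have hspan : leftIdeal L ≤ Submodule.span K G := by
    refine Submodule.span_le.2 ?_
    rintro _ ⟨A, hA, φ, rfl⟩
    obtain ⟨φe, φo, rfl, he, ho⟩ := hpar φ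
    rw [← evenPart_add_oddPart A, map_add, mul_add, add_mul, add_mul]
    have mem : ∀ {A' φ' a x}, A' ∈ weylHat K (Set.univ : Set (E ⊕ O)) → HasParity a A' →
        HasParity x (L φ') → A' * L φ' ∈ Submodule.span K G := fun h1 h2 h3 =>
      Submodule.subset_span ⟨_, h1, _, _, _, h2, h3, rfl⟩
    have hAe := hasParity_false.2 (isEvenOp_evenPart A)
    have hAo := hasParity_true.2 (isOddOp_oddPart A)
    have hLe := hasParity_false.2 he
    have hLo := hasParity_true.2 ho
    exact add_mem (add_mem (mem (evenPart_mem_weylHat hA) hAe hLe)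
      (mem (oddPart_mem_weylHat hA) hAo hLe)) (add_mem (mem (evenPart_mem_weylHat hA) hAe hLo)
      (mem (oddPart_mem_weylHat hA) hAo hLo))
  set M : Submodule K (Op K E O) := (leftIdeal L).map (LinearMap.mulLeft K hbar) with hM
  have memM : ∀ C ∈ weylHat K (Set.univ : Set (E ⊕ O)), ∀ φ, hbar * (C * L φ) ∈ M :=
    fun C hC φ => ⟨C * L φ, Submodule.subset_span ⟨C, hC, φ, rfl⟩, rfl⟩
  suffices h : ∀ A ∈ leftIdeal L, ∀ B ∈ leftIdeal L, superCommₗ A B ∈ M by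
    intro A hA B hB
    obtain ⟨C, hC, h⟩ := h A hA B hB
    exact ⟨C, hC, h.symm⟩
  refine fun A hA B hB => ?_
  have hmap : Submodule.map₂ superCommₗ (Submodule.span K G) (Submodule.span K G) ≤ M := by
    rw [Submodule.map₂_span_span, Submodule.span_le]
    rintro _ ⟨_, ⟨A, hA, φ, a, x, hAa, hφx, rfl⟩, _, ⟨B, hB, ψ, b, y, hBb, hψy, rfl⟩, rfl⟩
    change superComm (A * L φ) (B * L ψ) ∈ M
    rw [superComm_mul_mul hAa hφx hBb hψy]
    obtain ⟨C₁, hC₁, h₁⟩ := superComm_mem_hbar_weylHat (hW φ) hB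
    obtain ⟨χ, h₂⟩ := hbr φ ψ
    obtain ⟨C₃, hC₃, h₃⟩ := superComm_mem_hbar_weylHat hA hB
    obtain ⟨C₄, hC₄, h₄⟩ := superComm_mem_hbar_weylHat (hW ψ) hA
    rw [h₁, h₂, h₃, h₄]
    refine sub_mem (add_mem (add_mem ?_ (M.smul_mem _ ?_)) (M.smul_mem _ ?_)) (M.smul_mem _ ?_)
    · rw [← mul_assoc A, ← hbar_comm_of_mem_weylHat hA, mul_assoc hbar A, mul_assoc]
      exact memM _ (mul_mem_weylHat hA hC₁) ψ
    · rw [← mul_assoc, ← hbar_comm_of_mem_weylHat (mul_mem_weylHat hA hB), mul_assoc]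
      exact memM _ (mul_mem_weylHat hA hB) χ
    · rw [mul_assoc hbar, mul_assoc hbar]
      exact memM _ (mul_mem_weylHat hC₃ (hW ψ)) φ
    · rw [← mul_assoc B, ← hbar_comm_of_mem_weylHat hB, mul_assoc hbar B, mul_assoc]
      exact memM _ (mul_mem_weylHat hB hC₄) φ
  exact hmap (Submodule.apply_mem_map₂ _ (hspan hA) (hspan hB))

end LeftIdeal

/-! ### A criterion for super quantum Airy structures. -/

section Criterion

variable {K E O : Type*} [Field K] [CharZero K] [LinearOrder O] [DecidableEq E]

/-- Operators with the prescribed linear terms and locally finite commutation relations form a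
super quantum Airy structure. -/
theorem isSuperQuantumAiry_airyMap {H : E ⊕ O → Op K E (WithBot O)} (hH : LocFin H)
    (hW : ∀ a, H a ∈ weylHat K (Set.univ : Set (E ⊕ WithBot O)))
    (heven : ∀ e, IsEvenOp (H (Sum.inl e))) (hodd : ∀ o, IsOddOp (H (Sum.inr o)))
    (κ : E ⊕ O → E ⊕ O → K) (τ : E ⊕ O → E ⊕ O → E ⊕ O)
    (hbr : ∀ a b, superComm (H a) (H b) = κ a b • (hbar * H (τ a b)))
    (hfin : ∀ c, {q : (E ⊕ O) × (E ⊕ O) | κ q.1 q.2 ≠ 0 ∧ τ q.1 q.2 = c}.Finite)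
    (hdeg : ∀ a, ∃ R, Homog 2 R ∧ H a = hbar * derVar (inclVar a) + R) :
    IsSuperQuantumAiry (airyMap H hH) := by
  have map_even : ∀ φ : E ⊕ O → K, (∀ o, φ (Sum.inr o) = 0) → IsEvenOp (airyMap H hH φ) := by
    intro φ hφ
    refine (parityConj_airyMap hH 1 ?_).trans (one_smul K _)
    rintro (e | o)
    · rw [one_smul, parityConj_apply, heven]
    · simp [hφ]
  have map_odd : ∀ φ : E ⊕ O → K, (∀ e, φ (Sum.inl e) = 0) → IsOddOp (airyMap H hH φ) := by
    intro φ hφ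
    refine (parityConj_airyMap hH (-1) ?_).trans (neg_one_smul K _)
    rintro (e | o)
    · simp [hφ]
    · rw [parityConj_apply, hodd, smul_neg, neg_one_smul]
  have hW' := airyMap_mem_weylHat hH hW
  refine ⟨hW', map_even, map_odd, airyMap_continuous hH, ?_, ?_⟩
  · refine leftIdeal_superComm (airyMap H hH) hW' (fun φ => ?_)
      (exists_superComm_airyMap hH hW κ τ hbr hfin)
    refine ⟨Sum.elim (φ ∘ Sum.inl) 0, Sum.elim 0 (φ ∘ Sum.inr), ?_, map_even _ fun _ => rfl,
      map_odd _ fun _ => rfl⟩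
    funext a
    rcases a with e | o <;> simp
  · intro a
    obtain ⟨R, hR, h⟩ := hdeg a
    rw [airyMap_single, one_smul, h, degLE_add, hR.degLE_eq_zero (by norm_num), add_zero]
    exact (homog_hbar_mul_derVar _).degLE_eq_self (by norm_num)

end Criterion

/-! ### The Jacobi identity for brackets with signs. -/

section Jacobi

variable {K A : Type*} [Field K] [Ring A] [Algebra K A]

/-- If the brackets of `P`, `Q` and `T` with `X` match, then `[P, Q] - r h T` commutes with `X`;
all brackets are meant up to the given signs. -/
theorem bracket_sub_mul_comm {P Q T X u v w h : A} {εp εq σ cu cv cw a b r : K} (hσ : σ * σ = 1)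
    (hP' : h * P = P * h) (hQ' : h * Q = Q * h) (hX' : h * X = X * h)
    (hP : P * X = εp • (X * P) + cu • (h * u)) (hQ : Q * X = εq • (X * Q) + cv • (h * v))
    (hT : T * X = (εp * εq) • (X * T) + cw • (h * w))
    (hPv : P * v = (σ * εp) • (v * P) + a • (h * w))
    (hQu : Q * u = (σ * εq) • (u * Q) + b • (h * w)) (hc : cv * a - σ * cu * b = r * cw) :
    (P * Q - σ • (Q * P) - r • (h * T)) * X
      = (εp * εq) • (X * (P * Q - σ • (Q * P) - r • (h * T))) := by
  have e1 : P * Q * X = (εp * εq) • (X * (P * Q)) + (εq * cu) • (h * (u * Q))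
      + (cv * (σ * εp)) • (h * (v * P)) + (cv * a) • (h * (h * w)) := by
    rw [mul_assoc, hQ, mul_add, mul_smul_comm, mul_smul_comm, ← mul_assoc, hP, ← mul_assoc P h,
      ← hP', mul_assoc h P, hPv]
    simp only [add_mul, mul_add, smul_mul_assoc, mul_smul_comm, mul_assoc]
    module
  have e2 : Q * P * X = (εp * εq) • (X * (Q * P)) + (εp * cv) • (h * (v * P))
      + (cu * (σ * εq)) • (h * (u * Q)) + (cu * b) • (h * (h * w)) := by
    rw [mul_assoc, hP, mul_add, mul_smul_comm, mul_smul_comm, ← mul_assoc, hQ, ← mul_assoc Q h,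
      ← hQ', mul_assoc h Q, hQu]
    simp only [add_mul, mul_add, smul_mul_assoc, mul_smul_comm, mul_assoc]
    module
  have e3 : h * T * X = (εp * εq) • (X * (h * T)) + cw • (h * (h * w)) := by
    rw [mul_assoc, hT, mul_add, mul_smul_comm, mul_smul_comm, ← mul_assoc h X, hX', mul_assoc]
  -- The mixed terms h u Q and h v P cancel in the σ-commutator because σ² = 1. What remains is a
  -- multiple of h h w, balanced against the bracket of T by `hc`.
  rw [sub_mul, sub_mul, smul_mul_assoc, smul_mul_assoc, e1, e2, e3]
  simp only [mul_sub, mul_smul_comm]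
  match_scalars
  · ring
  · linear_combination (-(cu * εq)) * hσ
  · ring
  · linear_combination hc
  · ring
  · ring

end Jacobi

/-! ### The super Heisenberg algebra of the modes. -/

section ModeRelations

variable {K O : Type*} [Field K] [LinearOrder O] {t : ℕ → O}

omit [LinearOrder O] in
theorem bosMode_natCast (n : ℕ) : (bosMode n : Op K ℕ O) = hbar * derX n := by
  simp [bosMode]

omit [LinearOrder O] in
theorem bosMode_neg_natCast {n : ℕ} (hn : n ≠ 0) :
    (bosMode (-n) : Op K ℕ O) = (n : K) • mulX n := by
  rw [bosMode, if_neg (by omega)]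
  simp

theorem ferMode_natCast (t : ℕ → O) (n : ℕ) :
    (ferMode t n : Op K ℕ O) = hbar * derTheta (t n) := by
  simp [ferMode]

theorem ferMode_negSucc (t : ℕ → O) (n : ℕ) :
    (ferMode t (-n - 1) : Op K ℕ O) = mulTheta (t n) := by
  rw [ferMode, if_neg (by omega)]
  simp

theorem bosMode_cases {P : ℤ → Prop} (h1 : ∀ n : ℕ, P n) (h2 : ∀ n : ℕ, n ≠ 0 → P (-n)) (k : ℤ) :
    P k := by
  rcases le_or_gt 0 k with h | h
  · lift k to ℕ using h
    exact h1 k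
  · have := h2 (-k).toNat (by omega)
    rwa [Int.toNat_of_nonneg (by omega), neg_neg] at this

theorem ferMode_cases {P : ℤ → Prop} (h1 : ∀ n : ℕ, P n) (h2 : ∀ n : ℕ, P (-n - 1)) (k : ℤ) :
    P k := by
  rcases le_or_gt 0 k with h | h
  · lift k to ℕ using h
    exact h1 k
  · have := h2 (-k - 1).toNat
    rwa [Int.toNat_of_nonneg (by omega), neg_sub, sub_neg_eq_add, add_sub_cancel_left] at this

theorem bosMode_mem_weylFinite {s : Set (ℕ ⊕ O)} (hs : ∀ n, Sum.inl n ∈ s) (k : ℤ) :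
    (bosMode k : Op K ℕ O) ∈ weylFinite K s := by
  refine bosMode_cases (P := fun k => bosMode k ∈ weylFinite K s) (fun n => ?_) (fun n hn => ?_) k
  · rw [bosMode_natCast]
    exact hbar_mul_derVar_mem_weylFinite (hs n)
  · rw [bosMode_neg_natCast hn]
    exact Subalgebra.smul_mem _ (mulVar_mem_weylFinite (hs n)) _

theorem ferMode_mem_weylFinite {s : Set (ℕ ⊕ O)} (hs : ∀ n, Sum.inr (t n) ∈ s) (k : ℤ) :
    (ferMode t k : Op K ℕ O) ∈ weylFinite K s := by
  refine ferMode_cases (P := fun k => ferMode t k ∈ weylFinite K s) (fun n => ?_) (fun n => ?_) k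
  · rw [ferMode_natCast]
    exact hbar_mul_derVar_mem_weylFinite (hs n)
  · rw [ferMode_negSucc]
    exact mulVar_mem_weylFinite (hs n)

theorem hbar_comm_bosMode (k : ℤ) : (hbar : Op K ℕ O) * bosMode k = bosMode k * hbar :=
  hbar_comm_of_mem_weylFinite (bosMode_mem_weylFinite (fun _ => Set.mem_univ _) k)

theorem hbar_comm_ferMode (k : ℤ) : (hbar : Op K ℕ O) * ferMode t k = ferMode t k * hbar :=
  hbar_comm_of_mem_weylFinite (ferMode_mem_weylFinite (fun _ => Set.mem_univ _) k)

omit [LinearOrder O] in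
theorem homog_bosMode (k : ℤ) : Homog 1 (bosMode k : Op K ℕ O) := by
  refine bosMode_cases (P := fun k => Homog 1 (bosMode k : Op K ℕ O)) (fun n => ?_)
    (fun n hn => ?_) k
  · rw [bosMode_natCast]
    exact homog_hbar.mul (homog_derX n)
  · rw [bosMode_neg_natCast hn]
    exact (homog_mulX n).smul _

theorem homog_ferMode (k : ℤ) : Homog 1 (ferMode t k : Op K ℕ O) := by
  refine ferMode_cases (P := fun k => Homog 1 (ferMode t k : Op K ℕ O)) (fun n => ?_)
    (fun n => ?_) k
  · rw [ferMode_natCast]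
    exact homog_hbar.mul (homog_derTheta _)
  · rw [ferMode_negSucc]
    exact homog_mulTheta _

omit [LinearOrder O] in
theorem bosMode_continuous (k : ℤ) : Continuous (bosMode k : Op K ℕ O) :=
  ((homog_bosMode k).filtered zero_le_one).continuous

theorem ferMode_continuous (k : ℤ) : Continuous (ferMode t k : Op K ℕ O) :=
  ((homog_ferMode k).filtered zero_le_one).continuous

omit [LinearOrder O] in
theorem parityConj_bosMode (k : ℤ) : parityConj (bosMode k : Op K ℕ O) = bosMode k := by
  refine bosMode_cases (P := fun k => parityConj (bosMode k : Op K ℕ O) = bosMode k) (fun n => ?_)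
    (fun n hn => ?_) k
  · rw [bosMode_natCast, map_mul, parityConj_hbar, parityConj_derX]
  · rw [bosMode_neg_natCast hn, map_smul, parityConj_mulX]

theorem parityConj_ferMode (k : ℤ) : parityConj (ferMode t k : Op K ℕ O) = -ferMode t k := by
  refine ferMode_cases (P := fun k => parityConj (ferMode t k : Op K ℕ O) = -ferMode t k)
    (fun n => ?_) (fun n => ?_) k
  · rw [ferMode_natCast, map_mul, parityConj_hbar, parityConj_derTheta, mul_neg]
  · rw [ferMode_negSucc, parityConj_mulTheta]

omit [LinearOrder O] in
theorem bosMode_mul_mulX (k : ℤ) (e : ℕ) : (bosMode k : Op K ℕ O) * mulX e =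
    mulX e * bosMode k + if k = e then hbar else 0 := by
  refine bosMode_cases (P := fun k => (bosMode k : Op K ℕ O) * mulX e =
    mulX e * bosMode k + if k = e then hbar else 0) (fun n => ?_) (fun n hn => ?_) k
  · rw [bosMode_natCast, ← mul_assoc, ← hbar_comm_mulX, mul_assoc, mul_assoc]
    simp only [Nat.cast_inj]
    split_ifs with h
    · rw [h, derX_mul_mulX_self, mul_add, mul_one]
    · rw [derX_mul_mulX_of_ne h, add_zero]
  · rw [bosMode_neg_natCast hn, if_neg (by omega), add_zero, smul_mul_assoc, mul_smul_comm,
      mulX_comm]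

theorem bosMode_mul_mulTheta (k : ℤ) (o : O) : (bosMode k : Op K ℕ O) * mulTheta o =
    mulTheta o * bosMode k := by
  refine bosMode_cases (P := fun k => (bosMode k : Op K ℕ O) * mulTheta o =
    mulTheta o * bosMode k) (fun n => ?_) (fun n hn => ?_) k
  · rw [bosMode_natCast, ← mul_assoc, ← hbar_comm_mulTheta, mul_assoc, mul_assoc,
      derX_comm_mulTheta]
  · rw [bosMode_neg_natCast hn, smul_mul_assoc, mul_smul_comm, mulX_comm_mulTheta]

theorem ferMode_mul_mulX (k : ℤ) (e : ℕ) : (ferMode t k : Op K ℕ O) * mulX e =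
    mulX e * ferMode t k := by
  refine ferMode_cases (P := fun k => (ferMode t k : Op K ℕ O) * mulX e =
    mulX e * ferMode t k) (fun n => ?_) (fun n => ?_) k
  · rw [ferMode_natCast, ← mul_assoc, ← hbar_comm_mulX, mul_assoc, mul_assoc,
      mulX_comm_derTheta]
  · rw [ferMode_negSucc, mulX_comm_mulTheta]

theorem ferMode_mul_mulTheta (ht : Function.Injective t) (k : ℤ) (n : ℕ) :
    (ferMode t k : Op K ℕ O) * mulTheta (t n) =
      -(mulTheta (t n) * ferMode t k) + if k = n then hbar else 0 := by
  refine ferMode_cases (P := fun k => (ferMode t k : Op K ℕ O) * mulTheta (t n) =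
    -(mulTheta (t n) * ferMode t k) + if k = n then hbar else 0) (fun l => ?_) (fun l => ?_) k
  · rw [ferMode_natCast, ← mul_assoc, ← hbar_comm_mulTheta, mul_assoc, mul_assoc]
    simp only [Nat.cast_inj]
    split_ifs with h
    · rw [h, derTheta_mul_mulTheta_self, mul_add, mul_one, mul_neg]
    · rw [derTheta_mul_mulTheta_of_ne (ht.ne h), add_zero, mul_neg]
  · rw [ferMode_negSucc, if_neg (by omega), add_zero, mulTheta_anticomm]

/-- Needed for `thetaPlain`, whose range misses the label ⊥ of the extra variable. -/
theorem ferMode_mul_mulTheta_of_notMem {o : O} (ho : o ∉ Set.range t) (k : ℤ) :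
    (ferMode t k : Op K ℕ O) * mulTheta o = -(mulTheta o * ferMode t k) := by
  refine ferMode_cases (P := fun k => (ferMode t k : Op K ℕ O) * mulTheta o =
    -(mulTheta o * ferMode t k)) (fun l => ?_) (fun l => ?_) k
  · rw [ferMode_natCast, ← mul_assoc, ← hbar_comm_mulTheta, mul_assoc, mul_assoc,
      derTheta_mul_mulTheta_of_ne fun h => ho ⟨l, h⟩, mul_neg]
  · rw [ferMode_negSucc, mulTheta_anticomm]

theorem bosMode_mul_bosMode (k l : ℤ) : (bosMode k : Op K ℕ O) * bosMode l =
    bosMode l * bosMode k + if k + l = 0 then (k : K) • hbar else 0 := by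
  refine bosMode_cases (P := fun l => (bosMode k : Op K ℕ O) * bosMode l =
    bosMode l * bosMode k + if k + l = 0 then (k : K) • hbar else 0) (fun n => ?_)
    (fun n hn => ?_) l
  · refine bosMode_cases (P := fun k => (bosMode k : Op K ℕ O) * bosMode n =
      bosMode n * bosMode k + if k + n = 0 then (k : K) • hbar else 0) (fun m => ?_)
      (fun m hm => ?_) k
    · have h1 : (if (m : ℤ) + n = 0 then (((m : ℤ) : K)) • (hbar : Op K ℕ O) else 0) = 0 := by
        split_ifs with h
        · have : m = 0 := by omega
          simp [this]
        · rfl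
      rw [h1, add_zero, bosMode_natCast n, ← mul_assoc, ← hbar_comm_bosMode, mul_assoc, mul_assoc,
        bosMode_natCast, mul_assoc, derX_comm, ← mul_assoc (derX n), ← hbar_comm_derX, mul_assoc]
    · rw [bosMode_neg_natCast hm, smul_mul_assoc, mul_smul_comm, bosMode_mul_mulX, smul_add,
        add_assoc]
      simp only [Nat.cast_inj, neg_add_eq_zero, @eq_comm ℕ m n]
      split_ifs with h
      · subst h
        simp
      · simp
  · rw [bosMode_neg_natCast hn, mul_smul_comm, bosMode_mul_mulX, smul_add, smul_mul_assoc]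
    simp only [add_neg_eq_zero]
    split_ifs with h
    · rw [h]
      simp
    · rw [smul_zero]

theorem bosMode_mul_ferMode (k l : ℤ) : (bosMode k : Op K ℕ O) * ferMode t l =
    ferMode t l * bosMode k := by
  refine ferMode_cases (P := fun l => (bosMode k : Op K ℕ O) * ferMode t l =
    ferMode t l * bosMode k) (fun n => ?_) (fun n => ?_) l
  · refine bosMode_cases (P := fun k => (bosMode k : Op K ℕ O) * ferMode t n =
      ferMode t n * bosMode k) (fun m => ?_) (fun m hm => ?_) k
    · rw [bosMode_natCast, ← mul_assoc, ← hbar_comm_ferMode, mul_assoc, mul_assoc,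
        ferMode_natCast, mul_assoc, ← derX_comm_derTheta, ← mul_assoc (derX m), ← hbar_comm_derX,
        mul_assoc]
    · rw [bosMode_neg_natCast hm, smul_mul_assoc, mul_smul_comm, ferMode_mul_mulX]
  · rw [ferMode_negSucc, bosMode_mul_mulTheta]

theorem ferMode_mul_ferMode (ht : Function.Injective t) (k l : ℤ) :
    (ferMode t k : Op K ℕ O) * ferMode t l =
    -(ferMode t l * ferMode t k) + if k + l + 1 = 0 then hbar else 0 := by
  refine ferMode_cases (P := fun l => (ferMode t k : Op K ℕ O) * ferMode t l =
    -(ferMode t l * ferMode t k) + if k + l + 1 = 0 then hbar else 0) (fun n => ?_)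
    (fun n => ?_) l
  · refine ferMode_cases (P := fun k => (ferMode t k : Op K ℕ O) * ferMode t n =
      -(ferMode t n * ferMode t k) + if k + n + 1 = 0 then hbar else 0) (fun m => ?_)
      (fun m => ?_) k
    · rw [if_neg (by omega), add_zero, ferMode_natCast t n, ← mul_assoc, ← hbar_comm_ferMode,
        mul_assoc, mul_assoc, ferMode_natCast, mul_assoc, derTheta_anticomm,
        ← mul_assoc (derTheta (t n)), ← hbar_comm_derTheta, mul_assoc, mul_neg, mul_neg]
    · rw [ferMode_negSucc, ferMode_mul_mulTheta ht]
      simp only [Nat.cast_inj, show (-(m : ℤ) - 1 + n + 1 = 0) ↔ n = m by omega]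
      abel
  · rw [ferMode_negSucc, ferMode_mul_mulTheta ht]
    simp only [show (k + (-(n : ℤ) - 1) + 1 = 0) ↔ k = n by omega]

theorem isSuperHeisenberg [CharZero K] (ht : Function.Injective t) : IsSuperHeisenberg K t := by
  have hb : ∀ k, IsEvenOp (bosMode k : Op K ℕ O) := parityConj_bosMode
  have hf : ∀ k, IsOddOp (ferMode t k : Op K ℕ O) := parityConj_ferMode
  refine ⟨fun k l => ?_, fun k l => ?_, fun k l => ?_⟩
  · rw [(hb k).superComm_left, bosMode_mul_bosMode, add_sub_cancel_left]
  · rw [(hf k).superComm (hf l), ferMode_mul_ferMode ht, neg_add_cancel_comm]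
  · rw [(hb k).superComm_left, bosMode_mul_ferMode, sub_self]

end ModeRelations

/-! ### Convergence of the mode sums. -/

section Convergence

variable {K O : Type*} [Field K] [LinearOrder O] {t : ℕ → O}

/-- Modes of high index annihilate a series up to terms of high degree. -/
theorem exists_modes_mem_filt (ht : Function.Injective t) (f : Series K ℕ O) (p : ℕ) :
    ∃ M : ℕ, ∀ l : ℤ, M < l → (bosMode l : Op K ℕ O) f ∈ Series.filt p ∧
      (ferMode t l : Op K ℕ O) f ∈ Series.filt p := by
  -- Below degree p the series contains finitely many monomials, hence finitely many variables; M
  -- exceeds all their indices. Since ħ∂ raises degrees by 1, terms of degree at least p do no harm.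
  have hfin : {m : Mono ℕ O | m.deg < p ∧ f.coeff m ≠ 0}.Finite := by
    refine ((Finset.range p).finite_toSet.biUnion fun d _ => f.2 d).subset ?_
    rintro m ⟨hm, hne⟩
    exact Set.mem_biUnion (x := m.deg) (by simpa using hm) ⟨rfl, hne⟩
  have h1 : (⋃ m ∈ {m : Mono ℕ O | m.deg < p ∧ f.coeff m ≠ 0}, (m.2.1.support : Set ℕ)).Finite :=
    hfin.biUnion fun m _ => m.2.1.support.finite_toSet
  have h2 : (t ⁻¹' ⋃ m ∈ {m : Mono ℕ O | m.deg < p ∧ f.coeff m ≠ 0}, (m.2.2 : Set O)).Finite :=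
    (hfin.biUnion fun m _ => m.2.2.finite_toSet).preimage ht.injOn
  obtain ⟨M₁, hM₁⟩ := h1.bddAbove
  obtain ⟨M₂, hM₂⟩ := h2.bddAbove
  refine ⟨max M₁ M₂, fun l hl => ?_⟩
  lift l to ℕ using by omega
  rw [bosMode_natCast, ferMode_natCast]
  have hl' : max M₁ M₂ < l := by exact_mod_cast hl
  constructor
  · rintro ⟨k, α, S⟩ hm
    rw [Module.End.mul_apply, hbar_coeff, derX_coeff]
    split_ifs with hk
    · rfl
    by_contra hne
    have : l ≤ M₁ := hM₁ (Set.mem_biUnion (x := (k - 1, α + Finsupp.single l 1, S))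
      ⟨by simp only [Mono.deg, map_add, Finsupp.degree_single] at hm ⊢; omega,
        right_ne_zero_of_mul hne⟩ (by simp))
    omega
  · rintro ⟨k, α, S⟩ hm
    rw [Module.End.mul_apply, hbar_coeff, derTheta_coeff]
    split_ifs with hk ho
    · rfl
    · rfl
    by_contra hne
    have : l ≤ M₂ := hM₂ (Set.mem_biUnion (x := (k - 1, α, insert (t l) S))
      ⟨by simp only [Mono.deg, Finset.card_insert_of_notMem ho] at hm ⊢; omega,
        right_ne_zero_of_mul hne⟩ (by simp))
    omega

omit [LinearOrder O] in
-- Normal ordering lets the mode of larger index act first, and the other mode does not lower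
-- degrees. So one large index is enough.
theorem bosNormal_mem_filt {f : Series K ℕ O} {p : ℕ} {M : ℤ}
    (hM : ∀ l, M < l → (bosMode l : Op K ℕ O) f ∈ Series.filt p) {k l : ℤ} (h : M < k ∨ M < l) :
    (bosNormal k l : Op K ℕ O) f ∈ Series.filt p := by
  unfold bosNormal
  split_ifs with hkl
  · exact (homog_bosMode k).filtered zero_le_one _ _ (hM l (by omega))
  · exact (homog_bosMode l).filtered zero_le_one _ _ (hM k (by omega))

theorem ferNormal_mem_filt {f : Series K ℕ O} {p : ℕ} {M : ℤ}
    (hM : ∀ l, M < l → (ferMode t l : Op K ℕ O) f ∈ Series.filt p) {k l : ℤ} (h : M < k ∨ M < l) :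
    (ferNormal t k l : Op K ℕ O) f ∈ Series.filt p := by
  unfold ferNormal
  split_ifs with hkl
  · exact (homog_ferMode k).filtered zero_le_one _ _ (hM l (by omega))
  · exact neg_mem ((homog_ferMode l).filtered zero_le_one _ _ (hM k (by omega)))

omit [LinearOrder O] in
theorem bosTerm_mem_filt {f : Series K ℕ O} {p : ℕ} {M : ℤ}
    (hM : ∀ l, M < l → (bosMode l : Op K ℕ O) f ∈ Series.filt p) {n k : ℤ}
    (h : M < k ∨ M < n - k) : (bosTerm n k : Op K ℕ O) f ∈ Series.filt p :=
  bosNormal_mem_filt hM h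

theorem ferTerm_mem_filt {f : Series K ℕ O} {p : ℕ} {M : ℤ}
    (hM : ∀ l, M < l → (ferMode t l : Op K ℕ O) f ∈ Series.filt p) {n k : ℤ}
    (h : M < -k - 1 ∨ M < n + k) : (ferTerm t n k : Op K ℕ O) f ∈ Series.filt p :=
  Submodule.smul_mem _ _ (ferNormal_mem_filt hM h)

/-- Even and odd modes commute, so either factor can be made to act first. -/
theorem superTerm_mem_filt {f : Series K ℕ O} {p : ℕ} {M : ℤ}
    (hM : ∀ l, M < l → (bosMode l : Op K ℕ O) f ∈ Series.filt p ∧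
      (ferMode t l : Op K ℕ O) f ∈ Series.filt p) {k m : ℤ}
    (h : M < m ∨ M < k - m) : (superTerm t k m : Op K ℕ O) f ∈ Series.filt p := by
  rcases h with h | h
  · exact (homog_ferMode _).filtered zero_le_one _ _ (hM m h).1
  · rw [superTerm, ← bosMode_mul_ferMode]
    exact (homog_bosMode m).filtered zero_le_one _ _ (hM _ h).2

theorem locFin_bosTerm (ht : Function.Injective t) (n : ℤ) :
    LocFin (fun k => (bosTerm n k : Op K ℕ O)) := by
  intro f p
  obtain ⟨M, hM⟩ := exists_modes_mem_filt ht f p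
  refine (Set.finite_Icc (n - M) (M : ℤ)).subset fun k hk => ?_
  by_contra h
  exact hk (bosTerm_mem_filt (fun l hl => (hM l hl).1) (by rw [Set.mem_Icc] at h; omega))

theorem locFin_ferTerm (ht : Function.Injective t) (n : ℤ) :
    LocFin (fun k => (ferTerm t n k : Op K ℕ O)) := by
  intro f p
  obtain ⟨M, hM⟩ := exists_modes_mem_filt ht f p
  refine (Set.finite_Icc (-M - 1 : ℤ) (M - n : ℤ)).subset fun k hk => ?_
  by_contra h
  exact hk (ferTerm_mem_filt (fun l hl => (hM l hl).2) (by rw [Set.mem_Icc] at h; omega))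

theorem locFin_superTerm (ht : Function.Injective t) (k : ℤ) :
    LocFin (fun m => (superTerm t k m : Op K ℕ O)) := by
  intro f p
  obtain ⟨M, hM⟩ := exists_modes_mem_filt ht f p
  refine (Set.finite_Icc (k - M : ℤ) (M : ℤ)).subset fun m hm => ?_
  by_contra h
  exact hm (superTerm_mem_filt hM (by rw [Set.mem_Icc] at h; omega))

theorem modeSumsConverge (ht : Function.Injective t) : ModeSumsConverge K t := fun n =>
  ⟨(locFin_bosTerm ht n).summable, (locFin_ferTerm ht n).summable,
    (locFin_superTerm ht n).summable⟩

end Convergence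

/-! ### The super Virasoro operators and their brackets. -/

section Virasoro

variable {K O : Type*} [Field K] [LinearOrder O] {t : ℕ → O}

/-- The even modes `ħ L_n`. -/
def virL (t : ℕ → O) (n : ℤ) : Op K ℕ O :=
  (2⁻¹ : K) • (∑' k : ℤ, bosTerm n k) + (2⁻¹ : K) • (∑' k : ℤ, ferTerm t n k)

/-- The odd modes `ħ G_r`, `r = k + 1/2`. -/
def virG (t : ℕ → O) (k : ℤ) : Op K ℕ O := ∑' m : ℤ, superTerm t k m

theorem opH_eq (t : ℕ → O) (N i : ℤ) :
    (opH t N i : Op K ℕ O) = bosMode i + virL t (i + N - 1) := add_assoc _ _ _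

theorem opF_eq (t : ℕ → O) (N k : ℤ) :
    (opF t N k : Op K ℕ O) = ferMode t k + virG t (k + N - 1) := rfl

/-- The even operator `X` satisfies `[J_k, X] = c ħ δ_{k,j}` and commutes with the odd modes. -/
structure IsEvenTest (t : ℕ → O) (c : K) (j : ℤ) (X : Op K ℕ O) : Prop where
  continuous : Continuous X
  hbar : hbar * X = X * hbar
  bos : ∀ k, bosMode k * X = X * bosMode k + if k = j then c • SuperAiry.hbar else 0
  fer : ∀ k, ferMode t k * X = X * ferMode t k

/-- The odd operator `X` satisfies `{χ_k, X} = c ħ δ_{k,j}` and commutes with the even modes. -/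
structure IsOddTest (t : ℕ → O) (c : K) (j : ℤ) (X : Op K ℕ O) : Prop where
  continuous : Continuous X
  hbar : hbar * X = X * hbar
  bos : ∀ k, bosMode k * X = X * bosMode k
  fer : ∀ k, ferMode t k * X = -(X * ferMode t k) + if k = j then c • SuperAiry.hbar else 0

theorem isEvenTest_mulX (t : ℕ → O) (e : ℕ) : IsEvenTest t (1 : K) e (mulX e) where
  continuous := ((homog_mulX e).filtered zero_le_one).continuous
  hbar := hbar_comm_mulX e
  bos k := by rw [bosMode_mul_mulX, one_smul]
  fer k := ferMode_mul_mulX k e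

theorem isEvenTest_bosMode (t : ℕ → O) (m : ℤ) :
    IsEvenTest t (-(m : K)) (-m) (bosMode m) where
  continuous := bosMode_continuous m
  hbar := hbar_comm_bosMode m
  bos k := by
    rw [bosMode_mul_bosMode]
    simp only [eq_neg_iff_add_eq_zero]
    split_ifs with h
    · rw [show k = -m by omega, Int.cast_neg]
    · rfl
  fer k := (bosMode_mul_ferMode m k).symm

theorem isOddTest_ferMode (ht : Function.Injective t) (l : ℤ) :
    IsOddTest t (1 : K) (-l - 1) (ferMode t l) where
  continuous := ferMode_continuous l
  hbar := hbar_comm_ferMode l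
  bos k := bosMode_mul_ferMode k l
  fer k := by
    rw [ferMode_mul_ferMode ht, one_smul]
    simp only [show k + l + 1 = 0 ↔ k = -l - 1 by omega]

theorem exists_isOddTest_mulTheta (ht : Function.Injective t) (o : O) :
    ∃ (c : K) (j : ℤ), IsOddTest t c j (mulTheta o) := by
  have hc : Continuous (mulTheta o : Op K ℕ O) :=
    ((homog_mulTheta o).filtered zero_le_one).continuous
  by_cases ho : o ∈ Set.range t
  · obtain ⟨n, rfl⟩ := ho
    exact ⟨1, n, hc, hbar_comm_mulTheta _, fun k => bosMode_mul_mulTheta k _, fun k => by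
      rw [ferMode_mul_mulTheta ht, one_smul]⟩
  · exact ⟨0, 0, hc, hbar_comm_mulTheta _, fun k => bosMode_mul_mulTheta k _, fun k => by
      rw [ferMode_mul_mulTheta_of_notMem ho, zero_smul, ite_self, add_zero]⟩

/-- The two orders of a product of modes differ by a multiple of ħ, which commutes with X, so normal
ordering does not affect the bracket. -/
theorem bosNormal_mul {c : K} {j : ℤ} {X : Op K ℕ O} (hX : IsEvenTest t c j X) (k l : ℤ) :
    bosNormal k l * X = X * bosNormal k l
      + ((if k = j then c • (hbar * bosMode l) else 0)
        + if l = j then c • (hbar * bosMode k) else 0) := by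
  have key : ∀ k l : ℤ, bosMode k * bosMode l * X = X * (bosMode k * bosMode l)
      + ((if k = j then c • (hbar * bosMode l) else 0)
        + if l = j then c • (hbar * bosMode k) else 0) := by
    intro k l
    rw [mul_assoc, hX.bos l, mul_add, ← mul_assoc, hX.bos k, add_mul, mul_assoc, add_assoc]
    congr 2
    · split_ifs <;> simp
    · split_ifs
      · rw [mul_smul_comm, hbar_comm_bosMode]
      · simp
  unfold bosNormal
  by_cases h : k ≤ l
  · simp only [if_pos h, key k l]
  · simp only [if_neg h, key l k, add_comm (ite (l = j) _ _)]

theorem ferNormal_mul {c : K} {j : ℤ} {X : Op K ℕ O} (hX : IsOddTest t c j X) (k l : ℤ) :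
    ferNormal t k l * X = X * ferNormal t k l
      + ((if l = j then c • (hbar * ferMode t k) else 0)
        + if k = j then (-c) • (hbar * ferMode t l) else 0) := by
  have h1 : ∀ k l : ℤ, ferMode t k * (if l = j then c • (hbar : Op K ℕ O) else 0)
      = if l = j then c • (hbar * ferMode t k) else 0 := by
    intro k l
    split_ifs
    · rw [mul_smul_comm, hbar_comm_ferMode]
    · simp
  have h2 : ∀ k l : ℤ, (if k = j then c • (hbar : Op K ℕ O) else 0) * ferMode t l
      = -if k = j then (-c) • (hbar * ferMode t l) else 0 := by
    intro k l
    split_ifs <;> simp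
  have h3 : ∀ k l : ℤ, (if k = j then (-c) • (hbar * ferMode t l) else (0 : Op K ℕ O))
      = -if k = j then c • (hbar * ferMode t l) else 0 := by
    intro k l
    split_ifs <;> simp
  have key : ∀ k l : ℤ, ferMode t k * ferMode t l * X = X * (ferMode t k * ferMode t l)
      + ((if l = j then c • (hbar * ferMode t k) else 0)
        + if k = j then (-c) • (hbar * ferMode t l) else 0) := by
    intro k l
    rw [mul_assoc, hX.fer l, mul_add, h1, mul_neg, ← mul_assoc, hX.fer k, add_mul, h2]
    noncomm_ring
  unfold ferNormal
  by_cases h : k ≤ l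
  · simp only [if_pos h, key k l]
  · simp only [if_neg h, neg_mul, key l k, h3]
    noncomm_ring

theorem bosNormal_mul_odd {c : K} {j : ℤ} {X : Op K ℕ O} (hX : IsOddTest t c j X) (k l : ℤ) :
    bosNormal k l * X = X * bosNormal k l := by
  have key : ∀ k l : ℤ, bosMode k * bosMode l * X = X * (bosMode k * bosMode l) := fun k l => by
    rw [mul_assoc, hX.bos l, ← mul_assoc, hX.bos k, mul_assoc]
  unfold bosNormal
  split_ifs with h
  · exact key k l
  · exact key l k

theorem ferNormal_mul_even {c : K} {j : ℤ} {X : Op K ℕ O} (hX : IsEvenTest t c j X) (k l : ℤ) :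
    ferNormal t k l * X = X * ferNormal t k l := by
  have key : ∀ k l : ℤ, ferMode t k * ferMode t l * X = X * (ferMode t k * ferMode t l) :=
    fun k l => by rw [mul_assoc, hX.fer l, ← mul_assoc, hX.fer k, mul_assoc]
  unfold ferNormal
  split_ifs with h
  · exact key k l
  · rw [neg_mul, key l k, mul_neg]

/-- Of the bosonic sum only k = j and n - k = j contribute, with equal values; this cancels the
factor 1/2. When 2j = n both contributions sit at the same k and are still counted twice. -/
theorem virL_mul_even [CharZero K] (ht : Function.Injective t) {c : K} {j : ℤ} {X : Op K ℕ O} (hX : IsEvenTest t c j X) (n : ℤ) :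
    virL t n * X = X * virL t n + c • (hbar * bosMode (n - j)) := by
  have hb := (locFin_bosTerm (K := K) ht n).summable.hasSum
  have hf := (locFin_ferTerm (K := K) ht n).summable.hasSum
  have h1 : (∑' k, bosTerm n k) * X = X * (∑' k, bosTerm n k)
      + (c • (hbar * bosMode (n - j)) + c • (hbar * bosMode (n - j))) := by
    refine (hasSum_mul_right X hb).unique (((hasSum_mul_left hX.continuous hb).add
      ((hasSum_ite_eq j (c • (hbar * bosMode (n - j)))).add
      (hasSum_ite_eq (n - j) (c • (hbar * bosMode (n - j)))))).congr_fun' fun k => ?_)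
    rw [bosTerm, bosNormal_mul hX]
    congr 2
    · split_ifs with h
      · rw [h]
      · rfl
    · simp only [show n - k = j ↔ k = n - j by omega]
      split_ifs with h
      · rw [h]
      · rfl
  have h2 : (∑' k, ferTerm t n k) * X = X * (∑' k, ferTerm t n k) := by
    refine (hasSum_mul_right X hf).unique ((hasSum_mul_left hX.continuous hf).congr_fun'
      fun k => ?_)
    rw [ferTerm, smul_mul_assoc, ferNormal_mul_even hX, mul_smul_comm]
  rw [virL, add_mul, smul_mul_assoc, smul_mul_assoc, h1, h2, mul_add, mul_smul_comm,
    mul_smul_comm]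
  match_scalars <;> field_simp
  ring

/-- The surviving terms are k = j - n and k = -j - 1. Their weights k + 1/2 + n/2 are opposite, and
so are the signs from the position of the contracted mode, so the two contributions agree. -/
theorem virL_mul_odd [CharZero K] (ht : Function.Injective t) {c : K} {j : ℤ} {X : Op K ℕ O} (hX : IsOddTest t c j X) (n : ℤ) :
    virL t n * X = X * virL t n
      + (-c * ((n : K) / 2 - j - 2⁻¹)) • (hbar * ferMode t (n - j - 1)) := by
  have hb := (locFin_bosTerm (K := K) ht n).summable.hasSum
  have hf := (locFin_ferTerm (K := K) ht n).summable.hasSum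
  have h1 : (∑' k, bosTerm n k) * X = X * (∑' k, bosTerm n k) := by
    refine (hasSum_mul_right X hb).unique ((hasSum_mul_left hX.continuous hb).congr_fun'
      fun k => ?_)
    rw [bosTerm, bosNormal_mul_odd hX]
  have h2 : (∑' k, ferTerm t n k) * X = X * (∑' k, ferTerm t n k)
      + ((-c * ((n : K) / 2 - j - 2⁻¹)) • (hbar * ferMode t (n - j - 1))
        + (-c * ((n : K) / 2 - j - 2⁻¹)) • (hbar * ferMode t (n - j - 1))) := by
    refine (hasSum_mul_right X hf).unique (((hasSum_mul_left hX.continuous hf).add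
      ((hasSum_ite_eq (j - n) _).add (hasSum_ite_eq (-j - 1) _))).congr_fun' fun k => ?_)
    rw [ferTerm, smul_mul_assoc, ferNormal_mul hX, smul_add, mul_smul_comm, smul_add]
    congr 2
    · simp only [show n + k = j ↔ k = j - n by omega]
      split_ifs with h
      · rw [h, smul_smul, show -(j - n) - 1 = n - j - 1 by omega]
        congr 1
        push_cast
        ring
      · simp
    · simp only [show -k - 1 = j ↔ k = -j - 1 by omega]
      split_ifs with h
      · rw [h, smul_smul, show n + (-j - 1) = n - j - 1 by omega]
        congr 1
        push_cast
        ring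
      · simp
  rw [virL, add_mul, smul_mul_assoc, smul_mul_assoc, h1, h2, mul_add, mul_smul_comm,
    mul_smul_comm]
  match_scalars <;> field_simp
  ring

theorem virG_mul_even (ht : Function.Injective t) {c : K} {j : ℤ} {X : Op K ℕ O} (hX : IsEvenTest t c j X) (k : ℤ) :
    virG t k * X = X * virG t k + c • (hbar * ferMode t (k - j)) := by
  have hs := (locFin_superTerm (K := K) ht k).summable.hasSum
  refine (hasSum_mul_right X hs).unique (((hasSum_mul_left hX.continuous hs).add
      (hasSum_ite_eq j (c • (hbar * ferMode t (k - j))))).congr_fun' fun m => ?_)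
  rw [superTerm, mul_assoc, hX.bos, mul_add, ← mul_assoc, ← mul_assoc, hX.fer]
  congr 1
  split_ifs with h
  · rw [h, mul_smul_comm, hbar_comm_ferMode]
  · simp

theorem virG_mul_odd (ht : Function.Injective t) {c : K} {j : ℤ} {X : Op K ℕ O} (hX : IsOddTest t c j X) (k : ℤ) :
    virG t k * X = -(X * virG t k) + c • (hbar * bosMode (k - j)) := by
  have hs := (locFin_superTerm (K := K) ht k).summable.hasSum
  refine (hasSum_mul_right X hs).unique (((hasSum_mul_left hX.continuous hs).neg.add
      (hasSum_ite_eq (k - j) (c • (hbar * bosMode (k - j))))).congr_fun' fun m => ?_)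
  rw [superTerm, mul_assoc (ferMode _ _), hX.bos, ← mul_assoc, ← mul_assoc, hX.fer, add_mul, neg_mul]
  congr 1
  simp only [show k - m = j ↔ m = k - j by omega]
  split_ifs with h
  · rw [h, smul_mul_assoc]
  · simp

theorem virL_mul_bosMode [CharZero K] (ht : Function.Injective t) (n m : ℤ) : (virL t n : Op K ℕ O) * bosMode m =
    bosMode m * virL t n + (-(m : K)) • (hbar * bosMode (n + m)) := by
  rw [virL_mul_even ht (isEvenTest_bosMode t m), sub_neg_eq_add]

theorem virL_mul_ferMode [CharZero K] (ht : Function.Injective t) (n l : ℤ) : (virL t n : Op K ℕ O) * ferMode t l =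
    ferMode t l * virL t n + (-((n : K) / 2 + l + 2⁻¹)) • (hbar * ferMode t (n + l)) := by
  rw [virL_mul_odd ht (isOddTest_ferMode ht l), show n - (-l - 1) - 1 = n + l by omega]
  congr 2
  push_cast
  field_simp
  ring

theorem virG_mul_bosMode (ht : Function.Injective t) (k m : ℤ) : (virG t k : Op K ℕ O) * bosMode m =
    bosMode m * virG t k + (-(m : K)) • (hbar * ferMode t (k + m)) := by
  rw [virG_mul_even ht (isEvenTest_bosMode t m), sub_neg_eq_add]

theorem virG_mul_ferMode (ht : Function.Injective t) (k l : ℤ) : (virG t k : Op K ℕ O) * ferMode t l =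
    -(ferMode t l * virG t k) + hbar * bosMode (k + l + 1) := by
  rw [virG_mul_odd ht (isOddTest_ferMode ht l), one_smul, show k - (-l - 1) = k + l + 1 by omega]

theorem bosTerm_mem_weylFinite {s : Set (ℕ ⊕ O)} (hs : ∀ n, Sum.inl n ∈ s) (n k : ℤ) :
    (bosTerm n k : Op K ℕ O) ∈ weylFinite K s := by
  unfold bosTerm bosNormal
  split_ifs <;> exact mul_mem (bosMode_mem_weylFinite hs _) (bosMode_mem_weylFinite hs _)

theorem ferTerm_mem_weylFinite {s : Set (ℕ ⊕ O)} (hs : ∀ n, Sum.inr (t n) ∈ s) (n k : ℤ) :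
    (ferTerm t n k : Op K ℕ O) ∈ weylFinite K s := by
  refine Subalgebra.smul_mem _ ?_ _
  unfold ferNormal
  split_ifs
  · exact mul_mem (ferMode_mem_weylFinite hs _) (ferMode_mem_weylFinite hs _)
  · exact neg_mem (mul_mem (ferMode_mem_weylFinite hs _) (ferMode_mem_weylFinite hs _))

theorem virL_mem_weylHat {s : Set (ℕ ⊕ O)} (hs : ∀ n, Sum.inl n ∈ s)
    (hs' : ∀ n, Sum.inr (t n) ∈ s) (n : ℤ) : (virL t n : Op K ℕ O) ∈ weylHat K s :=
  add_mem_weylHat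
    (smul_mem_weylHat _ (tsum_mem_weylHat fun k =>
      weylFinite_subset_weylHat (bosTerm_mem_weylFinite hs n k)))
    (smul_mem_weylHat _ (tsum_mem_weylHat fun k =>
      weylFinite_subset_weylHat (ferTerm_mem_weylFinite hs' n k)))

theorem virG_mem_weylHat {s : Set (ℕ ⊕ O)} (hs : ∀ n, Sum.inl n ∈ s)
    (hs' : ∀ n, Sum.inr (t n) ∈ s) (n : ℤ) : (virG t n : Op K ℕ O) ∈ weylHat K s :=
  tsum_mem_weylHat fun _ => weylFinite_subset_weylHat
    (mul_mem (ferMode_mem_weylFinite hs' _) (bosMode_mem_weylFinite hs _))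

theorem homog_virL (n : ℤ) : Homog 2 (virL t n : Op K ℕ O) := by
  refine ((Homog.tsum fun k => ?_).smul _).add ((Homog.tsum fun k => ?_).smul _)
  · unfold bosTerm bosNormal
    split_ifs <;> exact (homog_bosMode _).mul (homog_bosMode _)
  · refine Homog.smul _ ?_
    unfold ferNormal
    split_ifs
    · exact (homog_ferMode _).mul (homog_ferMode _)
    · exact ((homog_ferMode _).mul (homog_ferMode _)).neg

theorem homog_virG (n : ℤ) : Homog 2 (virG t n : Op K ℕ O) :=
  Homog.tsum fun _ => (homog_ferMode _).mul (homog_bosMode _)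

/-- The constant series `1`. -/
abbrev vac : Series K ℕ O := Series.mono (0, 0, ∅)

theorem bosMode_vac {k : ℤ} (hk : 0 ≤ k) : (bosMode k : Op K ℕ O) (vac : Series K ℕ O) = 0 := by
  classical
  lift k to ℕ using hk
  refine Series.ext fun ⟨l, α, S⟩ => ?_
  rw [bosMode_natCast, Module.End.mul_apply, hbar_coeff, derX_coeff, Series.mono_coeff]
  split_ifs with _ h
  · rfl
  · simp only [Prod.mk.injEq] at h
    have := DFunLike.congr_fun h.2.1 k
    simp at this
  · exact mul_zero _

theorem ferMode_vac {k : ℤ} (hk : 0 ≤ k) : (ferMode t k : Op K ℕ O) (vac : Series K ℕ O) = 0 := by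
  classical
  lift k to ℕ using hk
  refine Series.ext fun ⟨l, α, S⟩ => ?_
  rw [ferMode_natCast, Module.End.mul_apply, hbar_coeff, derTheta_coeff,
    Series.mono_coeff]
  split_ifs with _ _ h
  · rfl
  · rfl
  · simp only [Prod.mk.injEq] at h
    simp at h
  · exact mul_zero _

omit [LinearOrder O] in
theorem tsum_apply_eq_zero {ι : Type*} {T : ι → Op K ℕ O} {f : Series K ℕ O}
    (h : ∀ i, T i f = 0) : (∑' i, T i) f = 0 := by
  by_cases hs : Summable T
  · refine Series.eq_zero_of_mem_filt fun p => Filtered.hasSum hs.hasSum fun i => ?_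
    rw [h]
    exact zero_mem _
  · rw [tsum_eq_zero_of_not_summable hs]
    rfl

/-- In a normally ordered product the mode acting first has index ≥ 0 unless both indices are
negative. For n ≥ -1 this leaves only the square of χ_{-1/2} in L_{-1}, whose weight is 0. -/
theorem virL_vac [CharZero K] {n : ℤ} (hn : -1 ≤ n) : (virL t n : Op K ℕ O) vac = 0 := by
  have h1 : ∀ k, (bosTerm n k : Op K ℕ O) vac = 0 := by
    intro k
    unfold bosTerm bosNormal
    split_ifs
    · rw [Module.End.mul_apply, bosMode_vac (by omega), map_zero]
    · rw [Module.End.mul_apply, bosMode_vac (by omega), map_zero]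
  have h2 : ∀ k, (ferTerm t n k : Op K ℕ O) vac = 0 := by
    intro k
    by_cases h : n = -1 ∧ k = 0
    · rw [h.1, h.2, ferTerm]
      norm_num
    · unfold ferTerm ferNormal
      split_ifs
      · rw [LinearMap.smul_apply, Module.End.mul_apply, ferMode_vac (by omega), map_zero, smul_zero]
      · rw [LinearMap.smul_apply, LinearMap.neg_apply, Module.End.mul_apply,
          ferMode_vac (by omega), map_zero, neg_zero, smul_zero]
  rw [virL, LinearMap.add_apply, LinearMap.smul_apply, LinearMap.smul_apply,
    tsum_apply_eq_zero h1, tsum_apply_eq_zero h2, smul_zero, add_zero]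

theorem virG_vac {n : ℤ} (hn : -1 ≤ n) : (virG t n : Op K ℕ O) vac = 0 := by
  refine tsum_apply_eq_zero fun k => ?_
  rcases le_or_gt 0 k with h | h
  · rw [superTerm, Module.End.mul_apply, bosMode_vac h, map_zero]
  · rw [superTerm, ← bosMode_mul_ferMode, Module.End.mul_apply, ferMode_vac (by omega), map_zero]

theorem eq_of_tests (ht : Function.Injective t) {Z : Op K ℕ O} (ε : K) (hZ : Z ∈ weylHat K Set.univ) (h1 : Z vac = 0)
    (hev : ∀ c j X, IsEvenTest t c j X → Z * X = X * Z)
    (hodd : ∀ c j X, IsOddTest t c j X → Z * X = ε • (X * Z)) : Z = 0 := by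
  refine (filtered_of_mem_weylHat hZ).eq_zero_of_comm ε h1 (hbar_comm_of_mem_weylHat hZ).symm
    (fun e => hev _ _ _ (isEvenTest_mulX t e)) fun o => ?_
  obtain ⟨c, j, h⟩ := exists_isOddTest_mulTheta (K := K) ht o
  exact hodd _ _ _ h

/-- The bracket is determined by its action on 1 and by its brackets with the variables. Only r • T
is required to annihilate 1, because T itself may have index -2. The factor 1 * 1 is the product of
signs supplied by `bracket_sub_mul_comm`. -/
theorem bracket_eq_of_tests (ht : Function.Injective t) [Nonempty O] {P Q T : Op K ℕ O} (σ ε r : K)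
    (hP : P ∈ weylHat K Set.univ) (hQ : Q ∈ weylHat K Set.univ) (hT : T ∈ weylHat K Set.univ)
    (hPv : P vac = 0) (hQv : Q vac = 0) (hTv : r • T vac = 0)
    (hev : ∀ c j X, IsEvenTest t c j X → (P * Q - σ • (Q * P) - r • (hbar * T)) * X
      = (1 * 1 : K) • (X * (P * Q - σ • (Q * P) - r • (hbar * T))))
    (hodd : ∀ c j X, IsOddTest t c j X → (P * Q - σ • (Q * P) - r • (hbar * T)) * X
      = ε • (X * (P * Q - σ • (Q * P) - r • (hbar * T)))) :
    P * Q - σ • (Q * P) = r • (hbar * T) := by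
  rw [← sub_eq_zero]
  refine eq_of_tests ht ε ?_ ?_ (fun c j X hX => (hev c j X hX).trans (by simp)) hodd
  · have hh : (hbar : Op K ℕ O) ∈ weylHat K Set.univ :=
      weylFinite_subset_weylHat (hbar_mem_weylFinite _)
    exact (weylHatSubmodule K Set.univ).sub_mem ((weylHatSubmodule K Set.univ).sub_mem
      (mul_mem_weylHat hP hQ) (smul_mem_weylHat _ (mul_mem_weylHat hQ hP)))
      (smul_mem_weylHat _ (mul_mem_weylHat hh hT))
  · simp only [LinearMap.sub_apply, LinearMap.smul_apply, Module.End.mul_apply, hPv, hQv, map_zero,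
      smul_zero, sub_zero, ← map_smul, hTv]

theorem virL_comm_virL [CharZero K] (ht : Function.Injective t) [Nonempty O] {m n : ℤ} (hm : -1 ≤ m) (hn : -1 ≤ n) :
    (virL t m : Op K ℕ O) * virL t n - virL t n * virL t m
      = ((m : K) - n) • (hbar * virL t (m + n)) := by
  have hL : ∀ n, (virL t n : Op K ℕ O) ∈ weylHat K Set.univ :=
    virL_mem_weylHat (fun _ => Set.mem_univ _) (fun _ => Set.mem_univ _)
  have hh := fun n => hbar_comm_of_mem_weylHat (hL n)
  have := bracket_eq_of_tests ht (1 : K) (1 * 1) ((m : K) - n) (hL m) (hL n) (hL (m + n))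
    (virL_vac hm) (virL_vac hn) ?_ ?_ ?_
  · simpa using this
  -- The operator L_{-2} is excluded from `virL_vac`, but it comes with the coefficient m - n = 0.
  · by_cases h : m = -1 ∧ n = -1
    · rw [h.1, h.2, sub_self, zero_smul]
    · rw [virL_vac (by omega), smul_zero]
  · intro c j X hX
    refine bracket_sub_mul_comm (u := bosMode (m - j)) (v := bosMode (n - j))
      (w := bosMode (m + n - j)) (cu := c) (cv := c) (cw := c)
      (a := -((n - j : ℤ) : K)) (b := -((m - j : ℤ) : K)) (one_mul 1) (hh m) (hh n) hX.hbar
      ?_ ?_ ?_ ?_ ?_ ?_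
    · rw [one_smul, virL_mul_even ht hX]
    · rw [one_smul, virL_mul_even ht hX]
    · rw [one_mul, one_smul, virL_mul_even ht hX]
    · rw [one_mul, one_smul, virL_mul_bosMode ht, show m + (n - j) = m + n - j by omega]
    · rw [one_mul, one_smul, virL_mul_bosMode ht, show n + (m - j) = m + n - j by omega]
    · push_cast
      ring
  · intro c j X hX
    refine bracket_sub_mul_comm (u := ferMode t (m - j - 1)) (v := ferMode t (n - j - 1))
      (w := ferMode t (m + n - j - 1)) (cu := -c * ((m : K) / 2 - j - 2⁻¹))
      (cv := -c * ((n : K) / 2 - j - 2⁻¹)) (cw := -c * (((m + n : ℤ) : K) / 2 - j - 2⁻¹))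
      (a := -((m : K) / 2 + (n - j - 1 : ℤ) + 2⁻¹)) (b := -((n : K) / 2 + (m - j - 1 : ℤ) + 2⁻¹))
      (one_mul 1) (hh m) (hh n) hX.hbar ?_ ?_ ?_ ?_ ?_ ?_
    · rw [one_smul, virL_mul_odd ht hX]
    · rw [one_smul, virL_mul_odd ht hX]
    · rw [one_mul, one_smul, virL_mul_odd ht hX]
    · rw [one_mul, one_smul, virL_mul_ferMode ht, show m + (n - j - 1) = m + n - j - 1 by omega]
    · rw [one_mul, one_smul, virL_mul_ferMode ht, show n + (m - j - 1) = m + n - j - 1 by omega]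
    · push_cast
      field_simp
      ring

theorem virL_comm_virG [CharZero K] (ht : Function.Injective t) [Nonempty O] {m k : ℤ} (hm : -1 ≤ m) (hk : -1 ≤ k) :
    (virL t m : Op K ℕ O) * virG t k - virG t k * virL t m
      = ((m : K) / 2 - k - 2⁻¹) • (hbar * virG t (m + k)) := by
  have hL : ∀ n, (virL t n : Op K ℕ O) ∈ weylHat K Set.univ :=
    virL_mem_weylHat (fun _ => Set.mem_univ _) (fun _ => Set.mem_univ _)
  have hG : ∀ n, (virG t n : Op K ℕ O) ∈ weylHat K Set.univ :=
    virG_mem_weylHat (fun _ => Set.mem_univ _) (fun _ => Set.mem_univ _)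
  have hh := fun n => hbar_comm_of_mem_weylHat (hL n)
  have hh' := fun n => hbar_comm_of_mem_weylHat (hG n)
  have := bracket_eq_of_tests ht (1 : K) (1 * (-1)) ((m : K) / 2 - k - 2⁻¹) (hL m) (hG k)
    (hG (m + k)) (virL_vac hm) (virG_vac hk) ?_ ?_ ?_
  · simpa using this
  -- Likewise G_{-3/2} occurs only for L_{-1} and G_{-1/2}, with coefficient -1/2 + 1 - 1/2 = 0.
  · by_cases h : m = -1 ∧ k = -1
    · rw [h.1, h.2, show ((-1 : ℤ) : K) / 2 - ((-1 : ℤ) : K) - 2⁻¹ = 0 by push_cast; norm_num,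
        zero_smul]
    · rw [virG_vac (by omega), smul_zero]
  · intro c j X hX
    refine bracket_sub_mul_comm (u := bosMode (m - j)) (v := ferMode t (k - j))
      (w := ferMode t (m + k - j)) (cu := c) (cv := c) (cw := c)
      (a := -((m : K) / 2 + (k - j : ℤ) + 2⁻¹)) (b := -((m - j : ℤ) : K)) (one_mul 1) (hh m)
      (hh' k) hX.hbar ?_ ?_ ?_ ?_ ?_ ?_
    · rw [one_smul, virL_mul_even ht hX]
    · rw [one_smul, virG_mul_even ht hX]
    · rw [one_mul, one_smul, virG_mul_even ht hX]
    · rw [one_mul, one_smul, virL_mul_ferMode ht, show m + (k - j) = m + k - j by omega]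
    · rw [one_mul, one_smul, virG_mul_bosMode ht, show k + (m - j) = m + k - j by omega]
    · push_cast
      field_simp
      ring
  · intro c j X hX
    refine bracket_sub_mul_comm (u := ferMode t (m - j - 1)) (v := bosMode (k - j))
      (w := bosMode (m + k - j)) (cu := -c * ((m : K) / 2 - j - 2⁻¹))
      (cv := c) (cw := c) (a := -((k - j : ℤ) : K)) (b := 1)
      (one_mul 1) (hh m) (hh' k) hX.hbar ?_ ?_ ?_ ?_ ?_ ?_
    · rw [one_smul, virL_mul_odd ht hX]
    · rw [neg_one_smul, virG_mul_odd ht hX]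
    · rw [one_mul, neg_one_smul, virG_mul_odd ht hX]
    · rw [one_mul, one_smul, virL_mul_bosMode ht, show m + (k - j) = m + k - j by omega]
    · rw [one_mul, neg_one_smul, one_smul, virG_mul_ferMode ht,
        show k + (m - j - 1) + 1 = m + k - j by omega]
    · push_cast
      field_simp
      ring

theorem virG_anticomm_virG [CharZero K] (ht : Function.Injective t) [Nonempty O] {k l : ℤ} (hk : -1 ≤ k) (hl : -1 ≤ l) :
    (virG t k : Op K ℕ O) * virG t l + virG t l * virG t k
      = (2 : K) • (hbar * virL t (k + l + 1)) := by
  have hL : ∀ n, (virL t n : Op K ℕ O) ∈ weylHat K Set.univ :=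
    virL_mem_weylHat (fun _ => Set.mem_univ _) (fun _ => Set.mem_univ _)
  have hG : ∀ n, (virG t n : Op K ℕ O) ∈ weylHat K Set.univ :=
    virG_mem_weylHat (fun _ => Set.mem_univ _) (fun _ => Set.mem_univ _)
  have hh' := fun n => hbar_comm_of_mem_weylHat (hG n)
  have := bracket_eq_of_tests ht (-1 : K) ((-1) * (-1)) 2 (hG k) (hG l)
    (hL (k + l + 1)) (virG_vac hk) (virG_vac hl) ?_ ?_ ?_
  · simpa using this
  · rw [virL_vac (by omega), smul_zero]
  · intro c j X hX
    refine bracket_sub_mul_comm (u := ferMode t (k - j)) (v := ferMode t (l - j))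
      (w := bosMode (k + l + 1 - j)) (cu := c) (cv := c) (cw := c)
      (a := 1) (b := 1) (by norm_num) (hh' k) (hh' l) hX.hbar ?_ ?_ ?_ ?_ ?_ ?_
    · rw [one_smul, virG_mul_even ht hX]
    · rw [one_smul, virG_mul_even ht hX]
    · rw [one_mul, one_smul, virL_mul_even ht hX]
    · rw [mul_one, neg_one_smul, one_smul, virG_mul_ferMode ht,
        show k + (l - j) + 1 = k + l + 1 - j by omega]
    · rw [mul_one, neg_one_smul, one_smul, virG_mul_ferMode ht,
        show l + (k - j) + 1 = k + l + 1 - j by omega]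
    · ring
  · intro c j X hX
    refine bracket_sub_mul_comm (u := bosMode (k - j)) (v := bosMode (l - j))
      (w := ferMode t (k + l - j)) (cu := c) (cv := c)
      (cw := -c * (((k + l + 1 : ℤ) : K) / 2 - j - 2⁻¹)) (a := -((l - j : ℤ) : K))
      (b := -((k - j : ℤ) : K)) (by norm_num) (hh' k) (hh' l) hX.hbar ?_ ?_ ?_ ?_ ?_ ?_
    · rw [neg_one_smul, virG_mul_odd ht hX]
    · rw [neg_one_smul, virG_mul_odd ht hX]
    · rw [neg_mul_neg, one_mul, one_smul, virL_mul_odd ht hX,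
        show k + l + 1 - j - 1 = k + l - j by omega]
    · rw [neg_mul_neg, one_mul, one_smul, virG_mul_bosMode ht,
        show k + (l - j) = k + l - j by omega]
    · rw [neg_mul_neg, one_mul, one_smul, virG_mul_bosMode ht,
        show l + (k - j) = k + l - j by omega]
    · push_cast
      field_simp
      ring

end Virasoro

/-! ### The commutation relations of the operators H_i and F_r. -/

section Relations

variable {K O : Type*} [Field K] [LinearOrder O] {t : ℕ → O}

omit [LinearOrder O] in
theorem parityConj_tsum {ι : Type*} {T : ι → Op K ℕ O} (c : K)
    (h : ∀ i, parityConj (T i) = c • T i) : parityConj (∑' i, T i) = c • ∑' i, T i := by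
  by_cases hs : Summable T
  · refine (hs.hasSum.map parityConj parityConj_continuous).unique
      ((hasSum_const_smul c hs.hasSum).congr_fun' fun i => (h i).symm)
  · rw [tsum_eq_zero_of_not_summable hs, map_zero, smul_zero]

omit [LinearOrder O] in
theorem parityConj_bosTerm (n k : ℤ) :
    parityConj (bosTerm n k : Op K ℕ O) = (1 : K) • bosTerm n k := by
  unfold bosTerm bosNormal
  split_ifs <;> rw [map_mul, parityConj_bosMode, parityConj_bosMode, one_smul]

theorem parityConj_ferTerm (n k : ℤ) :
    parityConj (ferTerm t n k : Op K ℕ O) = (1 : K) • ferTerm t n k := by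
  unfold ferTerm ferNormal
  split_ifs <;> simp [parityConj_ferMode]

theorem parityConj_superTerm (k m : ℤ) :
    parityConj (superTerm t k m : Op K ℕ O) = (-1 : K) • superTerm t k m := by
  rw [superTerm, map_mul, parityConj_ferMode, parityConj_bosMode, neg_one_smul, neg_mul]

theorem parityConj_virL (n : ℤ) : parityConj (virL t n : Op K ℕ O) = virL t n := by
  rw [virL, map_add, map_smul, map_smul, parityConj_tsum 1 (parityConj_bosTerm n),
    parityConj_tsum 1 (parityConj_ferTerm n), one_smul, one_smul]

theorem parityConj_virG (k : ℤ) : parityConj (virG t k : Op K ℕ O) = -virG t k := by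
  rw [virG, parityConj_tsum (-1) (parityConj_superTerm k), neg_one_smul]

/-- The constant term of `opHD`, divided by `ħ`. -/
def constHD (R : ℤ) (D : ℕ → K) (i : ℤ) : K := if i ≤ R then D i.toNat else 0

theorem opHD_eq (t : ℕ → O) (N R : ℤ) (D : ℕ → K) (i : ℤ) :
    opHD t N R D i = bosMode i + virL t (i + N - 1) + constHD R D i • hbar := by
  rw [opHD, opH_eq, constHD]
  split_ifs <;> simp

theorem isEvenOp_opHD (N R : ℤ) (D : ℕ → K) (i : ℤ) : IsEvenOp (opHD t N R D i) := by
  change parityConj _ = _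
  rw [opHD_eq, map_add, map_add, map_smul, parityConj_bosMode, parityConj_virL, parityConj_hbar]

theorem isOddOp_opF (N k : ℤ) : IsOddOp (opF t N k : Op K ℕ O) := by
  change parityConj _ = _
  rw [opF_eq, map_add, parityConj_ferMode, parityConj_virG, neg_add]

theorem opHD_mem_weylHat {s : Set (ℕ ⊕ O)} (hs : ∀ n, Sum.inl n ∈ s)
    (hs' : ∀ n, Sum.inr (t n) ∈ s) (N R : ℤ) (D : ℕ → K) (i : ℤ) :
    opHD t N R D i ∈ weylHat K s := by
  rw [opHD_eq]
  exact add_mem_weylHat (add_mem_weylHat (weylFinite_subset_weylHat (bosMode_mem_weylFinite hs i))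
    (virL_mem_weylHat hs hs' _))
    (smul_mem_weylHat _ (weylFinite_subset_weylHat (hbar_mem_weylFinite s)))

theorem opF_mem_weylHat {s : Set (ℕ ⊕ O)} (hs : ∀ n, Sum.inl n ∈ s)
    (hs' : ∀ n, Sum.inr (t n) ∈ s) (N k : ℤ) : (opF t N k : Op K ℕ O) ∈ weylHat K s := by
  rw [opF_eq]
  exact add_mem_weylHat (weylFinite_subset_weylHat (ferMode_mem_weylFinite hs' k))
    (virG_mem_weylHat hs hs' _)

variable [CharZero K]

omit [CharZero K] in
theorem hbar_comm_virL (n : ℤ) : (hbar : Op K ℕ O) * virL t n = virL t n * hbar :=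
  hbar_comm_of_mem_weylHat (virL_mem_weylHat (fun _ => Set.mem_univ _) (fun _ => Set.mem_univ _) n)

omit [CharZero K] in
theorem hbar_comm_opF (N k : ℤ) : (hbar : Op K ℕ O) * opF t N k = opF t N k * hbar :=
  hbar_comm_of_mem_weylHat
    (opF_mem_weylHat (fun _ => Set.mem_univ _) (fun _ => Set.mem_univ _) N k)

omit [CharZero K] in
theorem hbar_comm_opHD (N R : ℤ) (D : ℕ → K) (i : ℤ) :
    hbar * opHD t N R D i = opHD t N R D i * hbar :=
  hbar_comm_of_mem_weylHat
    (opHD_mem_weylHat (fun _ => Set.mem_univ _) (fun _ => Set.mem_univ _) N R D i)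

/-- The brackets [J_m, L] and [L, J_n] contribute m and -n times the same mode J_{m+n+N-1}, which is
the linear term of the operator on the right. By `hR` that operator carries no constant unless its
coefficient m - n is zero. -/
theorem superComm_opHD_opHD [Nonempty O] (ht : Function.Injective t) {N R m n : ℤ} (D : ℕ → K)
    (hm : 0 ≤ m) (hn : 0 ≤ n) (hmN : 0 ≤ m + N) (hnN : 0 ≤ n + N)
    (hR : m ≠ n → R < m + n + N - 1) :
    superComm (opHD t N R D m) (opHD t N R D n)
      = ((m : K) - n) • (hbar * opHD t N R D (m + n + N - 1)) := by
  rw [(isEvenOp_opHD N R D m).superComm_left]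
  by_cases hmn : m = n
  · rw [hmn, sub_self, sub_self, zero_smul]
  have h0 : (bosMode m : Op K ℕ O) * bosMode n = bosMode n * bosMode m := by
    rw [bosMode_mul_bosMode, if_neg (by omega), add_zero]
  have h1 := virL_mul_bosMode (K := K) ht (m + N - 1) n
  have h2 := virL_mul_bosMode (K := K) ht (n + N - 1) m
  have h3 := virL_comm_virL (K := K) ht (m := m + N - 1) (n := n + N - 1) (by omega) (by omega)
  rw [show m + N - 1 + n = m + n + N - 1 by omega] at h1
  rw [show n + N - 1 + m = m + n + N - 1 by omega] at h2
  rw [show m + N - 1 + (n + N - 1) = m + n + N - 1 + N - 1 by omega, sub_eq_iff_eq_add] at h3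
  have h4 := hbar_comm_opHD (t := t) N R D m
  have h5 := hbar_comm_opHD (t := t) N R D n
  rw [opHD_eq] at h4 h5
  have h6 : constHD R D (m + n + N - 1) = 0 := if_neg (by have := hR hmn; omega)
  rw [opHD_eq, opHD_eq, opHD_eq, h6, zero_smul, add_zero]
  simp only [mul_add, add_mul, smul_mul_assoc, mul_smul_comm, h0, h1, h2, h3,
    ← hbar_comm_bosMode, ← hbar_comm_virL]
  push_cast
  module

/-- The linear term arises from [J_m, G] with coefficient m and from [L, χ_r] with coefficient
-((m+N-1)/2 + r); their sum is (m-N+1)/2 - r. -/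
theorem superComm_opHD_opF [Nonempty O] (ht : Function.Injective t) {N R m k : ℤ} (D : ℕ → K)
    (hmN : 0 ≤ m + N) (hkN : 0 ≤ k + N) :
    superComm (opHD t N R D m) (opF t N k)
      = (((m : K) - N + 1) / 2 - ((k : K) + 2⁻¹)) • (hbar * opF t N (m + k + N - 1)) := by
  rw [(isEvenOp_opHD N R D m).superComm_left]
  have h0 : (bosMode m : Op K ℕ O) * ferMode t k = ferMode t k * bosMode m :=
    bosMode_mul_ferMode m k
  have h1 := virL_mul_ferMode (K := K) ht (m + N - 1) k
  have h2 := virG_mul_bosMode (K := K) ht (k + N - 1) m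
  have h3 := virL_comm_virG (K := K) ht (m := m + N - 1) (k := k + N - 1) (by omega) (by omega)
  rw [show m + N - 1 + k = m + k + N - 1 by omega] at h1
  rw [show k + N - 1 + m = m + k + N - 1 by omega] at h2
  rw [show m + N - 1 + (k + N - 1) = m + k + N - 1 + N - 1 by omega, sub_eq_iff_eq_add] at h3
  have h4 := hbar_comm_opF (K := K) (t := t) N k
  rw [opF_eq, mul_add, add_mul] at h4
  rw [opHD_eq, opF_eq, opF_eq]
  simp only [mul_add, add_mul, smul_mul_assoc, mul_smul_comm, h0, h1, h2, h3, ← hbar_comm_ferMode,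
    ← hbar_comm_of_mem_weylHat (virG_mem_weylHat (K := K) (t := t) (s := Set.univ)
      (fun _ => Set.mem_univ _) (fun _ => Set.mem_univ _) _)]
  push_cast
  match_scalars <;> (try field_simp) <;> ring

/-- Each of the two mixed anticommutators of χ and G contributes J_{k+l+N}, which accounts for the
factor 2 of the linear term. By `hR` the operator on the right carries no constant. -/
theorem superComm_opF_opF [Nonempty O] (ht : Function.Injective t) {N R k l : ℤ} (D : ℕ → K)
    (hk : 0 ≤ k) (hl : 0 ≤ l) (hkN : 0 ≤ k + N) (hlN : 0 ≤ l + N) (hR : R < k + l + N) :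
    superComm (opF t N k) (opF t N l) = (2 : K) • (hbar * opHD t N R D (k + l + N)) := by
  rw [(isOddOp_opF N k).superComm (isOddOp_opF N l)]
  have h0 : (ferMode t k : Op K ℕ O) * ferMode t l = -(ferMode t l * ferMode t k) := by
    rw [ferMode_mul_ferMode ht, if_neg (by omega), add_zero]
  have h1 := virG_mul_ferMode (K := K) ht (k + N - 1) l
  have h2 := virG_mul_ferMode (K := K) ht (l + N - 1) k
  have h3 := virG_anticomm_virG (K := K) ht (k := k + N - 1) (l := l + N - 1) (by omega) (by omega)
  rw [show k + N - 1 + l + 1 = k + l + N by omega] at h1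
  rw [show l + N - 1 + k + 1 = k + l + N by omega] at h2
  rw [show k + N - 1 + (l + N - 1) + 1 = k + l + N + N - 1 by omega, ← eq_sub_iff_add_eq] at h3
  have h6 : constHD R D (k + l + N) = 0 := if_neg (by omega)
  rw [opHD_eq, opF_eq, opF_eq, h6, zero_smul, add_zero]
  simp only [mul_add, add_mul, h0, h1, h2, h3]
  module

end Relations

/-! ### The subalgebra of the Neveu–Schwarz algebra. -/

section Representation

variable {K : Type*} [Field K]

theorem nsBracket_single (x y : NS) :
    nsBracket K (Finsupp.single x 1) (Finsupp.single y 1) = nsBasisBracket K x y := by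
  simp [nsBracket]

theorem nsMap_single {O : Type*} [LinearOrder O] (N : ℤ) (H F : ℤ → Op K ℕ O) (x : NS) (c : K) :
    nsMap N H F (Finsupp.single x c) = c • match x with
      | NS.L n => H (n - N + 1)
      | NS.G k => F (k - N + 1)
      | NS.one => 0 := by
  rw [nsMap]
  exact (Finsupp.linearCombination_single K c x).trans (by cases x <;> rfl)

variable [CharZero K]

omit [CharZero K] in
-- A central term needs m + n = 0, so m is -1, 0 or 1, the roots of m(m² - 1).
theorem nsBasisBracket_L_L {m n : ℤ} (hm : -1 ≤ m) (hn : -1 ≤ n) :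
    nsBasisBracket K (NS.L m) (NS.L n) = Finsupp.single (NS.L (m + n)) ((m : K) - n) := by
  rw [nsBasisBracket]
  split_ifs with h
  · have h' : m = -1 ∨ m = 0 ∨ m = 1 := by omega
    rcases h' with rfl | rfl | rfl <;> simp
  · rw [add_zero]

/-- A central term needs opposite indices, so r = ±1/2, where r² - 1/4 vanishes. -/
theorem nsBasisBracket_G_G {k l : ℤ} (hk : -1 ≤ k) (hl : -1 ≤ l) :
    nsBasisBracket K (NS.G k) (NS.G l) = Finsupp.single (NS.L (k + l + 1)) (2 : K) := by
  rw [nsBasisBracket]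
  split_ifs with h
  · have h' : k = -1 ∨ k = 0 := by omega
    rcases h' with rfl | rfl
    · rw [show (2⁻¹ * ((((-1 : ℤ) : K) + 2⁻¹) ^ 2 - 4⁻¹)) = 0 by push_cast; norm_num]
      simp
    · rw [show (2⁻¹ * ((((0 : ℤ) : K) + 2⁻¹) ^ 2 - 4⁻¹)) = 0 by push_cast; norm_num]
      simp
  · rw [add_zero]

omit [CharZero K] in
theorem bilin_mem_of_supported {α M : Type*} [AddCommGroup M] [Module K M] {s : Set α}
    (Φ : (α →₀ K) →ₗ[K] (α →₀ K) →ₗ[K] M) (S : Submodule K M)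
    (h : ∀ x ∈ s, ∀ y ∈ s, Φ (Finsupp.single x 1) (Finsupp.single y 1) ∈ S) :
    ∀ a ∈ Finsupp.supported K K s, ∀ b ∈ Finsupp.supported K K s, Φ a b ∈ S := by
  intro a ha b hb
  have hle : Submodule.map₂ Φ (Finsupp.supported K K s) (Finsupp.supported K K s) ≤ S := by
    rw [Finsupp.supported_eq_span_single, Submodule.map₂_span_span, Submodule.span_le]
    rintro _ ⟨_, ⟨x, hx, rfl⟩, _, ⟨y, hy, rfl⟩, rfl⟩
    exact h x hx y hy
  exact hle (Submodule.apply_mem_map₂ _ ha hb)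

/-- The hypotheses on e₀ and o₀ keep all brackets in range: `heN` serves [H, H] for distinct
indices, `hoe` serves {F, F}, and `heo` serves [H, F]. The bounds `hR` and `hR'` keep operators with
a constant from appearing on the right with nonzero coefficient. -/
theorem representsNS {O : Type*} [LinearOrder O] [Nonempty O] {t : ℕ → O}
    (ht : Function.Injective t) {N R e₀ o₀ : ℤ} (D : ℕ → K) (he : 0 ≤ e₀) (ho : 0 ≤ o₀)
    (heN : 0 ≤ e₀ + N) (hoN : 0 ≤ o₀ + N) (hR : R < 2 * e₀ + N) (hR' : R < 2 * o₀ + N)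
    (hoe : e₀ ≤ 2 * o₀ + N) (heo : 1 ≤ e₀ + N ∨ e₀ = o₀) :
    RepresentsNS N {i | e₀ ≤ i} {k | o₀ ≤ k} (opHD t N R D) (opF t N) := by
  have hHH : ∀ m ∈ {i : ℤ | e₀ ≤ i}, ∀ n ∈ {i : ℤ | e₀ ≤ i},
      superComm (opHD t N R D m) (opHD t N R D n)
        = ((m : K) - n) • (hbar * opHD t N R D (m + n + N - 1)) := by
    intro m hm n hn
    rw [Set.mem_ofPred_eq] at hm hn
    exact superComm_opHD_opHD ht D (by omega) (by omega) (by omega) (by omega) (by omega)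
  have hHF : ∀ m ∈ {i : ℤ | e₀ ≤ i}, ∀ k ∈ {k : ℤ | o₀ ≤ k},
      superComm (opHD t N R D m) (opF t N k)
        = (((m : K) - N + 1) / 2 - ((k : K) + 2⁻¹)) • (hbar * opF t N (m + k + N - 1)) := by
    intro m hm k hk
    rw [Set.mem_ofPred_eq] at hm hk
    exact superComm_opHD_opF ht D (by omega) (by omega)
  have hFF : ∀ k ∈ {k : ℤ | o₀ ≤ k}, ∀ l ∈ {k : ℤ | o₀ ≤ k},
      superComm (opF t N k) (opF t N l) = (2 : K) • (hbar * opHD t N R D (k + l + N)) := by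
    intro k hk l hl
    rw [Set.mem_ofPred_eq] at hk hl
    exact superComm_opF_opF ht D (by omega) (by omega) (by omega) (by omega) (by omega)
  have memL : ∀ n : ℤ, e₀ ≤ n - N + 1 → NS.L n ∈ nsIndices N {i | e₀ ≤ i} {k | o₀ ≤ k} :=
    fun n hn => Or.inl ⟨n - N + 1, hn, congrArg NS.L (by ring)⟩
  have memG : ∀ k : ℤ, o₀ ≤ k - N + 1 → NS.G k ∈ nsIndices N {i | e₀ ≤ i} {k | o₀ ≤ k} :=
    fun k hk => Or.inr ⟨k - N + 1, hk, congrArg NS.G (by ring)⟩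
  -- The bracket [H_m, F_r] leaves the range only if m = k = e₀ = o₀ = -N, and there its coefficient
  -- vanishes.
  have coeff_eq_zero : ∀ m k : ℤ, e₀ ≤ m → o₀ ≤ k → ¬o₀ ≤ m + N - 1 + (k + N - 1) - N + 1 →
      ((m + N - 1 : ℤ) : K) / 2 - (((k + N - 1 : ℤ) : K) + 2⁻¹) = 0 := by
    intro m k hm hk h
    have h1 : m = k := by omega
    have h2 : N = -k := by omega
    rw [h1, h2]
    push_cast
    field_simp
    ring
  refine ⟨?_, ?_, hHH, hHF, hFF⟩
  · refine bilin_mem_of_supported _ _ ?_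
    rintro _ (⟨m, hm, rfl⟩ | ⟨k, hk, rfl⟩) _ (⟨n, hn, rfl⟩ | ⟨l, hl, rfl⟩) <;>
      rw [nsBracket_single] <;> simp only [Set.mem_ofPred_eq] at *
    · rw [nsBasisBracket_L_L (by omega) (by omega)]
      by_cases h : m = n
      · simp [h]
      · exact Finsupp.single_mem_supported _ _ (memL _ (by omega))
    · rw [nsBasisBracket]
      by_cases h : o₀ ≤ m + N - 1 + (l + N - 1) - N + 1
      · exact Finsupp.single_mem_supported _ _ (memG _ h)
      · rw [coeff_eq_zero m l hm hl h, Finsupp.single_zero]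
        exact zero_mem _
    · rw [nsBasisBracket]
      refine neg_mem ?_
      by_cases h : o₀ ≤ n + N - 1 + (k + N - 1) - N + 1
      · exact Finsupp.single_mem_supported _ _ (memG _ h)
      · rw [coeff_eq_zero n k hn hk h, Finsupp.single_zero]
        exact zero_mem _
    · rw [nsBasisBracket_G_G (by omega) (by omega)]
      exact Finsupp.single_mem_supported _ _ (memL _ (by omega))
  -- The defect of the relation is bilinear, so its vanishing on basis vectors suffices; the target
  -- submodule is ⊥.
  · have key := bilin_mem_of_supported (s := nsIndices N {i | e₀ ≤ i} {k | o₀ ≤ k})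
      ((superCommₗ.compl₁₂ (nsMap N (opHD t N R D) (opF t N)) (nsMap N (opHD t N R D) (opF t N)))
        - (nsBracket K).compr₂ ((LinearMap.mulLeft K (hbar : Op K ℕ O)).comp
          (nsMap N (opHD t N R D) (opF t N)))) ⊥ ?_
    · intro a ha b hb
      exact sub_eq_zero.1 (key a ha b hb)
    rintro _ (⟨m, hm, rfl⟩ | ⟨k, hk, rfl⟩) _ (⟨n, hn, rfl⟩ | ⟨l, hl, rfl⟩) <;>
      rw [Submodule.mem_bot] <;> refine sub_eq_zero.2 ?_ <;>
      change superComm _ _ = hbar * nsMap N _ _ (nsBracket K _ _) <;>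
      rw [nsBracket_single, nsMap_single, nsMap_single, one_smul, one_smul] <;>
      simp only [show ∀ i : ℤ, i + N - 1 - N + 1 = i from fun i => by ring]
    · rw [hHH m hm n hn]
      rw [Set.mem_ofPred_eq] at hm hn
      rw [nsBasisBracket_L_L (by omega) (by omega), nsMap_single, mul_smul_comm]
      simp only [show m + N - 1 + (n + N - 1) - N + 1 = m + n + N - 1 by ring]
      congr 1
      push_cast
      ring
    · rw [hHF m hm l hl, nsBasisBracket, nsMap_single, mul_smul_comm]
      simp only [show m + N - 1 + (l + N - 1) - N + 1 = m + l + N - 1 by ring]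
      congr 1
      push_cast
      ring
    · have hsymm : superComm (opF t N k) (opHD t N R D n)
          = -superComm (opHD t N R D n) (opF t N k) := by
        rw [(isEvenOp_opHD N R D n).superComm_left, (isEvenOp_opHD N R D n).superComm_right, neg_sub]
      rw [hsymm, hHF n hn k hk, nsBasisBracket, map_neg, nsMap_single, mul_neg, mul_smul_comm]
      simp only [show n + N - 1 + (k + N - 1) - N + 1 = n + k + N - 1 by ring]
      congr 2
      push_cast
      ring
    · rw [hFF k hk l hl]
      rw [Set.mem_ofPred_eq] at hk hl
      rw [nsBasisBracket_G_G (by omega) (by omega), nsMap_single, mul_smul_comm]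
      simp only [show k + N - 1 + (l + N - 1) + 1 - N + 1 = k + l + N by ring]

end Representation

/-! ### The auxiliary operator at y_0. -/

section Auxiliary

variable {K O : Type*} [Field K] [LinearOrder O] {t : ℕ → O}

omit [LinearOrder O] in
theorem opAux_eq (C₀ D₀ : K) : (opAux C₀ D₀ : Op K ℕ O)
    = bosMode 0 + ((C₀ / 2) • (bosMode 0 * bosMode 0) + D₀ • hbar) := by
  have h : (bosMode 0 : Op K ℕ O) = hbar * derX 0 := bosMode_natCast 0
  have h' : (hbar * derX 0 : Op K ℕ O) * (hbar * derX 0) = hbar ^ 2 * derX 0 ^ 2 := by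
    rw [mul_assoc, ← mul_assoc (derX 0), ← hbar_comm_derX, pow_two, pow_two]
    simp only [mul_assoc]
  rw [opAux, h, h', add_assoc]

omit [LinearOrder O] in
theorem isEvenOp_opAux (C₀ D₀ : K) : IsEvenOp (opAux C₀ D₀ : Op K ℕ O) := by
  change parityConj _ = _
  simp only [opAux_eq, map_add, map_smul, map_mul, parityConj_bosMode, parityConj_hbar]

theorem opAux_mem_weylHat {s : Set (ℕ ⊕ O)} (hs : ∀ n, Sum.inl n ∈ s) (C₀ D₀ : K) :
    (opAux C₀ D₀ : Op K ℕ O) ∈ weylHat K s := by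
  have h : (bosMode 0 : Op K ℕ O) ∈ weylFinite K s := bosMode_mem_weylFinite hs 0
  rw [opAux_eq]
  exact weylFinite_subset_weylHat (add_mem h (add_mem (Subalgebra.smul_mem _ (mul_mem h h) _)
    (Subalgebra.smul_mem _ (hbar_mem_weylFinite s) _)))

omit [LinearOrder O] in
-- The auxiliary operator is a polynomial in ħ and J_0. Since J_0 has index 0, its brackets with the
-- modes, with ħL_n and with ħG_r all carry the coefficient 0.
theorem opAux_commute {C₀ D₀ : K} {T : Op K ℕ O} (h : Commute (bosMode 0) T)
    (h' : Commute hbar T) : Commute (opAux C₀ D₀) T := by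
  rw [opAux_eq]
  exact h.add_left (((h.mul_left h).smul_left _).add_left (h'.smul_left _))

variable [CharZero K]

theorem bosMode_zero_commute_opHD (ht : Function.Injective t) (N R : ℤ) (D : ℕ → K) (i : ℤ) :
    Commute (bosMode 0) (opHD t N R D i) := by
  have h1 : Commute (bosMode 0 : Op K ℕ O) (bosMode i) := by
    have := bosMode_mul_bosMode (K := K) (O := O) 0 i
    rw [Int.cast_zero, zero_smul, ite_self, add_zero] at this
    exact this
  have h2 : Commute (bosMode 0 : Op K ℕ O) (virL t (i + N - 1)) := by
    have := virL_mul_bosMode (K := K) ht (i + N - 1) 0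
    rw [Int.cast_zero, neg_zero, zero_smul, add_zero] at this
    exact this.symm
  have h3 : Commute (bosMode 0 : Op K ℕ O) hbar := (hbar_comm_bosMode 0).symm
  rw [opHD_eq]
  exact (h1.add_right h2).add_right (h3.smul_right _)

omit [CharZero K] in
theorem bosMode_zero_commute_opF (ht : Function.Injective t) (N k : ℤ) :
    Commute (bosMode 0 : Op K ℕ O) (opF t N k) := by
  have h1 : Commute (bosMode 0 : Op K ℕ O) (ferMode t k) := bosMode_mul_ferMode 0 k
  have h2 : Commute (bosMode 0 : Op K ℕ O) (virG t (k + N - 1)) := by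
    have := virG_mul_bosMode (K := K) ht (k + N - 1) 0
    rw [Int.cast_zero, neg_zero, zero_smul, add_zero] at this
    exact this.symm
  rw [opF_eq]
  exact h1.add_right h2

theorem superComm_opAux_opHD (ht : Function.Injective t) (N R : ℤ) (D : ℕ → K) (i : ℤ)
    (C₀ D₀ : K) : superComm (opAux C₀ D₀) (opHD t N R D i) = 0 := by
  rw [(isEvenOp_opAux C₀ D₀).superComm_left, sub_eq_zero]
  exact opAux_commute (bosMode_zero_commute_opHD ht N R D i) (hbar_comm_opHD N R D i)

theorem superComm_opAux_opF (ht : Function.Injective t) (N k : ℤ) (C₀ D₀ : K) :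
    superComm (opAux C₀ D₀ : Op K ℕ O) (opF t N k) = 0 := by
  rw [(isEvenOp_opAux C₀ D₀).superComm_left, sub_eq_zero]
  exact opAux_commute (bosMode_zero_commute_opF ht N k) (hbar_comm_opF N k)

omit [LinearOrder O] in
theorem superComm_opAux_opAux (C₀ D₀ : K) :
    superComm (opAux C₀ D₀ : Op K ℕ O) (opAux C₀ D₀) = 0 := by
  rw [(isEvenOp_opAux C₀ D₀).superComm_left, sub_self]

end Auxiliary

/-! ### A common form of the three families, and the main theorem. -/

section Family

variable {K O : Type*} [Field K] [LinearOrder O] {t : ℕ → O}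

omit [LinearOrder O] in
theorem tsum_mem_filt {ι : Type*} {T : ι → Op K ℕ O} {f : Series K ℕ O} {p : ℕ}
    (h : ∀ i, T i f ∈ Series.filt p) : (∑' i, T i) f ∈ Series.filt p := by
  by_cases hs : Summable T
  · exact Filtered.hasSum hs.hasSum h
  · rw [tsum_eq_zero_of_not_summable hs]
    exact zero_mem _

/-- The two mode indices of a term add up to n, or to n - 1 in the fermionic sum, so one of them
exceeds M. -/
theorem virL_mem_filt {f : Series K ℕ O} {p : ℕ} {M : ℤ}
    (hM : ∀ l, M < l → (bosMode l : Op K ℕ O) f ∈ Series.filt p ∧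
      (ferMode t l : Op K ℕ O) f ∈ Series.filt p) {n : ℤ} (hn : 2 * M + 1 < n) :
    (virL t n : Op K ℕ O) f ∈ Series.filt p :=
  add_mem
    (Submodule.smul_mem _ _ (tsum_mem_filt fun k =>
      bosTerm_mem_filt (fun l hl => (hM l hl).1) (by omega)))
    (Submodule.smul_mem _ _ (tsum_mem_filt fun k =>
      ferTerm_mem_filt (fun l hl => (hM l hl).2) (by omega)))

theorem virG_mem_filt {f : Series K ℕ O} {p : ℕ} {M : ℤ}
    (hM : ∀ l, M < l → (bosMode l : Op K ℕ O) f ∈ Series.filt p ∧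
      (ferMode t l : Op K ℕ O) f ∈ Series.filt p) {n : ℤ} (hn : 2 * M < n) :
    (virG t n : Op K ℕ O) f ∈ Series.filt p :=
  tsum_mem_filt fun k => superTerm_mem_filt hM (by omega)

/-- The operators `H_i + ħ D_i δ_{i ≤ R}`, `i ≥ e₀`, and `F_r`, `r ≥ o₀ + 1/2`, completed by the
auxiliary operator in the missing even positions. -/
def famOp (t : ℕ → O) (N R : ℤ) (D : ℕ → K) (C₀ : K) (e₀ o₀ : ℕ) : ℕ ⊕ ℕ → Op K ℕ O
  | Sum.inl i => if e₀ ≤ i then opHD t N R D i else opAux C₀ (D i)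
  | Sum.inr n => opF t N (n + o₀)

theorem locFin_famOp (ht : Function.Injective t) (N R : ℤ) (D : ℕ → K) (C₀ : K) (e₀ o₀ : ℕ) :
    LocFin (famOp t N R D C₀ e₀ o₀) := by
  intro f p
  obtain ⟨M, hM⟩ := exists_modes_mem_filt ht f p
  -- Beyond B the even index has passed e₀ and R, so the operator is `opHD` without constant, and
  -- all shifted indices exceed the bounds required for `virL` and `virG`.
  set B : ℕ := 2 * M + N.natAbs + R.natAbs + e₀ + 2
  refine (((Set.finite_Iic B).image Sum.inl).union ((Set.finite_Iic B).image Sum.inr)).subset ?_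
  rintro (i | n) h
  · refine Or.inl ⟨i, ?_, rfl⟩
    by_contra hi
    rw [Set.mem_Iic] at hi
    refine h ?_
    simp only [famOp]
    rw [if_pos (by omega), opHD_eq, constHD, if_neg (by omega), zero_smul, add_zero]
    exact add_mem (hM i (by omega)).1 (virL_mem_filt hM (by omega))
  · refine Or.inr ⟨n, ?_, rfl⟩
    by_contra hi
    rw [Set.mem_Iic] at hi
    refine h ?_
    simp only [famOp]
    rw [opF_eq]
    exact add_mem (hM _ (by omega)).2 (virG_mem_filt hM (by omega))

theorem famOp_mem_weylHat {s : Set (ℕ ⊕ O)} (hs : ∀ n, Sum.inl n ∈ s)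
    (hs' : ∀ n, Sum.inr (t n) ∈ s) (N R : ℤ) (D : ℕ → K) (C₀ : K) (e₀ o₀ : ℕ) (a : ℕ ⊕ ℕ) :
    famOp t N R D C₀ e₀ o₀ a ∈ weylHat K s := by
  rcases a with i | n <;> simp only [famOp]
  · split_ifs
    · exact opHD_mem_weylHat hs hs' N R D i
    · exact opAux_mem_weylHat hs _ _
  · exact opF_mem_weylHat hs hs' N _

theorem isEvenOp_famOp (N R : ℤ) (D : ℕ → K) (C₀ : K) (e₀ o₀ i : ℕ) :
    IsEvenOp (famOp t N R D C₀ e₀ o₀ (Sum.inl i)) := by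
  simp only [famOp]
  split_ifs
  · exact isEvenOp_opHD N R D i
  · exact isEvenOp_opAux _ _

/-- The coefficients of the commutation relations of the operators `famOp`. -/
def famCoeff (K : Type*) [Field K] (N : ℤ) (e₀ o₀ : ℕ) : ℕ ⊕ ℕ → ℕ ⊕ ℕ → K
  | Sum.inl i, Sum.inl j => if e₀ ≤ i ∧ e₀ ≤ j then (i : K) - j else 0
  | Sum.inl i, Sum.inr n =>
    if e₀ ≤ i then ((i : K) - N + 1) / 2 - ((n : K) + o₀ + 2⁻¹) else 0
  | Sum.inr n, Sum.inl i =>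
    if e₀ ≤ i then -(((i : K) - N + 1) / 2 - ((n : K) + o₀ + 2⁻¹)) else 0
  | Sum.inr _, Sum.inr _ => 2

/-- The index of the operator on the right of the commutation relations. -/
def famIndex (N : ℤ) (o₀ : ℕ) : ℕ ⊕ ℕ → ℕ ⊕ ℕ → ℕ ⊕ ℕ
  | Sum.inl i, Sum.inl j => Sum.inl (i + j + N - 1).toNat
  | Sum.inl i, Sum.inr n => Sum.inr (i + n + N - 1).toNat
  | Sum.inr n, Sum.inl i => Sum.inr (i + n + N - 1).toNat
  | Sum.inr n, Sum.inr m => Sum.inl (n + m + 2 * o₀ + N).toNat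

/-- The index on the right is the sum of the two indices plus a constant, cut off at 0, so a given
value bounds both of them. -/
theorem finite_famIndex_fiber (N : ℤ) (o₀ : ℕ) (c : ℕ ⊕ ℕ) :
    {q : (ℕ ⊕ ℕ) × (ℕ ⊕ ℕ) | famIndex N o₀ q.1 q.2 = c}.Finite := by
  set B : ℕ := Sum.elim id id c + N.natAbs + 1 with hB
  have hfin := ((Set.finite_Iic B).image (Sum.inl : ℕ → ℕ ⊕ ℕ)).union
    ((Set.finite_Iic B).image (Sum.inr : ℕ → ℕ ⊕ ℕ))
  refine (hfin.prod hfin).subset ?_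
  rintro ⟨i | n, j | m⟩ rfl <;>
    simp only [famIndex, Sum.elim_inl, Sum.elim_inr, id_eq] at hB <;>
    simp only [Set.mem_prod, Set.mem_union, Set.mem_image, Set.mem_Iic, Sum.inl.injEq,
      Sum.inr.injEq, reduceCtorEq, and_false, exists_const, or_false, false_or, exists_eq_right] <;>
    omega

variable [CharZero K]

theorem superComm_famOp [Nonempty O] (ht : Function.Injective t) {N R : ℤ} {e₀ o₀ : ℕ}
    (D : ℕ → K) (C₀ : K) (he₁ : e₀ ≤ 1)
    (heN : 0 ≤ e₀ + N) (hoN : 0 ≤ o₀ + N) (hR : R < 2 * e₀ + N) (hR' : R < 2 * o₀ + N)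
    (hoe : e₀ ≤ 2 * o₀ + N) (heo : 1 ≤ e₀ + N ∨ e₀ = o₀) (a b : ℕ ⊕ ℕ) :
    superComm (famOp t N R D C₀ e₀ o₀ a) (famOp t N R D C₀ e₀ o₀ b)
      = famCoeff K N e₀ o₀ a b • (hbar * famOp t N R D C₀ e₀ o₀ (famIndex N o₀ a b)) := by
  have mixed : ∀ i n : ℕ, superComm (famOp t N R D C₀ e₀ o₀ (Sum.inl i))
      (famOp t N R D C₀ e₀ o₀ (Sum.inr n)) = famCoeff K N e₀ o₀ (Sum.inl i) (Sum.inr n) •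
        (hbar * famOp t N R D C₀ e₀ o₀ (famIndex N o₀ (Sum.inl i) (Sum.inr n))) := by
    intro i n
    simp only [famOp, famCoeff, famIndex]
    by_cases hi : e₀ ≤ i
    · simp only [if_pos hi]
      rw [superComm_opHD_opF ht D (by omega) (by omega)]
      by_cases h : 0 ≤ (i : ℤ) + n + N - 1
      · rw [Int.toNat_of_nonneg h, show (i : ℤ) + (n + o₀) + N - 1 = i + n + N - 1 + o₀ by ring]
        push_cast
        rfl
      -- Here `toNat` returns a meaningless index 0, but this happens only for i = e₀ = o₀ = -N and
      -- n = 0, where the coefficient vanishes.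
      · have h1 : n = 0 := by omega
        have h2 : i = o₀ := by omega
        have h3 : N = -i := by omega
        have h4 : ((i : K) - N + 1) / 2 - ((n : K) + o₀ + 2⁻¹) = 0 := by
          rw [h1, h3, h2]
          push_cast
          field_simp
          ring
        push_cast
        rw [h4, zero_smul, zero_smul]
    · simp only [if_neg hi, zero_smul]
      exact superComm_opAux_opF ht N _ _ _
  rcases a with i | n <;> rcases b with j | m
  · simp only [famOp, famCoeff, famIndex]
    by_cases hi : e₀ ≤ i
    · by_cases hj : e₀ ≤ j
      · simp only [if_pos hi, if_pos hj, if_pos (And.intro hi hj)]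
        rw [superComm_opHD_opHD ht D (by omega) (by omega) (by omega) (by omega) (by omega)]
        by_cases h : i = j
        · simp [h]
        · rw [if_pos (by omega), Int.toNat_of_nonneg (by omega)]
          push_cast
          rfl
      · simp only [if_pos hi, hj, and_false, if_false, zero_smul]
        rw [(isEvenOp_opAux _ _).superComm_right, ← neg_sub, ← (isEvenOp_opAux _ _).superComm_left,
          superComm_opAux_opHD ht, neg_zero]
    · have h1 : i = 0 := by omega
      by_cases hj : e₀ ≤ j
      · simp only [if_pos hj, hi, false_and, if_false, zero_smul]
        exact superComm_opAux_opHD ht N R D j _ _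
      · have h2 : j = 0 := by omega
        simp only [h1, h2, if_neg (h1 ▸ hi), sub_self, zero_smul, ite_self]
        exact superComm_opAux_opAux _ _
  · exact mixed i m
  · rw [(isEvenOp_famOp N R D C₀ e₀ o₀ j).superComm_right, ← neg_sub,
      ← (isEvenOp_famOp N R D C₀ e₀ o₀ j).superComm_left, mixed, ← neg_smul]
    simp only [famCoeff, famIndex]
    split_ifs <;> simp
  · simp only [famOp, famCoeff, famIndex]
    rw [superComm_opF_opF ht D (R := R) (by omega) (by omega) (by omega) (by omega) (by omega),
      if_pos (by omega), Int.toNat_of_nonneg (by omega),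
      show (n : ℤ) + o₀ + (m + o₀) + N = n + m + 2 * o₀ + N by ring]

omit [CharZero K] in
-- The condition `hto` identifies the odd basis vector of V with index n as θ^{n+o₀+1}, the variable
-- differentiated by the linear term of the operator in that position.
theorem exists_linear_famOp {t : ℕ → WithBot ℕ} (N R : ℤ) (D : ℕ → K) (C₀ : K) {e₀ o₀ : ℕ}
    (he₁ : e₀ ≤ 1) (hto : ∀ n, t (n + o₀) = (n : ℕ)) (a : ℕ ⊕ ℕ) :
    ∃ T, Homog 2 T ∧ famOp t N R D C₀ e₀ o₀ a = hbar * derVar (inclVar a) + T := by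
  have hh : ∀ c : K, Homog 2 (c • hbar : Op K ℕ (WithBot ℕ)) := fun c => homog_hbar.smul c
  rcases a with i | n <;> simp only [famOp]
  · split_ifs with h
    · refine ⟨virL t (i + N - 1) + constHD R D i • hbar, (homog_virL _).add (hh _), ?_⟩
      rw [opHD_eq, bosMode_natCast, add_assoc]
      rfl
    · have hi : i = 0 := by omega
      refine ⟨(C₀ / 2) • (bosMode 0 * bosMode 0) + D i • hbar,
        (((homog_bosMode 0).mul (homog_bosMode 0)).smul _).add (hh _), ?_⟩
      rw [opAux_eq, hi, ← Nat.cast_zero, bosMode_natCast]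
      rfl
  · refine ⟨virG t (n + o₀ + N - 1), homog_virG _, ?_⟩
    rw [opF_eq, ← Nat.cast_add, ferMode_natCast, hto]
    rfl

theorem isSuperQuantumAiry_famOp {t : ℕ → WithBot ℕ} (ht : Function.Injective t) {N R : ℤ}
    {e₀ o₀ : ℕ} (D : ℕ → K) (C₀ : K) (he₁ : e₀ ≤ 1) (hto : ∀ n, t (n + o₀) = (n : ℕ))
    (heN : 0 ≤ e₀ + N) (hoN : 0 ≤ o₀ + N) (hR : R < 2 * e₀ + N) (hR' : R < 2 * o₀ + N)
    (hoe : e₀ ≤ 2 * o₀ + N) (heo : 1 ≤ e₀ + N ∨ e₀ = o₀) :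
    IsSuperQuantumAiry (airyMap (famOp t N R D C₀ e₀ o₀) (locFin_famOp ht N R D C₀ e₀ o₀)) :=
  isSuperQuantumAiry_airyMap _
    (famOp_mem_weylHat (fun _ => Set.mem_univ _) (fun _ => Set.mem_univ _) N R D C₀ e₀ o₀)
    (isEvenOp_famOp N R D C₀ e₀ o₀) (fun n => isOddOp_opF N (n + o₀)) (famCoeff K N e₀ o₀)
    (famIndex N o₀) (superComm_famOp ht D C₀ he₁ heN hoN hR hR' hoe heo)
    (fun c => (finite_famIndex_fiber N o₀ c).subset fun _ hq => hq.2)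
    (exists_linear_famOp N R D C₀ he₁ hto)

theorem thetaPlain_injective : Function.Injective thetaPlain := WithBot.coe_injective

theorem thetaExtra_injective : Function.Injective thetaExtra := by
  rintro (_ | m) (_ | n) h
  · rfl
  · exact absurd h.symm (WithBot.coe_ne_bot)
  · exact absurd h (WithBot.coe_ne_bot)
  · exact congrArg Nat.succ (WithBot.coe_injective h)

theorem inl_mem_range_inclVar (n : ℕ) :
    (Sum.inl n : ℕ ⊕ WithBot ℕ) ∈ Set.range (inclVar : ℕ ⊕ ℕ → ℕ ⊕ WithBot ℕ) :=
  ⟨Sum.inl n, rfl⟩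

theorem inr_thetaPlain_mem_range_inclVar (n : ℕ) :
    (Sum.inr (thetaPlain n) : ℕ ⊕ WithBot ℕ) ∈ Set.range (inclVar : ℕ ⊕ ℕ → ℕ ⊕ WithBot ℕ) :=
  ⟨Sum.inr n, rfl⟩

end Family

end SuperAiry

end

theorem mainTheorem9 {K : Type*} [RCLike K] :
    -- the modes represent the super Heisenberg algebra, and the mode sums converge
    (IsSuperHeisenberg K thetaPlain ∧ ModeSumsConverge K thetaPlain ∧
      IsSuperHeisenberg K thetaExtra ∧ ModeSumsConverge K thetaExtra) ∧
    -- first family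
    (∀ N : ℤ, 0 ≤ N → ∀ D : ℕ → K,
      ∃ L : (ℕ ⊕ ℕ → K) →ₗ[K] Op K ℕ (WithBot ℕ),
        (∀ i : ℕ, L (Pi.single (Sum.inl i) 1) = opHD thetaPlain N (N - 1) D i) ∧
        (∀ n : ℕ, L (Pi.single (Sum.inr n) 1) = opF thetaPlain N n) ∧
        (∀ φ, L φ ∈ weylHat K (Set.range inclVar)) ∧
        IsSuperQuantumAiry L ∧
        RepresentsNS N {i | 0 ≤ i} {k | 0 ≤ k}
          (opHD thetaPlain N (N - 1) D) (opF thetaPlain N)) ∧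
    -- second family
    (∀ N : ℤ, 1 ≤ N → ∀ (D : ℕ → K) (C₀ : K),
      ∃ L : (ℕ ⊕ ℕ → K) →ₗ[K] Op K ℕ (WithBot ℕ),
        (∀ i : ℕ, 1 ≤ i → L (Pi.single (Sum.inl i) 1) = opHD thetaPlain N (N - 1) D i) ∧
        (∀ n : ℕ, L (Pi.single (Sum.inr n) 1) = opF thetaPlain N n) ∧
        L (Pi.single (Sum.inl 0) 1) = opAux C₀ (D 0) ∧
        (∀ φ, L φ ∈ weylHat K (Set.range inclVar)) ∧
        IsSuperQuantumAiry L ∧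
        RepresentsNS N {i | 1 ≤ i} {k | 0 ≤ k}
          (opHD thetaPlain N (N - 1) D) (opF thetaPlain N) ∧
        (∀ i : ℕ, 1 ≤ i →
          superComm (L (Pi.single (Sum.inl 0) 1)) (L (Pi.single (Sum.inl i) 1)) = 0) ∧
        (∀ n : ℕ, superComm (L (Pi.single (Sum.inl 0) 1)) (L (Pi.single (Sum.inr n) 1)) = 0)) ∧
    -- third family: the odd basis vector with index `n` is `θ^{n+2}`, and `r = n + 3/2`
    (∀ N : ℤ, -1 ≤ N → ∀ (D : ℕ → K) (C₀ : K),
      ∃ L : (ℕ ⊕ ℕ → K) →ₗ[K] Op K ℕ (WithBot ℕ),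
        (∀ i : ℕ, 1 ≤ i → L (Pi.single (Sum.inl i) 1) = opHD thetaExtra N (N + 1) D i) ∧
        (∀ n : ℕ, L (Pi.single (Sum.inr n) 1) = opF thetaExtra N (n + 1)) ∧
        L (Pi.single (Sum.inl 0) 1) = opAux C₀ (D 0) ∧
        IsSuperQuantumAiry L ∧
        RepresentsNS N {i | 1 ≤ i} {k | 1 ≤ k}
          (opHD thetaExtra N (N + 1) D) (opF thetaExtra N) ∧
        (∀ i : ℕ, 1 ≤ i →
          superComm (L (Pi.single (Sum.inl 0) 1)) (L (Pi.single (Sum.inl i) 1)) = 0) ∧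
        (∀ n : ℕ, superComm (L (Pi.single (Sum.inl 0) 1)) (L (Pi.single (Sum.inr n) 1)) = 0)) := by
  
  refine ⟨⟨isSuperHeisenberg thetaPlain_injective, modeSumsConverge thetaPlain_injective,
    isSuperHeisenberg thetaExtra_injective, modeSumsConverge thetaExtra_injective⟩, ?_, ?_, ?_⟩
  -- Here e₀ = o₀ = 0 and R = N - 1. No even position is missing, so the value 0 for C₀ plays no
  -- role.
  · intro N hN D
    refine ⟨airyMap (famOp thetaPlain N (N - 1) D 0 0 0)
        (locFin_famOp thetaPlain_injective N (N - 1) D 0 0 0), fun i => ?_, fun n => ?_,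
      airyMap_mem_weylHat _ (famOp_mem_weylHat inl_mem_range_inclVar
        inr_thetaPlain_mem_range_inclVar N (N - 1) D 0 0 0),
      isSuperQuantumAiry_famOp thetaPlain_injective D 0 zero_le_one (fun _ => rfl)
        (by omega) (by omega) (by omega) (by omega) (by omega) (by omega),
      representsNS thetaPlain_injective D le_rfl le_rfl (by omega) (by omega) (by omega)
        (by omega) (by omega) (by omega)⟩
    · rw [airyMap_single, one_smul]
      simp only [famOp, Nat.zero_le, if_true]
    · rw [airyMap_single, one_smul]
      simp only [famOp, Nat.cast_zero, add_zero]
  -- Here e₀ = 1, o₀ = 0 and R = N - 1. Closure requires {F_{1/2}, F_{1/2}}, a multiple of H_N, to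
  -- avoid the missing index 0, which is the condition N ≥ 1.
  · intro N hN D C₀
    have h0 : airyMap (famOp thetaPlain N (N - 1) D C₀ 1 0)
        (locFin_famOp thetaPlain_injective N (N - 1) D C₀ 1 0) (Pi.single (Sum.inl 0) 1)
          = opAux C₀ (D 0) := by
      rw [airyMap_single, one_smul]
      rfl
    have h1 : ∀ i : ℕ, 1 ≤ i → airyMap (famOp thetaPlain N (N - 1) D C₀ 1 0)
        (locFin_famOp thetaPlain_injective N (N - 1) D C₀ 1 0) (Pi.single (Sum.inl i) 1)
          = opHD thetaPlain N (N - 1) D i := by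
      intro i hi
      rw [airyMap_single, one_smul]
      exact if_pos hi
    have h2 : ∀ n : ℕ, airyMap (famOp thetaPlain N (N - 1) D C₀ 1 0)
        (locFin_famOp thetaPlain_injective N (N - 1) D C₀ 1 0) (Pi.single (Sum.inr n) 1)
          = opF thetaPlain N n := by
      intro n
      rw [airyMap_single, one_smul]
      simp only [famOp, Nat.cast_zero, add_zero]
    refine ⟨airyMap (famOp thetaPlain N (N - 1) D C₀ 1 0)
        (locFin_famOp thetaPlain_injective N (N - 1) D C₀ 1 0), h1, h2, h0,
      airyMap_mem_weylHat _ (famOp_mem_weylHat inl_mem_range_inclVar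
        inr_thetaPlain_mem_range_inclVar N (N - 1) D C₀ 1 0),
      isSuperQuantumAiry_famOp thetaPlain_injective D C₀ le_rfl (fun _ => rfl)
        (by omega) (by omega) (by omega) (by omega) (by omega) (by omega),
      representsNS thetaPlain_injective D zero_le_one le_rfl (by omega) (by omega) (by omega)
        (by omega) (by omega) (by omega), fun i hi => ?_, fun n => ?_⟩
    · rw [h0, h1 i hi]
      exact superComm_opAux_opHD thetaPlain_injective N (N - 1) D i C₀ (D 0)
    · rw [h0, h2 n]
      exact superComm_opAux_opF thetaPlain_injective N n C₀ (D 0)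
  -- Here e₀ = o₀ = 1. All operators on the right with nonzero coefficient have even index at least
  -- N + 2, so constants are allowed up to R = N + 1.
  · intro N hN D C₀
    have h0 : airyMap (famOp thetaExtra N (N + 1) D C₀ 1 1)
        (locFin_famOp thetaExtra_injective N (N + 1) D C₀ 1 1) (Pi.single (Sum.inl 0) 1)
          = opAux C₀ (D 0) := by
      rw [airyMap_single, one_smul]
      rfl
    have h1 : ∀ i : ℕ, 1 ≤ i → airyMap (famOp thetaExtra N (N + 1) D C₀ 1 1)
        (locFin_famOp thetaExtra_injective N (N + 1) D C₀ 1 1) (Pi.single (Sum.inl i) 1)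
          = opHD thetaExtra N (N + 1) D i := by
      intro i hi
      rw [airyMap_single, one_smul]
      exact if_pos hi
    have h2 : ∀ n : ℕ, airyMap (famOp thetaExtra N (N + 1) D C₀ 1 1)
        (locFin_famOp thetaExtra_injective N (N + 1) D C₀ 1 1) (Pi.single (Sum.inr n) 1)
          = opF thetaExtra N (n + 1) := by
      intro n
      rw [airyMap_single, one_smul]
      simp only [famOp, Nat.cast_one]
    refine ⟨airyMap (famOp thetaExtra N (N + 1) D C₀ 1 1)
        (locFin_famOp thetaExtra_injective N (N + 1) D C₀ 1 1), h1, h2, h0,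
      isSuperQuantumAiry_famOp thetaExtra_injective D C₀ le_rfl (fun _ => rfl)
        (by omega) (by omega) (by omega) (by omega) (by omega) (by omega),
      representsNS thetaExtra_injective D zero_le_one zero_le_one (by omega) (by omega)
        (by omega) (by omega) (by omega) (by omega), fun i hi => ?_, fun n => ?_⟩
    · rw [h0, h1 i hi]
      exact superComm_opAux_opHD thetaExtra_injective N (N + 1) D i C₀ (D 0)
    · rw [h0, h2 n]
      exact superComm_opAux_opF thetaExtra_injective N (n + 1) C₀ (D 0)
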